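/- Let $n,m$ be positive integers, $t_0<T$, let $U\subseteq\mathbb R^m$ be nonempty and compact, and let $f:\mathbb R^n\times U\times[t_0,T]\to\mathbb R^n$ and $F:\mathbb R^n\times U\times[t_0,T]\to\mathbb R$. Call $\omega:\mathbb R_+\times\mathbb R_+\to\mathbb R_+$ a modulus if it is nondecreasing in both arguments and $\lim_{D\to0+}\omega(R,D)=0$ for every $R>0$. Assume: (H1) $f$ and $F$ are continuous, and there is $M>0$ with $\|f(0,u,t)\|\le M$ and $|F(0,u,t)|\le M$ for all $(u,t)\in U\times[t_0,T]$. (H2) There is a nondecreasing $L:\mathbb R_+\to\mathbb R_+$ such that for all $R>0$, $x,y\in\mathbb R^n$ with $\|x\|,\|y\|<R$, $t,s\in[t_0,T]$ and $u\in U$, both $\|f(x,u,t)-f(y,u,s)\|$ and $|F(x,u,t)-F(y,u,s)|$ are at most $L(R)(|t-s|+\|x-y\|)$. (H3) There is a modulus $\omega$ such that for all $R>0$, $\|x\|,\|y\|<R$, $t,s\in[t_0,T]$, $u\in U$ and $\lambda\in[0,1]$, $$\|\lambda f(x,u,t)+(1-\lambda)f(y,u,s)-f(\lambda x+(1-\lambda)y,u,\lambda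 t+(1-\lambda)s)\|\le\lambda(1-\lambda)\,(|t-s|+\|x-y\|)\,\omega(R,|t-s|+\|x-y\|).$$ (H4) There is a modulus $\omega$ such that for the same $R,x,y,t,s,u,\lambda$, $$\lambda F(x,u,t)+(1-\lambda)F(y,u,s)-F(\lambda x+(1-\lambda)y,u,\lambda t+(1-\lambda)s)\le\lambda(1-\lambda)\,(|t-s|+\|x-y\|)\,\omega(R,|t-s|+\|x-y\|).$$ For $\tau\in[t_0,T]$ let $\mathcal U(\tau)$ be the set of Lebesgue measurable $u(\cdot):[\tau,T]\to U$. Assume further that for all $(x^0,\tau)\in\mathbb R^n\times[t_0,T]$ and $u(\cdot)\in\mathcal U(\tau)$ the system $\dot x(t)=f(x(t),u(t),t)$ for a.e. $t\in[\tau,T]$, $x(\tau)=x^0$, has an absolutely continuous solution $x(\cdot)$ on all of $[\tau,T]$ (it is unique by (H2)). Put $$V(x^0,\tau)=\inf_{u(\cdot)\in\mathcal U(\tau)}\int_\tau^TF(x(t),u(t),t)\,dt,\qquad \mathscr H(x,p,u,t)=\langle p,f(x,u,t)\rangle-F(x,u,t).$$ Then $V$ is finite and is an extended solution, in Rozonoer's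 sense, of the Hamilton–Jacobi–Bellman equation $-v_\tau+\sup_{u\in U}\mathscr H(x,-v_x,u,\tau)=0$ with $v(x,T)=0$. This means: $V$ is continuous on $\mathbb R^n\times[t_0,T]$; $V(x,T)=0$ for all $x\in\mathbb R^n$; and for every $(x,\tau)\in\mathbb R^n\times[t_0,T]$ there are $p^*\in\mathbb R^n$ with $-p^*\in\partial_+V_x(x,\tau)$ and $u^*\in U$ such that $\mathscr H(x,p^*,u^*,\tau)\ge\mathscr H(x,p^*,u,\tau)$ for all $u\in U$, and $\mathscr H(x,p^*,u^*,\tau)\in\partial_+V_\tau(x,\tau)$. Here $$\partial_+V_x(x,\tau)=\Big\{p\in\mathbb R^n:\limsup_{y\to x}\frac{V(y,\tau)-V(x,\tau)-\langle p,y-x\rangle}{\|y-x\|}\le0\Big\},$$ $$\partial_+V_\tau(x,\tau)=\Big\{q\in\mathbb R:\limsup_{t\to\tau,\ t\in[t_0,T]}\frac{V(x,t)-V(x,\tau)-q(t-\tau)}{|t-\tau|}\le0\Big\},$$ so that the latter is the right (left) partial superdifferential at $\tau=t_0$ (at $\tau=T$). -/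

import Mathlib

open Set Filter Topology MeasureTheory

/-- The data of the optimal control problem: minimize the Lagrange cost `∫ F(x,u,t) dt` subject to
`ẋ = f(x,u,t)`, `u(t) ∈ U`, on the time interval `[t₀, T]` with `t₀ < T`.  The functions `f` and `F`
are only ever used on `ℝⁿ × U × [t₀, T]`. -/
structure LagrangeOCP (n m : ℕ) where
  /-- The control domain. -/
  U : Set (EuclideanSpace ℝ (Fin m))
  /-- The initial time. -/
  t₀ : ℝ
  /-- The terminal time. -/
  T : ℝ
  /-- The time interval is nondegenerate. -/
  t₀_lt_T : t₀ < T
  /-- The dynamics. -/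
  f : EuclideanSpace ℝ (Fin n) → EuclideanSpace ℝ (Fin m) → ℝ → EuclideanSpace ℝ (Fin n)
  /-- The running cost. -/
  F : EuclideanSpace ℝ (Fin n) → EuclideanSpace ℝ (Fin m) → ℝ → ℝ

/-- A modulus `ω : ℝ₊ × ℝ₊ → ℝ₊`: nonnegative, nondecreasing in both arguments, and
`ω(R, D) → 0` as `D → 0+`, for every `R > 0`. -/
def IsSemiconcavityModulus (ω : ℝ → ℝ → ℝ) : Prop :=
  (∀ r d, 0 ≤ r → 0 ≤ d → 0 ≤ ω r d) ∧
  (∀ r R d D, 0 ≤ r → r ≤ R → 0 ≤ d → d ≤ D → ω r d ≤ ω R D) ∧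
  (∀ R, 0 < R → Tendsto (fun D => ω R D) (𝓝[>] 0) (𝓝 0))

namespace LagrangeOCP

variable {n m : ℕ} (P : LagrangeOCP n m)

/-- Assumption (H1): `f` and `F` are continuous on `ℝⁿ × U × [t₀, T]`, and `f(0,·,·)`, `F(0,·,·)` are
bounded on `U × [t₀, T]`. -/
def H1 : Prop :=
  ContinuousOn
    (fun z : EuclideanSpace ℝ (Fin n) × EuclideanSpace ℝ (Fin m) × ℝ => P.f z.1 z.2.1 z.2.2)
    (univ ×ˢ P.U ×ˢ Icc P.t₀ P.T) ∧
  ContinuousOn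
    (fun z : EuclideanSpace ℝ (Fin n) × EuclideanSpace ℝ (Fin m) × ℝ => P.F z.1 z.2.1 z.2.2)
    (univ ×ˢ P.U ×ˢ Icc P.t₀ P.T) ∧
  ∃ M : ℝ, 0 < M ∧ ∀ u ∈ P.U, ∀ t ∈ Icc P.t₀ P.T, ‖P.f 0 u t‖ ≤ M ∧ |P.F 0 u t| ≤ M

/-- Assumption (H2): `f(·,u,·)` and `F(·,u,·)` are locally Lipschitz, uniformly in `u ∈ U`, with a
nondecreasing function `L : ℝ₊ → ℝ₊` of Lipschitz constants. -/
def H2 : Prop :=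
  ∃ L : ℝ → ℝ, (∀ r, 0 ≤ r → 0 ≤ L r) ∧ (∀ r R, 0 ≤ r → r ≤ R → L r ≤ L R) ∧
    ∀ R : ℝ, 0 < R → ∀ x ∈ Metric.ball (0 : EuclideanSpace ℝ (Fin n)) R,
      ∀ y ∈ Metric.ball (0 : EuclideanSpace ℝ (Fin n)) R,
      ∀ t ∈ Icc P.t₀ P.T, ∀ s ∈ Icc P.t₀ P.T, ∀ u ∈ P.U,
        ‖P.f x u t - P.f y u s‖ ≤ L R * (|t - s| + ‖x - y‖) ∧
        |P.F x u t - P.F y u s| ≤ L R * (|t - s| + ‖x - y‖)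

/-- Assumption (H3): the two-sided semiconcavity-type condition on `f`, uniform in `u ∈ U`. -/
def H3 : Prop :=
  ∃ ω : ℝ → ℝ → ℝ, IsSemiconcavityModulus ω ∧
    ∀ R : ℝ, 0 < R → ∀ x ∈ Metric.ball (0 : EuclideanSpace ℝ (Fin n)) R,
      ∀ y ∈ Metric.ball (0 : EuclideanSpace ℝ (Fin n)) R,
      ∀ t ∈ Icc P.t₀ P.T, ∀ s ∈ Icc P.t₀ P.T, ∀ u ∈ P.U, ∀ l ∈ Icc (0 : ℝ) 1,
        ‖l • P.f x u t + (1 - l) • P.f y u s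
            - P.f (l • x + (1 - l) • y) u (l * t + (1 - l) * s)‖
          ≤ l * (1 - l) * (|t - s| + ‖x - y‖) * ω R (|t - s| + ‖x - y‖)

/-- Assumption (H4): `F(·,u,·)` is semiconcave on `ℝⁿ × [t₀, T]`, uniformly in `u ∈ U`. -/
def H4 : Prop :=
  ∃ ω : ℝ → ℝ → ℝ, IsSemiconcavityModulus ω ∧
    ∀ R : ℝ, 0 < R → ∀ x ∈ Metric.ball (0 : EuclideanSpace ℝ (Fin n)) R,
      ∀ y ∈ Metric.ball (0 : EuclideanSpace ℝ (Fin n)) R,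
      ∀ t ∈ Icc P.t₀ P.T, ∀ s ∈ Icc P.t₀ P.T, ∀ u ∈ P.U, ∀ l ∈ Icc (0 : ℝ) 1,
        l * P.F x u t + (1 - l) * P.F y u s
            - P.F (l • x + (1 - l) • y) u (l * t + (1 - l) * s)
          ≤ l * (1 - l) * (|t - s| + ‖x - y‖) * ω R (|t - s| + ‖x - y‖)

/-- Admissible controls with initial time `τ`: Lebesgue measurable maps `[τ, T] → U`.
(Values of `u` outside `[τ, T]` are irrelevant.) -/
def IsAdmissibleControl (τ : ℝ) (u : ℝ → EuclideanSpace ℝ (Fin m)) : Prop :=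
  AEMeasurable u (volume.restrict (Icc τ P.T)) ∧ ∀ t ∈ Icc τ P.T, u t ∈ P.U

/-- `x` is a (Carathéodory) solution on `[τ, T]` of `ẋ = f(x,u(t),t)`, `x(τ) = x⁰`. -/
def IsTrajectory (x₀ : EuclideanSpace ℝ (Fin n)) (τ : ℝ) (u : ℝ → EuclideanSpace ℝ (Fin m))
    (x : ℝ → EuclideanSpace ℝ (Fin n)) : Prop :=
  ContinuousOn x (Icc τ P.T) ∧
  IntervalIntegrable (fun s => P.f (x s) (u s) s) volume τ P.T ∧
  ∀ t ∈ Icc τ P.T, x t = x₀ + ∫ s in τ..t, P.f (x s) (u s) s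

/-- For all initial data and all admissible controls, the controlled system has a solution on the
whole interval `[τ, T]` (no blow-up in finite time). -/
def HasGlobalTrajectories : Prop :=
  ∀ x₀ : EuclideanSpace ℝ (Fin n), ∀ τ ∈ Icc P.t₀ P.T, ∀ u : ℝ → EuclideanSpace ℝ (Fin m),
    P.IsAdmissibleControl τ u → ∃ x, P.IsTrajectory x₀ τ u x

/-- The set of all costs `∫_τ^T F(x(t),u(t),t) dt` of admissible controls from `(x⁰, τ)`. -/
def costSet (x₀ : EuclideanSpace ℝ (Fin n)) (τ : ℝ) : Set ℝ :=
  {J | ∃ u x, P.IsAdmissibleControl τ u ∧ P.IsTrajectory x₀ τ u x ∧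
    J = ∫ t in τ..P.T, P.F (x t) (u t) t}

/-- The value (Bellman) function. -/
noncomputable def value (x₀ : EuclideanSpace ℝ (Fin n)) (τ : ℝ) : ℝ :=
  sInf (P.costSet x₀ τ)

/-- The control Hamiltonian `ℋ(x,p,u,t) = ⟨p, f(x,u,t)⟩ - F(x,u,t)`. -/
noncomputable def hamiltonian (x p : EuclideanSpace ℝ (Fin n)) (u : EuclideanSpace ℝ (Fin m))
    (t : ℝ) : ℝ :=
  inner ℝ p (P.f x u t) - P.F x u t

/-- The partial superdifferential of `φ` at `(x, τ)` with respect to `x`. -/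
def superdiffX (φ : EuclideanSpace ℝ (Fin n) → ℝ → ℝ) (x : EuclideanSpace ℝ (Fin n)) (τ : ℝ) :
    Set (EuclideanSpace ℝ (Fin n)) :=
  {p | limsup (fun y => (((φ y τ - φ x τ - inner ℝ p (y - x)) / ‖y - x‖ : ℝ) : EReal)) (𝓝[≠] x) ≤ 0}

/-- The partial superdifferential, at `(x, τ)` and with respect to `τ`, of a function `φ` on
`ℝⁿ × [t₀, T]`.  The limit is taken over `t ∈ [t₀, T]`, `t ≠ τ`, so that it is two-sided for
`τ ∈ (t₀, T)`, and is the right (left) partial superdifferential at `τ = t₀` (at `τ = T`). -/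
def superdiffTime (t₀ T : ℝ) (φ : EuclideanSpace ℝ (Fin n) → ℝ → ℝ)
    (x : EuclideanSpace ℝ (Fin n)) (τ : ℝ) : Set ℝ :=
  {q | limsup (fun t => (((φ x t - φ x τ - q * (t - τ)) / |t - τ| : ℝ) : EReal))
    (𝓝[Icc t₀ T \ {τ}] τ) ≤ 0}

/-- `v : ℝⁿ × [t₀, T] → ℝ` is an extended solution (in the sense of Rozonoer) of
`-v_τ + sup_{u ∈ U} ℋ(x, -v_x, u, τ) = 0`, `v(x, T) = 0`. -/
def IsExtendedSolution (v : EuclideanSpace ℝ (Fin n) → ℝ → ℝ) : Prop :=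
  ContinuousOn (fun z : EuclideanSpace ℝ (Fin n) × ℝ => v z.1 z.2) (univ ×ˢ Icc P.t₀ P.T) ∧
  (∀ x : EuclideanSpace ℝ (Fin n), ∀ τ ∈ Icc P.t₀ P.T,
    ∃ p : EuclideanSpace ℝ (Fin n), -p ∈ superdiffX v x τ ∧
      ∃ u ∈ P.U, (∀ w ∈ P.U, P.hamiltonian x p w τ ≤ P.hamiltonian x p u τ) ∧
        P.hamiltonian x p u τ ∈ superdiffTime P.t₀ P.T v x τ) ∧
  ∀ x : EuclideanSpace ℝ (Fin n), v x P.T = 0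

end LagrangeOCP

/-! Everything rests on the joint semiconcavity of the value function `V` in space and time. It
provides supergradients: linear functionals `p` on space-time with `V b ≤ V a + p (b - a) + o(‖b -
a‖)`. At `(x, τ)` with `τ < T` one needs a supergradient whose pre-Hamiltonian `w ↦ p (f(x,w,τ), 1)
+ F(x,w,τ)` has minimum zero over `U`. The Hamiltonian at minus the spatial part of `p` is the time
part of `p` minus the pre-Hamiltonian, so a minimiser is the required control value and the maximal
Hamiltonian is the time part of `p`.

At every supergradient the pre-Hamiltonian is nonnegative: run a constant control and use one half
of dynamic programming (`IsSupergradient.preHamiltonian_nonneg`). For the reverse inequality the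
supergradient must be chosen. Follow a nearly optimal trajectory for a short time, take a
supergradient at the point reached, and test it backwards at `(x, τ)`; the other half of dynamic
programming makes the pre-Hamiltonian at most `ε` at some control value
(`exists_approx_supergradient`). These supergradients are bounded by a Lipschitz constant and share
one error modulus on a whole region, so compactness gives a limit. The points reached are interior
in time, which also settles `τ = t₀`. The terminal time is treated directly.

For semiconcavity (`exists_value_semiconcave`), time is rescaled affinely to `[0, 1]`: the initial
time becomes a parameter and one control serves all initial data. A nearly optimal control for a
convex combination of two data is reused at both of them. By (H3) and Gronwall the combined
trajectories differ from the trajectory of the combination by a semiconcavity-type error, and (H4)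
then compares the costs.

Uniform constants require trajectories from a bounded set to be uniformly bounded, although only the
existence of each single one is assumed (`exists_trajectory_bound`). If this failed, one could steer
from a point of unboundedness onto a neighbourhood of a later one, and so on. For the concatenated
control, some trajectory passes near all these points. It is bounded, so the time steps are bounded
below and the times exceed `T`, a contradiction. -/

/-! ### Gronwall's inequality, measurability, local bounds -/

/-- Gronwall's inequality in integral form. -/
theorem le_mul_exp_of_le_add_mul_integral {φ : ℝ → ℝ} {A K a b : ℝ} (hK : 0 ≤ K)
    (hφ : ContinuousOn φ (Icc a b)) (h : ∀ t ∈ Icc a b, φ t ≤ A + K * ∫ s in a..t, φ s) :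
    ∀ t ∈ Icc a b, φ t ≤ A * Real.exp (K * (t - a)) := by
  intro t ht
  have hab : a ≤ b := ht.1.trans ht.2
  have hint : IntervalIntegrable φ volume a b :=
    (hφ.mono (by rw [uIcc_of_le hab])).intervalIntegrable
  have hprim : ContinuousOn (fun t => ∫ s in a..t, φ s) (Icc a b) := by
    have := intervalIntegral.continuousOn_primitive_interval (μ := volume) (f := φ) (a := a) (b := b)
      (by rw [uIcc_of_le hab]; exact hφ.integrableOn_Icc)
    rwa [uIcc_of_le hab] at this
  -- The differential inequality is applied to the majorant, which has a right derivative; `φ`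
  -- itself is only continuous.
  have key := le_gronwallBound_of_liminf_deriv_right_le (f := fun t => A + K * ∫ s in a..t, φ s)
    (f' := fun t => K * φ t) (δ := A) (K := K) (ε := 0) (a := a) (b := b)
    (continuousOn_const.add (continuousOn_const.mul hprim)) ?_ (by simp) ?_ t ht
  · rw [gronwallBound_ε0] at key
    exact (h t ht).trans key
  · intro x hx r hr
    have hd : HasDerivWithinAt (fun t => A + K * ∫ s in a..t, φ s) (K * φ x) (Ici x) x := by
      refine HasDerivWithinAt.const_add _ (HasDerivWithinAt.const_mul _ ?_)
      have hx' : Icc x b ∈ 𝓝[≥] x := Icc_mem_nhdsGE hx.2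
      have hcx : ContinuousWithinAt φ (Ici x) x :=
        ((hφ x (Ico_subset_Icc_self hx)).mono (Icc_subset_Icc_left hx.1)).mono_of_mem_nhdsWithin hx'
      refine intervalIntegral.integral_hasDerivWithinAt_right
        (hint.mono_set (by
          rw [uIcc_of_le hab, uIcc_of_le hx.1]; exact Icc_subset_Icc_right hx.2.le)) ?_
        (s := Ici x) (t := Ioi x) (hcx.mono Ioi_subset_Ici_self)
      refine ⟨Ioc x b, Ioc_mem_nhdsGT hx.2, ?_⟩
      exact ((hφ.mono (Ioc_subset_Icc_self.trans
        (Icc_subset_Icc_left hx.1))).aestronglyMeasurable measurableSet_Ioc)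
    exact hd.liminf_right_slope_le hr
  · intro x hx
    have := h x (Ico_subset_Icc_self hx)
    simp only [add_zero]
    exact mul_le_mul_of_nonneg_left this hK

namespace LagrangeOCP

variable {n m : ℕ} {P : LagrangeOCP n m}

/-- Composing a function continuous on `ℝⁿ × U × [t₀, T]` with a continuous curve and a measurable
control gives an integrable function. -/
theorem intervalIntegrable_comp {G : Type*} [NormedAddCommGroup G] [SecondCountableTopology G]
    {g : EuclideanSpace ℝ (Fin n) → EuclideanSpace ℝ (Fin m) → ℝ → G} (hUc : IsCompact P.U)
    (hg : ContinuousOn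
      (fun z : EuclideanSpace ℝ (Fin n) × EuclideanSpace ℝ (Fin m) × ℝ => g z.1 z.2.1 z.2.2)
      (univ ×ˢ P.U ×ˢ Icc P.t₀ P.T))
    {a b : ℝ} (hab : a ≤ b) {z : ℝ → EuclideanSpace ℝ (Fin n)} {v : ℝ → EuclideanSpace ℝ (Fin m)}
    {θ : ℝ → ℝ} (hz : ContinuousOn z (Icc a b)) (hv : AEMeasurable v (volume.restrict (Icc a b)))
    (hvU : ∀ s ∈ Icc a b, v s ∈ P.U) (hθ : ContinuousOn θ (Icc a b))
    (hθm : MapsTo θ (Icc a b) (Icc P.t₀ P.T)) :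
    IntervalIntegrable (fun s => g (z s) (v s) (θ s)) volume a b := by
  rw [intervalIntegrable_iff_integrableOn_Icc_of_le hab]
  set μ := volume.restrict (Icc a b) with hμ
  set S : Set (EuclideanSpace ℝ (Fin n) × EuclideanSpace ℝ (Fin m) × ℝ) :=
    univ ×ˢ P.U ×ˢ Icc P.t₀ P.T with hS
  have hSm : MeasurableSet S :=
    (isClosed_univ.prod (hUc.isClosed.prod isClosed_Icc)).measurableSet
  set φ : ℝ → EuclideanSpace ℝ (Fin n) × EuclideanSpace ℝ (Fin m) × ℝ :=
    fun s => (z s, v s, θ s) with hφ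
  have hφm : AEMeasurable φ μ :=
    (hz.aemeasurable measurableSet_Icc).prodMk (hv.prodMk (hθ.aemeasurable measurableSet_Icc))
  have hφS : ∀ᵐ s ∂μ, φ s ∈ S := by
    filter_upwards [ae_restrict_mem measurableSet_Icc] with s hs
    exact ⟨mem_univ _, hvU s hs, hθm hs⟩
  -- Continuity is known only on `S`, so measurability is obtained for the push-forward of `μ`,
  -- which is carried by `S`, and then pulled back along `φ`.
  have hres : (μ.map φ).restrict S = μ.map φ := by
    apply Measure.restrict_eq_self_of_ae_mem
    exact (ae_map_iff hφm hSm).2 hφS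
  have hmeas : AEStronglyMeasurable (fun s => g (z s) (v s) (θ s)) μ := by
    have h0 := hg.aestronglyMeasurable (μ := μ.map φ) hSm
    rw [hres] at h0
    exact h0.comp_aemeasurable hφm
  obtain ⟨R, hR⟩ := (isCompact_Icc.image_of_continuousOn hz).isBounded.subset_closedBall 0
  have hcomp : IsCompact ((Metric.closedBall (0 : EuclideanSpace ℝ (Fin n)) R) ×ˢ P.U ×ˢ
      Icc P.t₀ P.T) := (isCompact_closedBall _ _).prod (hUc.prod isCompact_Icc)
  obtain ⟨C, hC⟩ := hcomp.exists_bound_of_continuousOn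
    (hg.mono (prod_mono (subset_univ _) subset_rfl))
  refine Integrable.of_bound hmeas C ?_
  filter_upwards [ae_restrict_mem measurableSet_Icc] with s hs
  exact hC (z s, v s, θ s) ⟨hR (mem_image_of_mem z hs), hvU s hs, hθm hs⟩

/-- `K R` bounds `f`, `F` and their Lipschitz constants on the ball of radius `R`. -/
structure IsLocalBound (P : LagrangeOCP n m) (K : ℝ → ℝ) : Prop where
  one_le : ∀ R, 0 ≤ R → 1 ≤ K R
  mono : ∀ r R, 0 ≤ r → r ≤ R → K r ≤ K R
  f_le : ∀ {R : ℝ} {x : EuclideanSpace ℝ (Fin n)} {u : EuclideanSpace ℝ (Fin m)} {t : ℝ},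
    ‖x‖ < R → u ∈ P.U → t ∈ Icc P.t₀ P.T → ‖P.f x u t‖ ≤ K R
  F_le : ∀ {R : ℝ} {x : EuclideanSpace ℝ (Fin n)} {u : EuclideanSpace ℝ (Fin m)} {t : ℝ},
    ‖x‖ < R → u ∈ P.U → t ∈ Icc P.t₀ P.T → |P.F x u t| ≤ K R
  f_sub_le : ∀ {R : ℝ} {x y : EuclideanSpace ℝ (Fin n)} {u : EuclideanSpace ℝ (Fin m)} {t s : ℝ},
    ‖x‖ < R → ‖y‖ < R → u ∈ P.U → t ∈ Icc P.t₀ P.T → s ∈ Icc P.t₀ P.T →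
      ‖P.f x u t - P.f y u s‖ ≤ K R * (|t - s| + ‖x - y‖)
  F_sub_le : ∀ {R : ℝ} {x y : EuclideanSpace ℝ (Fin n)} {u : EuclideanSpace ℝ (Fin m)} {t s : ℝ},
    ‖x‖ < R → ‖y‖ < R → u ∈ P.U → t ∈ Icc P.t₀ P.T → s ∈ Icc P.t₀ P.T →
      |P.F x u t - P.F y u s| ≤ K R * (|t - s| + ‖x - y‖)

/-- Comparison with the point `0` bounds `f` and `F` by `M + L R * R`; the sum `1 + M + L R * (1 +
R)` dominates this and the Lipschitz constant `L R`. The summand `1` keeps `K` away from zero, which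
the tube time and the space-time estimates need. -/
theorem exists_isLocalBound (h1 : P.H1) (h2 : P.H2) : ∃ K, P.IsLocalBound K := by
  obtain ⟨-, -, M, hM, hb⟩ := h1
  obtain ⟨L, hL0, hLm, hL⟩ := h2
  have hLK : ∀ R, 0 ≤ R → L R ≤ 1 + M + L R * (1 + R) := fun R hR => by
    nlinarith [hL0 R hR, mul_nonneg (hL0 R hR) hR]
  have hball : ∀ {R : ℝ} {x : EuclideanSpace ℝ (Fin n)}, ‖x‖ < R → 0 < R ∧ x ∈ Metric.ball 0 R ∧
      (0 : EuclideanSpace ℝ (Fin n)) ∈ Metric.ball 0 R := fun {R x} hx =>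
    have : 0 < R := (norm_nonneg x).trans_lt hx
    ⟨this, by simpa using hx, by simpa using this⟩
  refine ⟨fun R => 1 + M + L R * (1 + R), ⟨?_, ?_, ?_, ?_, ?_, ?_⟩⟩
  · intro R hR
    nlinarith [mul_nonneg (hL0 R hR) (by linarith : 0 ≤ 1 + R)]
  · intro r R hr hrR
    have := mul_le_mul (hLm r R hr hrR) (by linarith : 1 + r ≤ 1 + R) (by linarith)
      (hL0 R (hr.trans hrR))
    linarith
  · intro R x u t hx hu ht
    obtain ⟨hR, hxR, h0R⟩ := hball hx
    have e1 := (hL R hR x hxR 0 h0R t ht t ht u hu).1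
    have e2 := (hb u hu t ht).1
    have e3 := norm_le_norm_add_norm_sub' (P.f x u t) (P.f 0 u t)
    simp only [sub_self, abs_zero, zero_add, sub_zero] at e1
    have := mul_le_mul_of_nonneg_left hx.le (hL0 R hR.le)
    have := hL0 R hR.le
    linarith
  · intro R x u t hx hu ht
    obtain ⟨hR, hxR, h0R⟩ := hball hx
    have e1 := (hL R hR x hxR 0 h0R t ht t ht u hu).2
    have e2 := (hb u hu t ht).2
    have e3 := norm_le_norm_add_norm_sub' (P.F x u t) (P.F 0 u t)
    simp only [Real.norm_eq_abs] at e3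
    simp only [sub_self, abs_zero, zero_add, sub_zero] at e1
    have := mul_le_mul_of_nonneg_left hx.le (hL0 R hR.le)
    have := hL0 R hR.le
    linarith
  · intro R x y u t s hx hy hu ht hs
    obtain ⟨hR, hxR, -⟩ := hball hx
    exact ((hL R hR x hxR y (hball hy).2.1 t ht s hs u hu).1).trans
      (mul_le_mul_of_nonneg_right (hLK R hR.le) (by positivity))
  · intro R x y u t s hx hy hu ht hs
    obtain ⟨hR, hxR, -⟩ := hball hx
    exact ((hL R hR x hxR y (hball hy).2.1 t ht s hs u hu).2).trans
      (mul_le_mul_of_nonneg_right (hLK R hR.le) (by positivity))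

/-! ### Trajectories: restriction, continuous dependence, uniqueness -/

section Trajectory

variable {x₀ y₀ : EuclideanSpace ℝ (Fin n)} {τ σ t : ℝ} {u w : ℝ → EuclideanSpace ℝ (Fin m)}
  {X Y : ℝ → EuclideanSpace ℝ (Fin n)} {K : ℝ → ℝ} {R : ℝ}

theorem IsAdmissibleControl.mono (hu : P.IsAdmissibleControl τ u) (h : τ ≤ σ) :
    P.IsAdmissibleControl σ u :=
  ⟨hu.1.mono_measure (Measure.restrict_mono (Icc_subset_Icc_left h) le_rfl),
    fun t ht => hu.2 t ⟨h.trans ht.1, ht.2⟩⟩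

theorem isAdmissibleControl_const {c : EuclideanSpace ℝ (Fin m)} (hc : c ∈ P.U) (τ : ℝ) :
    P.IsAdmissibleControl τ fun _ => c :=
  ⟨aemeasurable_const, fun _ _ => hc⟩

theorem IsTrajectory.apply_left (hX : P.IsTrajectory x₀ τ u X) (hτ : τ ≤ P.T) : X τ = x₀ := by
  simpa using hX.2.2 τ ⟨le_rfl, hτ⟩

theorem IsTrajectory.integrable (hX : P.IsTrajectory x₀ τ u X) {a b : ℝ} (ha : τ ≤ a) (hab : a ≤ b)
    (hb : b ≤ P.T) : IntervalIntegrable (fun s => P.f (X s) (u s) s) volume a b :=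
  hX.2.1.mono_set (by
    rw [uIcc_of_le hab, uIcc_of_le (ha.trans (hab.trans hb))]; exact Icc_subset_Icc ha hb)

theorem IsTrajectory.integrable_cost (hUc : IsCompact P.U) (h1 : P.H1)
    (hX : P.IsTrajectory x₀ τ u X) (hu : P.IsAdmissibleControl τ u) (hτ : P.t₀ ≤ τ) {a b : ℝ}
    (ha : τ ≤ a) (hab : a ≤ b) (hb : b ≤ P.T) :
    IntervalIntegrable (fun s => P.F (X s) (u s) s) volume a b := by
  have hs : Icc a b ⊆ Icc τ P.T := Icc_subset_Icc ha hb
  exact intervalIntegrable_comp hUc h1.2.1 hab (hX.1.mono hs)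
    (hu.1.mono_measure (Measure.restrict_mono hs le_rfl)) (fun s h => hu.2 s (hs h))
    continuousOn_id fun s h => ⟨hτ.trans (hs h).1, (hs h).2⟩

theorem IsTrajectory.sub_eq (hX : P.IsTrajectory x₀ τ u X) {a b : ℝ} (ha : τ ≤ a) (hab : a ≤ b)
    (hb : b ≤ P.T) : X b - X a = ∫ s in a..b, P.f (X s) (u s) s := by
  rw [hX.2.2 b ⟨ha.trans hab, hb⟩, hX.2.2 a ⟨ha, hab.trans hb⟩, add_sub_add_left_eq_sub,
    ← intervalIntegral.integral_add_adjacent_intervals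
      (hX.integrable le_rfl ha (hab.trans hb)) (hX.integrable ha hab hb), add_sub_cancel_left]

theorem IsTrajectory.restrict (hX : P.IsTrajectory x₀ τ u X) (h : τ ≤ σ) (hσ : σ ≤ P.T) :
    P.IsTrajectory (X σ) σ u X := by
  refine ⟨hX.1.mono (Icc_subset_Icc_left h), hX.integrable h hσ le_rfl, fun t ht => ?_⟩
  rw [← hX.sub_eq h ht.1 ht.2, add_sub_cancel]

theorem IsTrajectory.exists_norm_lt (hX : P.IsTrajectory x₀ τ u X) :
    ∃ R, ∀ t ∈ Icc τ P.T, ‖X t‖ < R := by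
  obtain ⟨C, hC⟩ := isCompact_Icc.exists_bound_of_continuousOn hX.1
  exact ⟨C + 1, fun t ht => (hC t ht).trans_lt (lt_add_one C)⟩

/-- Continuous dependence on the initial point, for two controls that agree up to time `t`. -/
theorem IsTrajectory.norm_sub_le (hK : P.IsLocalBound K) (hτ : P.t₀ ≤ τ)
    (hX : P.IsTrajectory x₀ τ u X) (hu : P.IsAdmissibleControl τ u)
    (hY : P.IsTrajectory y₀ τ w Y) (huw : EqOn u w (Ioc τ t)) (ht : t ≤ P.T)
    (hXR : ∀ s ∈ Icc τ t, ‖X s‖ < R) (hYR : ∀ s ∈ Icc τ t, ‖Y s‖ < R) :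
    ∀ s ∈ Icc τ t, ‖X s - Y s‖ ≤ ‖x₀ - y₀‖ * Real.exp (K R * (s - τ)) ∧
      ‖(X s - x₀) - (Y s - y₀)‖ ≤ K R * ∫ r in τ..s, ‖X r - Y r‖ := by
  intro s₀ hs₀
  have hR : 0 ≤ R := (norm_nonneg _).trans (hXR s₀ hs₀).le
  have hsub : Icc τ t ⊆ Icc τ P.T := Icc_subset_Icc_right ht
  have hcont : ContinuousOn (fun s => ‖X s - Y s‖) (Icc τ t) :=
    ((hX.1.mono hsub).sub (hY.1.mono hsub)).norm
  -- Comparing displacements rather than positions shows later that the flow over a short time is a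
  -- small Lipschitz perturbation of the identity.
  have hsec : ∀ s ∈ Icc τ t, ‖(X s - x₀) - (Y s - y₀)‖ ≤ K R * ∫ r in τ..s, ‖X r - Y r‖ := by
    intro s hs
    rw [hX.2.2 s (hsub hs), hY.2.2 s (hsub hs), add_sub_cancel_left, add_sub_cancel_left,
      ← intervalIntegral.integral_sub (hX.integrable le_rfl hs.1 (hs.2.trans ht))
        (hY.integrable le_rfl hs.1 (hs.2.trans ht)), ← intervalIntegral.integral_const_mul]
    refine intervalIntegral.norm_integral_le_of_norm_le hs.1 ?_ ?_
    · refine Eventually.of_forall fun r hr => ?_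
      have hr' : r ∈ Icc τ t := ⟨hr.1.le, hr.2.trans hs.2⟩
      rw [← huw ⟨hr.1, hr'.2⟩]
      have := hK.f_sub_le (hXR r hr') (hYR r hr') (hu.2 r (hsub hr'))
        (t := r) (s := r) ⟨hτ.trans hr'.1, hr'.2.trans ht⟩ ⟨hτ.trans hr'.1, hr'.2.trans ht⟩
      simpa using this
    · exact ((hcont.mono (by
        rw [uIcc_of_le hs.1]; exact Icc_subset_Icc_right hs.2)).intervalIntegrable).const_mul _
  refine ⟨?_, hsec s₀ hs₀⟩
  refine le_mul_exp_of_le_add_mul_integral (zero_le_one.trans (hK.one_le R hR)) hcont ?_ s₀ hs₀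
  intro s hs
  have h1 : X s - Y s = (x₀ - y₀) + ((X s - x₀) - (Y s - y₀)) := by abel
  calc ‖X s - Y s‖ ≤ ‖x₀ - y₀‖ + ‖(X s - x₀) - (Y s - y₀)‖ := by
        conv_lhs => rw [h1]
        exact norm_add_le _ _
    _ ≤ _ := by linarith [hsec s hs]

/-- Agreement of the controls on a half-open interval suffices, since integrals ignore the initial
instant; this is the form met when controls are concatenated. -/
theorem IsTrajectory.eqOn (hK : P.IsLocalBound K) (hτ : P.t₀ ≤ τ)
    (hX : P.IsTrajectory x₀ τ u X) (hu : P.IsAdmissibleControl τ u)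
    (hY : P.IsTrajectory x₀ τ w Y) (huw : EqOn u w (Ioc τ t)) (ht : t ≤ P.T) :
    EqOn X Y (Icc τ t) := by
  intro s hs
  obtain ⟨R, hR⟩ := hX.exists_norm_lt
  obtain ⟨R', hR'⟩ := hY.exists_norm_lt
  have := (hX.norm_sub_le (R := max R R') hK hτ hu hY huw ht
    (fun s hs => (hR s ⟨hs.1, hs.2.trans ht⟩).trans_le (le_max_left _ _))
    (fun s hs => (hR' s ⟨hs.1, hs.2.trans ht⟩).trans_le (le_max_right _ _)) s hs).1
  simpa [sub_eq_zero] using this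

/-- The norm bound is required only on the open interval, so that the estimate can be used up to a
first exit time. -/
theorem IsTrajectory.norm_apply_sub_le (hK : P.IsLocalBound K) (hτ : P.t₀ ≤ τ)
    (hX : P.IsTrajectory x₀ τ u X) (hu : P.IsAdmissibleControl τ u) {a b : ℝ} (ha : τ ≤ a)
    (hab : a ≤ b) (hb : b ≤ P.T) (hXR : ∀ s ∈ Ioo a b, ‖X s‖ < R) :
    ‖X b - X a‖ ≤ K R * (b - a) := by
  rw [hX.sub_eq ha hab hb]
  refine (intervalIntegral.norm_integral_le_of_norm_le_const_ae (C := K R) ?_).trans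
    (by rw [abs_of_nonneg (sub_nonneg.2 hab)])
  have hne : ∀ᵐ s : ℝ, s ≠ b := by simp [ae_iff]
  filter_upwards [hne] with s hsb hs
  rw [uIoc_of_le hab] at hs
  exact hK.f_le (hXR s ⟨hs.1, lt_of_le_of_ne hs.2 hsb⟩) (hu.2 s ⟨ha.trans hs.1.le, hs.2.trans hb⟩)
    ⟨hτ.trans (ha.trans hs.1.le), hs.2.trans hb⟩

end Trajectory

/-! ### Confinement over short times -/

/-- A time during which no trajectory starting within `1` of `a` leaves the ball of radius `2`
around `a`. -/
noncomputable def tubeTime (K : ℝ → ℝ) (a : EuclideanSpace ℝ (Fin n)) : ℝ :=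
  (4 * K (‖a‖ + 3))⁻¹

theorem IsLocalBound.one_le_add {K : ℝ → ℝ} (hK : P.IsLocalBound K)
    (a : EuclideanSpace ℝ (Fin n)) : 1 ≤ K (‖a‖ + 3) :=
  hK.one_le _ (by positivity)

theorem IsLocalBound.tubeTime_pos {K : ℝ → ℝ} (hK : P.IsLocalBound K)
    (a : EuclideanSpace ℝ (Fin n)) : 0 < tubeTime K a := by
  have := hK.one_le_add a
  exact inv_pos.2 (by linarith)

theorem IsLocalBound.mul_tubeTime {K : ℝ → ℝ} (hK : P.IsLocalBound K)
    (a : EuclideanSpace ℝ (Fin n)) : K (‖a‖ + 3) * tubeTime K a = 1 / 4 := by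
  have := hK.one_le_add a
  have h : K (‖a‖ + 3) ≠ 0 := by linarith
  unfold tubeTime
  field_simp

section

variable {x₀ a : EuclideanSpace ℝ (Fin n)} {τ σ t : ℝ} {u : ℝ → EuclideanSpace ℝ (Fin m)}
  {X : ℝ → EuclideanSpace ℝ (Fin n)} {K : ℝ → ℝ}

/-- First-exit argument: until distance `2` is reached the speed is at most `K (‖a‖ + 3)`, so within
the tube time the trajectory moves by at most `1 / 4`, too little to get from distance `1` to
distance `2`. -/
theorem IsTrajectory.norm_sub_le_two (hK : P.IsLocalBound K) (hτ : P.t₀ ≤ τ)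
    (hX : P.IsTrajectory x₀ τ u X) (hu : P.IsAdmissibleControl τ u) (hσ : τ ≤ σ)
    (ha : ‖X σ - a‖ ≤ 1) (hσt : σ ≤ t) (ht : t ≤ P.T) (htσ : t ≤ σ + tubeTime K a) :
    ‖X t - a‖ ≤ 2 := by
  by_contra! hcon
  have hc : ContinuousOn (fun s => ‖X s - a‖) (Icc σ t) :=
    ((hX.1.mono (Icc_subset_Icc hσ ht)).sub continuousOn_const).norm
  have hcl : IsCompact {s ∈ Icc σ t | 2 ≤ ‖X s - a‖} := by
    refine isCompact_Icc.of_isClosed_subset ?_ (sep_subset _ _)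
    exact isClosed_Icc.isClosed_le continuousOn_const hc
  obtain ⟨s, ⟨hs, hs2⟩, hmin⟩ := hcl.exists_isLeast ⟨t, ⟨hσt, le_rfl⟩, hcon.le⟩
  have hin : ∀ r ∈ Ioo σ s, ‖X r‖ < ‖a‖ + 3 := by
    intro r hr
    have h2 : ‖X r - a‖ < 2 := by
      by_contra! h
      exact absurd (hmin ⟨⟨hr.1.le, hr.2.le.trans hs.2⟩, h⟩) (not_le.2 hr.2)
    have := norm_le_norm_add_norm_sub' (X r) a
    linarith
  have hd := hX.norm_apply_sub_le hK hτ hu hσ hs.1 (hs.2.trans ht) hin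
  have h4 : K (‖a‖ + 3) * (s - σ) ≤ 1 / 4 := by
    rw [← hK.mul_tubeTime a]
    have := hK.one_le_add a
    exact mul_le_mul_of_nonneg_left (by linarith [hs.2]) (by linarith)
  have h5 : ‖X s - a‖ ≤ ‖X s - X σ‖ + ‖X σ - a‖ := norm_sub_le_norm_sub_add_norm_sub _ _ _
  linarith

theorem IsTrajectory.norm_lt_add_three (hK : P.IsLocalBound K) (hτ : P.t₀ ≤ τ)
    (hX : P.IsTrajectory x₀ τ u X) (hu : P.IsAdmissibleControl τ u) (hσ : τ ≤ σ)
    (ha : ‖X σ - a‖ ≤ 1) (hσt : σ ≤ t) (ht : t ≤ P.T) (htσ : t ≤ σ + tubeTime K a) :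
    ‖X t‖ < ‖a‖ + 3 := by
  have h1 := hX.norm_sub_le_two hK hτ hu hσ ha hσt ht htσ
  have h2 := norm_le_norm_add_norm_sub' (X t) a
  linarith

end

/-! ### Uniform boundedness of trajectories -/

/-- The trajectories issuing at time `τ` from any neighbourhood of `a` are unbounded. -/
def IsUnboundedAt (P : LagrangeOCP n m) (a : EuclideanSpace ℝ (Fin n)) (τ : ℝ) : Prop :=
  τ ∈ Icc P.t₀ P.T ∧ ∀ δ > 0, ∀ N : ℝ, ∃ x u X, ‖x - a‖ ≤ δ ∧ P.IsAdmissibleControl τ u ∧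
    P.IsTrajectory x τ u X ∧ ∃ t ∈ Icc τ P.T, N < ‖X t‖

/-- Confinement delays the large values beyond `σ + tubeTime K a / 2`. At that common time the
positions lie in a compact ball, and at a limit point of them the tails of the same trajectories
witness unboundedness. Half a tube time leaves room for initial times differing from `σ` by up to
the other half. -/
theorem exists_isUnboundedAt_of_tendsto {K : ℝ → ℝ} (hK : P.IsLocalBound K)
    {a : EuclideanSpace ℝ (Fin n)} {σ : ℝ} (hσ : P.t₀ ≤ σ) {x : ℕ → EuclideanSpace ℝ (Fin n)}
    {s t : ℕ → ℝ} {u : ℕ → ℝ → EuclideanSpace ℝ (Fin m)} {X : ℕ → ℝ → EuclideanSpace ℝ (Fin n)}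
    (hx : Tendsto x atTop (𝓝 a)) (hs : Tendsto s atTop (𝓝 σ)) (hs₀ : ∀ k, P.t₀ ≤ s k)
    (hu : ∀ k, P.IsAdmissibleControl (s k) (u k)) (hX : ∀ k, P.IsTrajectory (x k) (s k) (u k) (X k))
    (ht : ∀ k, t k ∈ Icc (s k) P.T) (hlarge : ∀ k : ℕ, (k : ℝ) < ‖X k (t k)‖) :
    σ + tubeTime K a / 2 < P.T ∧ ∃ b, ∃ φ : ℕ → ℕ, StrictMono φ ∧
      Tendsto (fun k => X (φ k) (σ + tubeTime K a / 2)) atTop (𝓝 b) ∧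
      P.IsUnboundedAt b (σ + tubeTime K a / 2) := by
  set h := tubeTime K a with hh
  have hpos : 0 < h := hK.tubeTime_pos a
  set τ := σ + h / 2 with hτ
  have hev : ∀ᶠ k in atTop, s k < τ ∧ τ < t k ∧ τ < P.T ∧ X k τ ∈ Metric.closedBall a 2 := by
    filter_upwards [Metric.tendsto_nhds.1 hx 1 one_pos, Metric.tendsto_nhds.1 hs (h / 2) (by positivity),
      tendsto_natCast_atTop_atTop.eventually_ge_atTop (‖a‖ + 3)] with k hk1 hk2 hk3
    rw [dist_eq_norm] at hk1
    rw [Real.dist_eq, abs_lt] at hk2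
    have h1 : s k ≤ P.T := (ht k).1.trans (ht k).2
    have hstart : ‖X k (s k) - a‖ ≤ 1 := by rw [(hX k).apply_left h1]; exact hk1.le
    have htk : τ < t k := by
      by_contra! hle
      have := (hX k).norm_lt_add_three hK (hs₀ k) (hu k) le_rfl hstart (ht k).1 (ht k).2
        (by linarith)
      linarith [hlarge k]
    have hτT : τ < P.T := htk.trans_le (ht k).2
    refine ⟨by linarith, htk, hτT, ?_⟩
    rw [mem_closedBall_iff_norm]
    exact (hX k).norm_sub_le_two hK (hs₀ k) (hu k) le_rfl hstart (by linarith) hτT.le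
      (by linarith)
  have hτT : τ < P.T := hev.exists.choose_spec.2.2.1
  obtain ⟨b, -, φ, hφ, hb⟩ := (isCompact_closedBall a (2 : ℝ)).tendsto_subseq'
    (x := fun k => X k τ) (hev.mono fun k hk => hk.2.2.2).frequently
  refine ⟨hτT, b, φ, hφ, hb, ⟨by linarith, hτT.le⟩, fun δ hδ N => ?_⟩
  obtain ⟨k, hk1, hk2, hk3⟩ := ((hφ.tendsto_atTop.eventually hev).and
    ((Metric.tendsto_nhds.1 hb δ hδ).and (hφ.tendsto_atTop.eventually
      (tendsto_natCast_atTop_atTop.eventually_ge_atTop N)))).exists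
  refine ⟨X (φ k) τ, u (φ k), X (φ k), ?_, (hu _).mono hk1.1.le, (hX _).restrict hk1.1.le hτT.le,
    t (φ k), ⟨hk1.2.1.le, (ht _).2⟩, hk3.trans_lt (hlarge _)⟩
  rw [← dist_eq_norm]
  exact hk2.le

/-- From a neighbourhood of a point of unboundedness one can steer, with a single control, onto a
whole neighbourhood of a later point of unboundedness. -/
theorem IsUnboundedAt.exists_next {K : ℝ → ℝ} (hK : P.IsLocalBound K)
    (hglob : P.HasGlobalTrajectories) {a : EuclideanSpace ℝ (Fin n)} {τ δ : ℝ}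
    (ha : P.IsUnboundedAt a τ) (hδ : 0 < δ) (hδ1 : δ ≤ 1) :
    ∃ b v, P.IsUnboundedAt b (τ + tubeTime K a / 2) ∧ P.IsAdmissibleControl τ v ∧
      ∀ y, ‖y - b‖ ≤ δ / 8 → ∃ x X, ‖x - a‖ ≤ δ ∧ P.IsTrajectory x τ v X ∧
        X (τ + tubeTime K a / 2) = y := by
  choose x u X hx hu hX t ht hN using fun k : ℕ => ha.2 (1 / ((k : ℝ) + 1)) (by positivity) k
  have hxa : Tendsto x atTop (𝓝 a) := by
    rw [tendsto_iff_norm_sub_tendsto_zero]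
    exact squeeze_zero (fun _ => norm_nonneg _) hx tendsto_one_div_add_atTop_nhds_zero_nat
  obtain ⟨hT, b, φ, hφ, hb, hbad⟩ := exists_isUnboundedAt_of_tendsto hK ha.1.1 hxa
    tendsto_const_nhds (fun _ => ha.1.1) hu hX ht hN
  set h := tubeTime K a with hh
  have hpos : 0 < h := hK.tubeTime_pos a
  set τ' := τ + h / 2 with hτ'
  have hττ' : τ ≤ τ' := by linarith
  -- A single control is frozen: its trajectory starts within `δ / 2` of `a` and is within `δ / 8`
  -- of `b` at time `τ'`.
  obtain ⟨k, hk1, hk2⟩ := ((Metric.tendsto_nhds.1 hb (δ / 8) (by positivity)).and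
    (hφ.tendsto_atTop.eventually (Metric.tendsto_nhds.1 hxa (δ / 2) (by positivity)))).exists
  rw [dist_eq_norm] at hk1 hk2
  choose Z hZ using fun y => hglob y τ ha.1 (u (φ k)) (hu (φ k))
  have hZx : Z (x (φ k)) τ' = X (φ k) τ' :=
    (hZ _).eqOn hK ha.1.1 (hu _) (hX (φ k)) (fun _ _ => rfl) hT.le ⟨hττ', le_rfl⟩
  have hnear : ∀ y ∈ Metric.closedBall (x (φ k)) (δ / 2), ‖y - a‖ ≤ δ := by
    intro y hy
    rw [mem_closedBall_iff_norm] at hy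
    have := norm_sub_le_norm_sub_add_norm_sub y (x (φ k)) a
    linarith
  have hbd : ∀ y ∈ Metric.closedBall (x (φ k)) (δ / 2), ∀ s ∈ Icc τ τ', ‖Z y s‖ < ‖a‖ + 3 := by
    intro y hy s hs
    refine (hZ y).norm_lt_add_three hK ha.1.1 (hu _) le_rfl ?_ hs.1 (hs.2.trans hT.le)
      (by linarith [hs.2])
    rw [(hZ y).apply_left ha.1.2]
    exact (hnear y hy).trans hδ1
  -- The flow map from `τ` to `τ'` minus the identity has Lipschitz constant at most `K (‖a‖ + 3) *
  -- 3 * (h / 2) = 3 / 8 ≤ 1 / 2`. By the quantitative inverse function theorem it maps the ball of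
  -- radius `δ / 2` onto a set containing a ball of radius `δ / 4`, hence the ball of radius `δ / 8`
  -- around `b`.
  have happ : ApproximatesLinearOn (fun y => Z y τ') (ContinuousLinearMap.id ℝ _)
      (Metric.closedBall (x (φ k)) (δ / 2)) (1 / 2) := by
    intro y hy z hz
    have e := fun s hs => (hZ y).norm_sub_le hK ha.1.1 (hu (φ k)) (hZ z) (fun _ _ => rfl) hT.le
      (hbd y hy) (hbd z hz) s hs
    have e2 := (e τ' ⟨hττ', le_rfl⟩).2
    have hKpos := hK.one_le_add a
    have hexp : ∀ s ∈ Icc τ τ', ‖Z y s - Z z s‖ ≤ ‖y - z‖ * 3 := by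
      intro s hs
      refine (e s hs).1.trans (mul_le_mul_of_nonneg_left ?_ (norm_nonneg _))
      have h4 : K (‖a‖ + 3) * (s - τ) ≤ 1 := by
        have : K (‖a‖ + 3) * (s - τ) ≤ K (‖a‖ + 3) * h :=
          mul_le_mul_of_nonneg_left (by linarith [hs.2]) (by linarith)
        rw [hK.mul_tubeTime a] at this
        linarith
      exact (Real.exp_le_exp.2 h4).trans Real.exp_one_lt_three.le
    have hint : ∫ r in τ..τ', ‖Z y r - Z z r‖ ≤ ‖y - z‖ * 3 * (h / 2) := by
      have := intervalIntegral.norm_integral_le_of_norm_le_const (a := τ) (b := τ')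
        (f := fun r => ‖Z y r - Z z r‖) (C := ‖y - z‖ * 3) (fun r hr => by
          rw [uIoc_of_le hττ'] at hr
          rw [norm_norm]
          exact hexp r ⟨hr.1.le, hr.2⟩)
      rw [abs_of_nonneg (by linarith), hτ', add_sub_cancel_left] at this
      exact (le_abs_self _).trans this
    have e3 : ‖(Z y τ' - y) - (Z z τ' - z)‖ ≤ 1 / 2 * ‖y - z‖ := by
      refine e2.trans ((mul_le_mul_of_nonneg_left hint (by linarith)).trans ?_)
      have := hK.mul_tubeTime a
      calc K (‖a‖ + 3) * (‖y - z‖ * 3 * (h / 2))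
          = (K (‖a‖ + 3) * h) * (‖y - z‖ * 3 / 2) := by ring
        _ ≤ 1 / 2 * ‖y - z‖ := by rw [this]; nlinarith [norm_nonneg (y - z)]
    have e4 : Z y τ' - Z z τ' - (ContinuousLinearMap.id ℝ _) (y - z)
        = (Z y τ' - y) - (Z z τ' - z) := by
      simp only [ContinuousLinearMap.id_apply]; abel
    rw [e4]
    simpa using e3
  have hsurj := happ.surjOn_closedBall_of_nonlinearRightInverse (b := x (φ k)) (ε := δ / 2)
    { toFun := id
      nnnorm := 1
      bound' := fun y => by simp
      right_inv' := fun y => rfl } (by positivity) subset_rfl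
  refine ⟨b, u (φ k), hbad, hu _, fun y hy => ?_⟩
  have hy' : y ∈ Metric.closedBall (Z (x (φ k)) τ') ((((1 : NNReal) : ℝ)⁻¹ - ((1 / 2 : NNReal) : ℝ)) * (δ / 2)) := by
    rw [mem_closedBall_iff_norm, hZx]
    have h3 := norm_sub_le_norm_sub_add_norm_sub y b (X (φ k) τ')
    rw [norm_sub_rev b] at h3
    push_cast
    linarith
  obtain ⟨z, hz, hzy⟩ := hsurj hy'
  exact ⟨z, Z z, hnear z hz, hZ z, hzy⟩

/-- Controls given on the consecutive intervals `(τₖ, τₖ₊₁]` can be joined. -/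
theorem exists_concat_control (hU : P.U.Nonempty) {τ : ℕ → ℝ} (hτ : StrictMono τ)
    {v : ℕ → ℝ → EuclideanSpace ℝ (Fin m)} (hτT : ∀ k, τ k ≤ P.T)
    (hv : ∀ k, P.IsAdmissibleControl (τ k) (v k)) :
    ∃ w, P.IsAdmissibleControl (τ 0) w ∧ ∀ k, EqOn w (v k) (Ioc (τ k) (τ (k + 1))) := by
  classical
  obtain ⟨c, hc⟩ := hU
  -- `Nat.find` selects the first interval whose right end is not passed yet; the constant `c` fills
  -- the times beyond all `τ k`, where no `v k` is prescribed.
  set w : ℝ → EuclideanSpace ℝ (Fin m) :=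
    fun t => if h : ∃ k, t ≤ τ (k + 1) then v (Nat.find h) t else c with hw
  have hweq : ∀ k, EqOn w (v k) (Ioc (τ k) (τ (k + 1))) := by
    intro k t ht
    have h : ∃ k, t ≤ τ (k + 1) := ⟨k, ht.2⟩
    have hk : Nat.find h = k := by
      rw [Nat.find_eq_iff]
      exact ⟨ht.2, fun j hj => not_le.2 ((hτ.monotone (Nat.succ_le_of_lt hj)).trans_lt ht.1)⟩
    simp only [hw, dif_pos h, hk]
  refine ⟨w, ⟨?_, ?_⟩, hweq⟩
  · rw [← Measure.restrict_congr_set (μ := volume) (Ioc_ae_eq_Icc (a := τ 0) (b := P.T))]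
    -- The index `none` stands for the times after all `τ k`.
    set S : Option ℕ → Set ℝ := fun o => o.elim (⋂ k, Ioi (τ (k + 1)))
      (fun k => Ioc (τ k) (τ (k + 1))) with hS
    have hcover : Ioc (τ 0) P.T ⊆ ⋃ o, S o := by
      intro t ht
      by_cases h : ∃ k, t ≤ τ (k + 1)
      · refine mem_iUnion.2 ⟨some (Nat.find h), ?_, Nat.find_spec h⟩
        rcases Nat.eq_zero_or_pos (Nat.find h) with h0 | h0
        · rw [h0]; exact ht.1
        · have := Nat.find_min h (Nat.sub_one_lt h0.ne')
          rwa [Nat.sub_one_add_one h0.ne', not_le] at this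
      · push Not at h
        exact mem_iUnion.2 ⟨none, mem_iInter.2 h⟩
    refine AEMeasurable.mono_measure ?_ (Measure.restrict_mono hcover le_rfl)
    rw [aemeasurable_iUnion_iff]
    rintro (_ | k)
    · refine (aemeasurable_const (b := c)).congr (ae_restrict_of_forall_mem
        (MeasurableSet.iInter fun k => measurableSet_Ioi) fun t ht => ?_)
      have h : ¬ ∃ k, t ≤ τ (k + 1) := by
        push Not
        exact mem_iInter.1 ht
      simp only [hw, dif_neg h]
    · refine AEMeasurable.congr (f := v k) ((hv k).1.mono_measure
        (Measure.restrict_mono (Ioc_subset_Icc_self.trans (Icc_subset_Icc_right (hτT _))) le_rfl))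
        (ae_restrict_of_forall_mem measurableSet_Ioc fun t ht => (hweq k ht).symm)
  · intro t ht
    by_cases h : ∃ k, t ≤ τ (k + 1)
    · simp only [hw, dif_pos h]
      refine (hv _).2 t ⟨?_, ht.2⟩
      rcases Nat.eq_zero_or_pos (Nat.find h) with h0 | h0
      · rw [h0]; exact ht.1
      · have := Nat.find_min h (Nat.sub_one_lt h0.ne')
        rw [Nat.sub_one_add_one h0.ne', not_le] at this
        exact this.le
    · simp only [hw, dif_neg h]
      exact hc

/-- A point of unboundedness generates a sequence of such points, each steered to the next. -/
theorem IsUnboundedAt.exists_seq {K : ℝ → ℝ} (hK : P.IsLocalBound K)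
    (hglob : P.HasGlobalTrajectories) {a₀ : EuclideanSpace ℝ (Fin n)} {τ₀ : ℝ}
    (h₀ : P.IsUnboundedAt a₀ τ₀) :
    ∃ (a : ℕ → EuclideanSpace ℝ (Fin n)) (τ δ : ℕ → ℝ) (v : ℕ → ℝ → EuclideanSpace ℝ (Fin m)),
      (∀ k, τ (k + 1) = τ k + tubeTime K (a k) / 2) ∧ (∀ k, τ k ∈ Icc P.t₀ P.T) ∧
      (∀ k, 0 < δ k ∧ δ k ≤ 1) ∧ (∀ k, P.IsAdmissibleControl (τ k) (v k)) ∧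
      ∀ k y, ‖y - a (k + 1)‖ ≤ δ (k + 1) → ∃ x X, ‖x - a k‖ ≤ δ k ∧
        P.IsTrajectory x (τ k) (v k) X ∧ X (τ (k + 1)) = y := by
  -- A state consists of a point of unboundedness, its time and a radius in `(0, 1]`; each step
  -- divides the radius by `8`.
  let S := {p : EuclideanSpace ℝ (Fin n) × ℝ × ℝ //
    P.IsUnboundedAt p.1 p.2.1 ∧ 0 < p.2.2 ∧ p.2.2 ≤ 1}
  have hstep : ∀ p : S, ∃ q : S, ∃ v, q.1.2.1 = p.1.2.1 + tubeTime K p.1.1 / 2 ∧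
      P.IsAdmissibleControl p.1.2.1 v ∧
      ∀ y, ‖y - q.1.1‖ ≤ q.1.2.2 → ∃ x X, ‖x - p.1.1‖ ≤ p.1.2.2 ∧
        P.IsTrajectory x p.1.2.1 v X ∧ X q.1.2.1 = y := by
    rintro ⟨⟨a, τ, δ⟩, ha, hδ, hδ1⟩
    obtain ⟨b, v, hb, hv, h⟩ := ha.exists_next hK hglob hδ hδ1
    exact ⟨⟨(b, τ + tubeTime K a / 2, δ / 8), hb, by simp only; positivity,
      by simp only at hδ1 ⊢; linarith⟩, v, rfl, hv, h⟩
  choose next ctrl hnext hctrl hreach using hstep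
  obtain ⟨p, hp⟩ : ∃ p : ℕ → S, ∀ k, p (k + 1) = next (p k) :=
    ⟨fun k => Nat.rec (⟨(a₀, τ₀, 1), h₀, one_pos, le_rfl⟩ : S) (fun _ => next) k, fun _ => rfl⟩
  refine ⟨fun k => (p k).1.1, fun k => (p k).1.2.1, fun k => (p k).1.2.2, fun k => ctrl (p k),
    fun k => ?_, fun k => (p k).2.1.1, fun k => (p k).2.2, fun k => hctrl (p k), fun k => ?_⟩
  · beta_reduce
    rw [hp, hnext]
  · beta_reduce
    rw [hp]
    exact hreach (p k)

/-- Global existence for all controls excludes points of unboundedness (Lin, Sontag and Wang). -/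
theorem not_isUnboundedAt {K : ℝ → ℝ} (hK : P.IsLocalBound K) (hU : P.U.Nonempty)
    (hglob : P.HasGlobalTrajectories) (a₀ : EuclideanSpace ℝ (Fin n)) (τ₀ : ℝ) :
    ¬ P.IsUnboundedAt a₀ τ₀ := by
  intro h₀
  obtain ⟨a, τ, δ, v, hτs, hτmem, hδ, hv, hreach⟩ := h₀.exists_seq hK hglob
  have hδ1 : ∀ k, δ k ≤ 1 := fun k => (hδ k).2
  have hmono : StrictMono τ := strictMono_nat_of_lt_succ fun k => by
    rw [hτs]; linarith [hK.tubeTime_pos (a k)]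
  obtain ⟨w, hw, hwe⟩ := exists_concat_control hU hmono (fun k => (hτmem k).2) hv
  have hwk : ∀ k, P.IsAdmissibleControl (τ k) w := fun k => hw.mono (hmono.monotone (Nat.zero_le k))
  -- every point near `a k` is reached under `w` through neighbourhoods of the previous points
  have hback : ∀ k y, ‖y - a k‖ ≤ δ k → ∃ x X, ‖x - a 0‖ ≤ δ 0 ∧ P.IsTrajectory x (τ 0) w X ∧
      X (τ k) = y ∧ ∀ j ≤ k, ‖X (τ j) - a j‖ ≤ δ j := by
    intro k
    induction k with
    | zero =>
      intro y hy
      obtain ⟨X, hX⟩ := hglob y (τ 0) (hτmem 0) w hw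
      have h0 : X (τ 0) = y := hX.apply_left (hτmem 0).2
      refine ⟨y, X, hy, hX, h0, fun j hj => ?_⟩
      obtain rfl : j = 0 := by omega
      rwa [h0]
    | succ k ih =>
      intro y hy
      obtain ⟨x, Y, hx, hY, hYy⟩ := hreach k y hy
      obtain ⟨x', X, hx', hX, hXx, hXj⟩ := ih x hx
      have hXk := hX.restrict (hmono.monotone (Nat.zero_le k)) (hτmem k).2
      rw [hXx] at hXk
      have heq := hXk.eqOn hK (hτmem k).1 (hwk k) hY (hwe k) (hτmem (k + 1)).2
        ⟨(hmono (Nat.lt_succ_self k)).le, le_rfl⟩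
      refine ⟨x', X, hx', hX, heq.trans hYy, fun j hj => ?_⟩
      rcases Nat.lt_or_ge k j with h | h
      · obtain rfl : j = k + 1 := by omega
        rw [heq, hYy]; exact hy
      · exact hXj j h
  choose x X hx hX hXk hXj using fun k => hback k (a k) (by
    rw [sub_self, norm_zero]; exact (hδ k).1.le)
  -- The `k`-th trajectory passes near `a 0, …, a k`. The trajectory from a limit of the starting
  -- points will pass near every `a j`.
  obtain ⟨q, -, φ, hφ, hq⟩ := (isCompact_closedBall (a 0) (δ 0)).tendsto_subseq
    (x := x) (fun k => mem_closedBall_iff_norm.2 (hx k))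
  obtain ⟨Q, hQ⟩ := hglob q (τ 0) (hτmem 0) w hw
  -- No uniform bound on the trajectories is available yet, so convergence is propagated by
  -- induction: closeness to `a j` confines both trajectories until `τ (j + 1)`, and there
  -- continuous dependence applies with a constant depending on `j`.
  have hlim : ∀ j, Tendsto (fun k => X (φ k) (τ j)) atTop (𝓝 (Q (τ j))) ∧
      ‖Q (τ j) - a j‖ ≤ 1 := by
    have hle : ∀ j, Tendsto (fun k => X (φ k) (τ j)) atTop (𝓝 (Q (τ j))) →
        ‖Q (τ j) - a j‖ ≤ 1 := by
      intro j hj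
      refine le_of_tendsto (hj.sub_const (a j)).norm ?_
      filter_upwards [eventually_ge_atTop j] with k hk
      exact (hXj _ j (hk.trans (hφ.id_le k))).trans (hδ1 j)
    intro j
    induction j with
    | zero =>
      have : Tendsto (fun k => X (φ k) (τ 0)) atTop (𝓝 (Q (τ 0))) := by
        rw [hQ.apply_left (hτmem 0).2]
        exact hq.congr fun k => ((hX (φ k)).apply_left (hτmem 0).2).symm
      exact ⟨this, hle 0 this⟩
    | succ j ih =>
      have h0j : τ 0 ≤ τ j := hmono.monotone (Nat.zero_le j)
      have hjj : τ j ≤ τ (j + 1) := (hmono (Nat.lt_succ_self j)).le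
      have htube : τ (j + 1) ≤ τ j + tubeTime K (a j) := by
        rw [hτs]; linarith [hK.tubeTime_pos (a j)]
      have hbound : ∀ᶠ k in atTop, ‖X (φ k) (τ (j + 1)) - Q (τ (j + 1))‖ ≤
          ‖X (φ k) (τ j) - Q (τ j)‖ * Real.exp (K (‖a j‖ + 3) * (τ (j + 1) - τ j)) := by
        filter_upwards [eventually_ge_atTop j] with k hk
        have hb : ∀ Y y, P.IsTrajectory y (τ 0) w Y → ‖Y (τ j) - a j‖ ≤ 1 →
            ∀ s ∈ Icc (τ j) (τ (j + 1)), ‖Y s‖ < ‖a j‖ + 3 := fun Y y hY h1 s hs =>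
          hY.norm_lt_add_three hK (hτmem 0).1 hw h0j h1 hs.1 (hs.2.trans (hτmem (j + 1)).2)
            (hs.2.trans htube)
        exact (((hX (φ k)).restrict h0j (hτmem j).2).norm_sub_le hK (hτmem j).1 (hwk j)
          (hQ.restrict h0j (hτmem j).2) (fun _ _ => rfl) (hτmem (j + 1)).2
          (hb _ _ (hX (φ k)) ((hXj _ j (hk.trans (hφ.id_le k))).trans (hδ1 j)))
          (hb _ _ hQ ih.2) _ ⟨hjj, le_rfl⟩).1
      have : Tendsto (fun k => X (φ k) (τ (j + 1))) atTop (𝓝 (Q (τ (j + 1)))) := by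
        rw [tendsto_iff_norm_sub_tendsto_zero]
        refine squeeze_zero' (Eventually.of_forall fun _ => norm_nonneg _) hbound ?_
        have := (tendsto_iff_norm_sub_tendsto_zero.1 ih.1).mul_const
          (Real.exp (K (‖a j‖ + 3) * (τ (j + 1) - τ j)))
        rwa [zero_mul] at this
      exact ⟨this, hle _ this⟩
  obtain ⟨C, hC⟩ := hQ.exists_norm_lt
  have hC0 : 0 ≤ C := (norm_nonneg _).trans (hC (τ 0) ⟨le_rfl, (hτmem 0).2⟩).le
  -- `Q` exists up to `T` and is therefore bounded. So the `a k` are bounded, their tube times have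
  -- a positive lower bound, and `τ k` grows at least linearly.
  have haC : ∀ k, ‖a k‖ ≤ C + 1 := by
    intro k
    have h1 := norm_le_norm_add_norm_sub (Q (τ k)) (a k)
    have h2 := hC (τ k) ⟨hmono.monotone (Nat.zero_le k), (hτmem k).2⟩
    linarith [(hlim k).2]
  set h := (4 * K (C + 1 + 3))⁻¹ with hh
  have hpos : 0 < h := inv_pos.2 (by linarith [hK.one_le (C + 1 + 3) (by linarith)])
  have hge : ∀ k, h ≤ tubeTime K (a k) := fun k =>
    inv_anti₀ (by linarith [hK.one_le_add (a k)])
      (mul_le_mul_of_nonneg_left (hK.mono _ _ (by positivity) (by linarith [haC k])) (by norm_num))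
  have hgrow : ∀ k : ℕ, τ 0 + k * (h / 2) ≤ τ k := by
    intro k
    induction k with
    | zero => simp
    | succ k ih => rw [hτs]; push_cast; linarith [hge k]
  obtain ⟨k, hk⟩ := exists_nat_gt ((P.T - τ 0) / (h / 2))
  rw [div_lt_iff₀ (by positivity)] at hk
  linarith [hgrow k, (hτmem k).2]

/-- Trajectories starting in a bounded set are uniformly bounded. -/
theorem exists_trajectory_bound {K : ℝ → ℝ} (hK : P.IsLocalBound K) (hU : P.U.Nonempty)
    (hglob : P.HasGlobalTrajectories) (R : ℝ) :
    ∃ N : ℝ, ∀ x : EuclideanSpace ℝ (Fin n), ‖x‖ ≤ R → ∀ τ ∈ Icc P.t₀ P.T, ∀ u X,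
      P.IsAdmissibleControl τ u → P.IsTrajectory x τ u X → ∀ t ∈ Icc τ P.T, ‖X t‖ < N := by
  by_contra! hcon
  choose x hx s hs u X hu hX t ht hN using fun k : ℕ => hcon (k + 1)
  obtain ⟨⟨a, σ⟩, ⟨-, hσ⟩, φ, hφ, hlim⟩ := ((isCompact_closedBall
    (0 : EuclideanSpace ℝ (Fin n)) R).prod (isCompact_Icc (a := P.t₀) (b := P.T))).tendsto_subseq
    (x := fun k => (x k, s k)) (fun k => ⟨mem_closedBall_zero_iff.2 (hx k), hs k⟩)
  rw [nhds_prod_eq, tendsto_prod_iff'] at hlim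
  -- The initial times vary with `k`, so unboundedness is not asserted at the limit datum itself but
  -- at a slightly later time common to the trajectories.
  obtain ⟨-, b, -, -, -, hb⟩ := exists_isUnboundedAt_of_tendsto hK hσ.1 hlim.1 hlim.2
    (fun k => (hs _).1) (fun k => hu _) (fun k => hX _) (fun k => ht _) (fun k => by
      have h1 := hN (φ k)
      have h2 : (k : ℝ) ≤ φ k := by exact_mod_cast hφ.id_le k
      linarith)
  exact not_isUnboundedAt hK hU hglob _ _ hb

/-! ### The value function and dynamic programming -/

/-- `N` bounds all trajectories that start in the closed ball of radius `R`. -/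
def IsTrajectoryBound (P : LagrangeOCP n m) (R N : ℝ) : Prop :=
  ∀ x : EuclideanSpace ℝ (Fin n), ‖x‖ ≤ R → ∀ τ ∈ Icc P.t₀ P.T, ∀ u X,
    P.IsAdmissibleControl τ u → P.IsTrajectory x τ u X → ∀ t ∈ Icc τ P.T, ‖X t‖ < N

section Value

variable {x : EuclideanSpace ℝ (Fin n)} {τ σ : ℝ} {u : ℝ → EuclideanSpace ℝ (Fin m)}
  {X : ℝ → EuclideanSpace ℝ (Fin n)} {K : ℝ → ℝ} {R N : ℝ}

theorem IsTrajectoryBound.lt (hN : P.IsTrajectoryBound R N) (hU : P.U.Nonempty)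
    (hglob : P.HasGlobalTrajectories) (hx : ‖x‖ ≤ R) : ‖x‖ < N := by
  obtain ⟨c, hc⟩ := hU
  have hT : P.T ∈ Icc P.t₀ P.T := ⟨P.t₀_lt_T.le, le_rfl⟩
  obtain ⟨X, hX⟩ := hglob x P.T hT _ (isAdmissibleControl_const hc _)
  have := hN x hx P.T hT _ X (isAdmissibleControl_const hc _) hX P.T ⟨le_rfl, le_rfl⟩
  rwa [hX.apply_left le_rfl] at this

theorem IsTrajectory.norm_integral_cost_le (hK : P.IsLocalBound K) (hτ : P.t₀ ≤ τ)
    (hu : P.IsAdmissibleControl τ u) {a b : ℝ} (ha : τ ≤ a)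
    (hab : a ≤ b) (hb : b ≤ P.T) (hXN : ∀ t ∈ Icc a b, ‖X t‖ < N) :
    |∫ s in a..b, P.F (X s) (u s) s| ≤ K N * (b - a) := by
  have h := intervalIntegral.norm_integral_le_of_norm_le_const (a := a) (b := b)
    (f := fun s => P.F (X s) (u s) s) (C := K N) ?_
  · rwa [abs_of_nonneg (sub_nonneg.2 hab)] at h
  intro s hs
  rw [uIoc_of_le hab] at hs
  exact hK.F_le (hXN s ⟨hs.1.le, hs.2⟩) (hu.2 s ⟨ha.trans hs.1.le, hs.2.trans hb⟩)
    ⟨hτ.trans (ha.trans hs.1.le), hs.2.trans hb⟩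

theorem costSet_nonempty (hU : P.U.Nonempty) (hglob : P.HasGlobalTrajectories)
    (hτ : τ ∈ Icc P.t₀ P.T) : (P.costSet x τ).Nonempty := by
  obtain ⟨c, hc⟩ := hU
  obtain ⟨X, hX⟩ := hglob x τ hτ _ (isAdmissibleControl_const hc _)
  exact ⟨_, _, X, isAdmissibleControl_const hc _, hX, rfl⟩

theorem IsTrajectoryBound.abs_cost_le (hN : P.IsTrajectoryBound R N) (hK : P.IsLocalBound K)
    (hx : ‖x‖ ≤ R) (hτ : τ ∈ Icc P.t₀ P.T) {J : ℝ} (hJ : J ∈ P.costSet x τ) :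
    |J| ≤ K N * (P.T - τ) := by
  obtain ⟨u, X, hu, hX, rfl⟩ := hJ
  exact IsTrajectory.norm_integral_cost_le hK hτ.1 hu le_rfl hτ.2 le_rfl (hN x hx τ hτ u X hu hX)

/-- The uniform bound on trajectories bounds all costs from below, so `sInf` takes no junk value. -/
theorem isGLB_value (hK : P.IsLocalBound K) (hU : P.U.Nonempty) (hglob : P.HasGlobalTrajectories)
    (hτ : τ ∈ Icc P.t₀ P.T) : IsGLB (P.costSet x τ) (P.value x τ) := by
  obtain ⟨N, hN⟩ := exists_trajectory_bound hK hU hglob ‖x‖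
  refine isGLB_csInf (costSet_nonempty hU hglob hτ) ⟨-(K N * (P.T - τ)), fun J hJ => ?_⟩
  exact (abs_le.1 (IsTrajectoryBound.abs_cost_le hN hK le_rfl hτ hJ)).1

theorem value_le (hK : P.IsLocalBound K) (hU : P.U.Nonempty) (hglob : P.HasGlobalTrajectories)
    (hτ : τ ∈ Icc P.t₀ P.T) (hu : P.IsAdmissibleControl τ u) (hX : P.IsTrajectory x τ u X) :
    P.value x τ ≤ ∫ t in τ..P.T, P.F (X t) (u t) t :=
  (isGLB_value hK hU hglob hτ).1 ⟨u, X, hu, hX, rfl⟩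

theorem exists_cost_lt_value_add (hK : P.IsLocalBound K) (hU : P.U.Nonempty)
    (hglob : P.HasGlobalTrajectories) (x : EuclideanSpace ℝ (Fin n)) (hτ : τ ∈ Icc P.t₀ P.T)
    {ε : ℝ} (hε : 0 < ε) : ∃ u X, P.IsAdmissibleControl τ u ∧ P.IsTrajectory x τ u X ∧
      ∫ t in τ..P.T, P.F (X t) (u t) t < P.value x τ + ε := by
  obtain ⟨J, ⟨u, X, hu, hX, rfl⟩, -, hJ⟩ :=
    (isGLB_value hK hU hglob hτ).exists_between (lt_add_of_pos_right (P.value x τ) hε)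
  exact ⟨u, X, hu, hX, hJ⟩

theorem IsTrajectoryBound.abs_value_le (hN : P.IsTrajectoryBound R N) (hK : P.IsLocalBound K)
    (hU : P.U.Nonempty) (hglob : P.HasGlobalTrajectories) (hx : ‖x‖ ≤ R)
    (hτ : τ ∈ Icc P.t₀ P.T) : |P.value x τ| ≤ K N * (P.T - τ) := by
  have hG := isGLB_value (x := x) hK hU hglob hτ
  obtain ⟨J, hJ⟩ := costSet_nonempty (x := x) hU hglob hτ
  have h1 := hN.abs_cost_le hK hx hτ hJ
  rw [abs_le] at h1 ⊢
  refine ⟨hG.2 fun J hJ => (abs_le.1 (hN.abs_cost_le hK hx hτ hJ)).1, (hG.1 hJ).trans h1.2⟩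

theorem value_terminal (hK : P.IsLocalBound K) (hU : P.U.Nonempty)
    (hglob : P.HasGlobalTrajectories) (x : EuclideanSpace ℝ (Fin n)) : P.value x P.T = 0 := by
  obtain ⟨N, hN⟩ := exists_trajectory_bound hK hU hglob ‖x‖
  have := IsTrajectoryBound.abs_value_le hN hK hU hglob (x := x) le_rfl
    (⟨P.t₀_lt_T.le, le_rfl⟩ : P.T ∈ Icc P.t₀ P.T)
  simpa using this

/-- One half of the dynamic programming principle. -/
theorem value_le_integral_add_value (hK : P.IsLocalBound K) (hU : P.U.Nonempty)
    (hUc : IsCompact P.U) (h1 : P.H1) (hglob : P.HasGlobalTrajectories) (hτ : P.t₀ ≤ τ)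
    (hu : P.IsAdmissibleControl τ u) (hX : P.IsTrajectory x τ u X) (hσ : σ ∈ Icc τ P.T) :
    P.value x τ ≤ (∫ t in τ..σ, P.F (X t) (u t) t) + P.value (X σ) σ := by
  classical
  have hσ' : σ ∈ Icc P.t₀ P.T := ⟨hτ.trans hσ.1, hσ.2⟩
  have hτT : τ ≤ P.T := hσ.1.trans hσ.2
  refine le_of_forall_pos_le_add fun ε hε => ?_
  obtain ⟨v, Y, hv, hY, hJ⟩ := exists_cost_lt_value_add hK hU hglob (X σ) hσ' hε
  -- Follow `u` up to `σ` and then an `ε`-optimal control for the datum reached.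
  set w : ℝ → EuclideanSpace ℝ (Fin m) := (Iic σ).piecewise u v with hw
  have hwu : EqOn w u (Ioc τ σ) := fun t ht => piecewise_eq_of_mem _ _ _ ht.2
  have hwv : EqOn w v (Ioc σ P.T) := fun t ht => piecewise_eq_of_notMem _ _ _ (not_le.2 ht.1)
  have hwa : P.IsAdmissibleControl τ w := by
    refine ⟨?_, fun t ht => ?_⟩
    · rw [← Icc_union_Ioc_eq_Icc hσ.1 hσ.2, aemeasurable_union_iff]
      refine ⟨AEMeasurable.congr (f := u) (hu.1.mono_measure (Measure.restrict_mono
          (Icc_subset_Icc_right hσ.2) le_rfl)) (ae_restrict_of_forall_mem measurableSet_Icc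
          fun t ht => (piecewise_eq_of_mem (Iic σ) u v (mem_Iic.2 ht.2)).symm),
        AEMeasurable.congr (f := v) (hv.1.mono_measure (Measure.restrict_mono
          Ioc_subset_Icc_self le_rfl)) (ae_restrict_of_forall_mem measurableSet_Ioc
          fun t ht => (hwv ht).symm)⟩
    · by_cases h : t ≤ σ
      · rw [hw, piecewise_eq_of_mem _ _ _ (mem_Iic.2 h)]
        exact hu.2 t ht
      · rw [hw, piecewise_eq_of_notMem _ _ _ (by simpa using h)]
        exact hv.2 t ⟨(not_le.1 h).le, ht.2⟩
  obtain ⟨Z, hZ⟩ := hglob x τ ⟨hτ, hτT⟩ w hwa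
  have hZX := hZ.eqOn hK hτ hwa hX hwu hσ.2
  have hZσ := hZ.restrict hσ.1 hσ.2
  rw [hZX ⟨hσ.1, le_rfl⟩] at hZσ
  have hZY := hZσ.eqOn hK hσ'.1 (hwa.mono hσ.1) hY hwv le_rfl
  have e1 : ∫ t in τ..σ, P.F (Z t) (w t) t = ∫ t in τ..σ, P.F (X t) (u t) t := by
    refine intervalIntegral.integral_congr_ae (Eventually.of_forall fun t ht => ?_)
    rw [uIoc_of_le hσ.1] at ht
    rw [hZX ⟨ht.1.le, ht.2⟩, hwu ht]
  have e2 : ∫ t in σ..P.T, P.F (Z t) (w t) t = ∫ t in σ..P.T, P.F (Y t) (v t) t := by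
    refine intervalIntegral.integral_congr_ae (Eventually.of_forall fun t ht => ?_)
    rw [uIoc_of_le hσ.2] at ht
    rw [hZY ⟨ht.1.le, ht.2⟩, hwv ht]
  have e3 := value_le hK hU hglob ⟨hτ, hτT⟩ hwa hZ
  rw [← intervalIntegral.integral_add_adjacent_intervals
    (hZ.integrable_cost hUc h1 hwa hτ le_rfl hσ.1 hσ.2)
    (hZ.integrable_cost hUc h1 hwa hτ hσ.1 hσ.2 le_rfl), e1, e2] at e3
  linarith

/-- The other half of the dynamic programming principle. -/
theorem integral_add_value_le (hK : P.IsLocalBound K) (hU : P.U.Nonempty)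
    (hUc : IsCompact P.U) (h1 : P.H1) (hglob : P.HasGlobalTrajectories) (hτ : P.t₀ ≤ τ)
    (hu : P.IsAdmissibleControl τ u) (hX : P.IsTrajectory x τ u X) (hσ : σ ∈ Icc τ P.T) :
    (∫ t in τ..σ, P.F (X t) (u t) t) + P.value (X σ) σ ≤ ∫ t in τ..P.T, P.F (X t) (u t) t := by
  rw [← intervalIntegral.integral_add_adjacent_intervals
    (hX.integrable_cost hUc h1 hu hτ le_rfl hσ.1 hσ.2)
    (hX.integrable_cost hUc h1 hu hτ hσ.1 hσ.2 le_rfl)]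
  exact add_le_add_right (value_le hK hU hglob ⟨hτ.trans hσ.1, hσ.2⟩ (hu.mono hσ.1)
    (hX.restrict hσ.1 hσ.2)) _

end Value

end LagrangeOCP

/-! ### Rescaling to the unit time interval -/

/-- Controls are only almost everywhere measurable, so a change of time has to pull null sets back
to null sets. -/
theorem quasiMeasurePreserving_mul_add {a : ℝ} (ha : a ≠ 0) (b : ℝ) :
    Measure.QuasiMeasurePreserving (fun s : ℝ => a * s + b) volume volume := by
  have h1 : Measure.QuasiMeasurePreserving (fun s : ℝ => a * s) volume volume :=
    ⟨measurable_const_mul a, by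
      rw [Real.map_volume_mul_left ha]
      exact Measure.smul_absolutelyContinuous⟩
  exact (measurePreserving_add_right volume b).quasiMeasurePreserving.comp h1

namespace LagrangeOCP

variable {n m : ℕ} {P : LagrangeOCP n m}

/-- The affine change of time from `[0, 1]` to `[τ, T]`. -/
def timeChange (P : LagrangeOCP n m) (τ s : ℝ) : ℝ := (P.T - τ) * s + τ

theorem timeChange_mem {τ s : ℝ} (hτ : τ ≤ P.T) (hs : s ∈ Icc (0 : ℝ) 1) :
    P.timeChange τ s ∈ Icc τ P.T := by
  unfold timeChange
  constructor <;> nlinarith [hs.1, hs.2]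

theorem continuous_timeChange (τ : ℝ) : Continuous (P.timeChange τ) := by
  unfold timeChange; fun_prop

/-- Measurable controls on the unit time interval. -/
def IsUnitControl (P : LagrangeOCP n m) (v : ℝ → EuclideanSpace ℝ (Fin m)) : Prop :=
  AEMeasurable v (volume.restrict (Icc 0 1)) ∧ ∀ s ∈ Icc (0 : ℝ) 1, v s ∈ P.U

/-- Trajectories on `[τ, T]` rescaled to the unit time interval. -/
def IsUnitTrajectory (P : LagrangeOCP n m) (x : EuclideanSpace ℝ (Fin n)) (τ : ℝ)
    (v : ℝ → EuclideanSpace ℝ (Fin m)) (z : ℝ → EuclideanSpace ℝ (Fin n)) : Prop :=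
  ContinuousOn z (Icc 0 1) ∧ ∀ r ∈ Icc (0 : ℝ) 1,
    z r = x + ∫ s in (0 : ℝ)..r, (P.T - τ) • P.f (z s) (v s) (P.timeChange τ s)

/-- The cost along a rescaled trajectory. -/
noncomputable def unitCost (P : LagrangeOCP n m) (τ : ℝ) (v : ℝ → EuclideanSpace ℝ (Fin m))
    (z : ℝ → EuclideanSpace ℝ (Fin n)) : ℝ :=
  ∫ s in (0 : ℝ)..1, (P.T - τ) • P.F (z s) (v s) (P.timeChange τ s)

section

variable {x : EuclideanSpace ℝ (Fin n)} {τ σ : ℝ} {u v : ℝ → EuclideanSpace ℝ (Fin m)}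
  {X z : ℝ → EuclideanSpace ℝ (Fin n)} {K : ℝ → ℝ} {R N : ℝ}

theorem IsAdmissibleControl.comp_timeChange (hτ : τ ≤ P.T) (hu : P.IsAdmissibleControl τ u) :
    P.IsUnitControl fun s => u (P.timeChange τ s) := by
  refine ⟨?_, fun s hs => hu.2 _ (timeChange_mem hτ hs)⟩
  -- At `τ = T` the time change collapses to a constant and is no longer quasi-measure-preserving.
  rcases hτ.eq_or_lt with h | h
  · have : (fun s => u (P.timeChange τ s)) = fun _ => u P.T := by
      funext s; simp [timeChange, h]
    rw [this]
    exact aemeasurable_const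
  · exact hu.1.comp_quasiMeasurePreserving
      ((quasiMeasurePreserving_mul_add (sub_ne_zero.2 h.ne') τ).restrict
        fun s hs => timeChange_mem hτ hs)

theorem IsUnitControl.comp_inv_timeChange (hτ : τ < P.T) (hv : P.IsUnitControl v) :
    P.IsAdmissibleControl τ fun t => v ((P.T - τ)⁻¹ * t + -((P.T - τ)⁻¹ * τ)) := by
  have hpos : 0 < P.T - τ := sub_pos.2 hτ
  have hmaps : MapsTo (fun t => (P.T - τ)⁻¹ * t + -((P.T - τ)⁻¹ * τ)) (Icc τ P.T) (Icc 0 1) := by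
    intro t ht
    have : (P.T - τ)⁻¹ * t + -((P.T - τ)⁻¹ * τ) = (t - τ) / (P.T - τ) := by
      field_simp; ring
    simp only [this]
    exact ⟨div_nonneg (sub_nonneg.2 ht.1) hpos.le,
      (div_le_one hpos).2 (sub_le_sub_right ht.2 _)⟩
  exact ⟨hv.1.comp_quasiMeasurePreserving
    ((quasiMeasurePreserving_mul_add (inv_ne_zero hpos.ne') _).restrict hmaps),
    fun t ht => hv.2 _ (hmaps ht)⟩

theorem IsTrajectory.comp_timeChange (hτ : τ ≤ P.T) (hX : P.IsTrajectory x τ u X) :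
    P.IsUnitTrajectory x τ (fun s => u (P.timeChange τ s)) fun s => X (P.timeChange τ s) := by
  refine ⟨hX.1.comp (continuous_timeChange τ).continuousOn fun s hs => timeChange_mem hτ hs,
    fun r hr => ?_⟩
  beta_reduce
  rw [hX.2.2 _ (timeChange_mem hτ hr), intervalIntegral.integral_smul]
  have := intervalIntegral.smul_integral_comp_mul_add (a := 0) (b := r)
    (fun t => P.f (X t) (u t) t) (P.T - τ) τ
  unfold timeChange
  rw [this, mul_zero, zero_add]

theorem unitCost_comp_timeChange :
    P.unitCost τ (fun s => u (P.timeChange τ s)) (fun s => X (P.timeChange τ s)) =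
      ∫ t in τ..P.T, P.F (X t) (u t) t := by
  have := intervalIntegral.smul_integral_comp_mul_add (a := 0) (b := 1)
    (fun t => P.F (X t) (u t) t) (P.T - τ) τ
  unfold unitCost timeChange
  rw [intervalIntegral.integral_smul, this, mul_zero, zero_add, mul_one, sub_add_cancel]

/-- This is the gain of the rescaling: one control on `[0, 1]` is usable from every initial datum.
At `τ = T` the rescaled dynamics vanish, the trajectory is constant and its cost is zero. -/
theorem IsUnitControl.exists_unitTrajectory (hK : P.IsLocalBound K) (hU : P.U.Nonempty)
    (hglob : P.HasGlobalTrajectories) (hN : P.IsTrajectoryBound R N) (hv : P.IsUnitControl v)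
    (hx : ‖x‖ ≤ R) (hτ : τ ∈ Icc P.t₀ P.T) : ∃ z, P.IsUnitTrajectory x τ v z ∧
      (∀ s ∈ Icc (0 : ℝ) 1, ‖z s‖ < N) ∧ P.value x τ ≤ P.unitCost τ v z := by
  rcases hτ.2.eq_or_lt with h | h
  · refine ⟨fun _ => x, ⟨continuousOn_const, fun r hr => ?_⟩,
      fun s hs => IsTrajectoryBound.lt hN hU hglob hx, ?_⟩
    · simp [h]
    · rw [h, value_terminal hK hU hglob]
      simp [unitCost]
  · have hu := hv.comp_inv_timeChange h
    obtain ⟨X, hX⟩ := hglob x τ hτ _ hu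
    have hpos : 0 < P.T - τ := sub_pos.2 h
    have hvu : (fun s => (fun t => v ((P.T - τ)⁻¹ * t + -((P.T - τ)⁻¹ * τ))) (P.timeChange τ s))
        = v := by
      funext s
      simp only [timeChange]
      congr 1
      field_simp
      ring
    have h1 := hX.comp_timeChange h.le
    have h2 := unitCost_comp_timeChange (P := P) (τ := τ)
      (u := fun t => v ((P.T - τ)⁻¹ * t + -((P.T - τ)⁻¹ * τ))) (X := X)
    rw [hvu] at h1 h2
    refine ⟨_, h1, fun s hs => hN x hx τ hτ _ X hu hX _ (timeChange_mem h.le hs), ?_⟩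
    rw [h2]
    exact value_le hK hU hglob hτ hu hX

theorem exists_unitCost_lt (hK : P.IsLocalBound K) (hU : P.U.Nonempty)
    (hglob : P.HasGlobalTrajectories) (hN : P.IsTrajectoryBound R N)
    (hx : ‖x‖ ≤ R) (hτ : τ ∈ Icc P.t₀ P.T) {ε : ℝ} (hε : 0 < ε) :
    ∃ v z, P.IsUnitControl v ∧ P.IsUnitTrajectory x τ v z ∧
      (∀ s ∈ Icc (0 : ℝ) 1, ‖z s‖ < N) ∧ P.unitCost τ v z < P.value x τ + ε := by
  obtain ⟨u, X, hu, hX, hJ⟩ := exists_cost_lt_value_add hK hU hglob x hτ hε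
  rw [← unitCost_comp_timeChange] at hJ
  exact ⟨_, _, hu.comp_timeChange hτ.2, hX.comp_timeChange hτ.2,
    fun s hs => hN x hx τ hτ u X hu hX _ (timeChange_mem hτ.2 hs), hJ⟩

theorem IsUnitTrajectory.intervalIntegrable (hUc : IsCompact P.U) (h1 : P.H1)
    (hv : P.IsUnitControl v) (hz : P.IsUnitTrajectory x τ v z) (hτ : τ ∈ Icc P.t₀ P.T) {a b : ℝ}
    (ha : 0 ≤ a) (hab : a ≤ b) (hb : b ≤ 1) :
    IntervalIntegrable (fun s => (P.T - τ) • P.f (z s) (v s) (P.timeChange τ s)) volume a b ∧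
    IntervalIntegrable (fun s => (P.T - τ) • P.F (z s) (v s) (P.timeChange τ s)) volume a b := by
  have hs : Icc a b ⊆ Icc 0 1 := Icc_subset_Icc ha hb
  have hm : AEMeasurable v (volume.restrict (Icc a b)) :=
    hv.1.mono_measure (Measure.restrict_mono hs le_rfl)
  have ht : MapsTo (P.timeChange τ) (Icc a b) (Icc P.t₀ P.T) := fun s h =>
    Icc_subset_Icc_left hτ.1 (timeChange_mem hτ.2 (hs h))
  exact ⟨(intervalIntegrable_comp (g := P.f) hUc h1.1 hab (hz.1.mono hs) hm (fun s h => hv.2 s (hs h))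
      (continuous_timeChange τ).continuousOn ht).smul (P.T - τ),
    (intervalIntegrable_comp (g := P.F) hUc h1.2.1 hab (hz.1.mono hs) hm (fun s h => hv.2 s (hs h))
      (continuous_timeChange τ).continuousOn ht).smul (P.T - τ)⟩

end

end LagrangeOCP

/-! ### Local Lipschitz continuity of the value function -/

theorem norm_smul_sub_smul_le {G : Type*} [NormedAddCommGroup G] [NormedSpace ℝ G] (c₁ c₀ : ℝ)
    (a₁ a₀ : G) : ‖c₁ • a₁ - c₀ • a₀‖ ≤ |c₁ - c₀| * ‖a₁‖ + |c₀| * ‖a₁ - a₀‖ := by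
  have h : c₁ • a₁ - c₀ • a₀ = (c₁ - c₀) • a₁ + c₀ • (a₁ - a₀) := by
    rw [sub_smul, smul_sub]; abel
  rw [h, ← Real.norm_eq_abs, ← Real.norm_eq_abs, ← norm_smul, ← norm_smul]
  exact norm_add_le _ _

namespace LagrangeOCP

variable {n m : ℕ} {P : LagrangeOCP n m}

theorem timeChange_sub (τ₁ τ₀ s : ℝ) :
    P.timeChange τ₁ s - P.timeChange τ₀ s = (τ₁ - τ₀) * (1 - s) := by
  unfold timeChange; ring

theorem abs_timeChange_sub_le (τ₁ τ₀ : ℝ) {s : ℝ} (hs : s ∈ Icc (0 : ℝ) 1) :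
    |P.timeChange τ₁ s - P.timeChange τ₀ s| ≤ |τ₁ - τ₀| := by
  rw [timeChange_sub, abs_mul, abs_of_nonneg (sub_nonneg.2 hs.2)]
  exact mul_le_of_le_one_right (abs_nonneg _) (by linarith [hs.1])

theorem timeChange_mem' {τ s : ℝ} (hτ : τ ∈ Icc P.t₀ P.T) (hs : s ∈ Icc (0 : ℝ) 1) :
    P.timeChange τ s ∈ Icc P.t₀ P.T :=
  Icc_subset_Icc_left hτ.1 (timeChange_mem hτ.2 hs)

section

variable {x₁ x₀ : EuclideanSpace ℝ (Fin n)} {τ₁ τ₀ : ℝ} {v : ℝ → EuclideanSpace ℝ (Fin m)}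
  {z₁ z₀ : ℝ → EuclideanSpace ℝ (Fin n)} {K : ℝ → ℝ} {R N : ℝ}

/-- A Lipschitz constant of the rescaled dynamics and cost. -/
noncomputable def unitLip (P : LagrangeOCP n m) (K : ℝ → ℝ) (N : ℝ) : ℝ :=
  K N * (1 + (P.T - P.t₀))

/-- The initial time enters through the factor `T - τ` and through the time argument; each changes
by at most `|τ₁ - τ₀|`. The constant `k` serves both as a bound and as a Lipschitz constant. -/
theorem rescaled_sub_le {G : Type*} [NormedAddCommGroup G] [NormedSpace ℝ G]
    {g₁ g₀ : G} {k d s : ℝ} (hs : s ∈ Icc (0 : ℝ) 1) (hk : 0 ≤ k) (hd : 0 ≤ d)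
    (hτ₀ : τ₀ ∈ Icc P.t₀ P.T) (h1 : ‖g₁‖ ≤ k)
    (h2 : ‖g₁ - g₀‖ ≤ k * (|P.timeChange τ₁ s - P.timeChange τ₀ s| + d)) :
    ‖(P.T - τ₁) • g₁ - (P.T - τ₀) • g₀‖ ≤ k * (1 + (P.T - P.t₀)) * (|τ₁ - τ₀| + d) := by
  refine (norm_smul_sub_smul_le _ _ _ _).trans ?_
  have e1 : |P.T - τ₁ - (P.T - τ₀)| = |τ₁ - τ₀| := by
    rw [abs_sub_comm τ₁ τ₀]; congr 1; ring
  have e2 : |P.T - τ₀| = P.T - τ₀ := abs_of_nonneg (sub_nonneg.2 hτ₀.2)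
  have e3 : P.T - τ₀ ≤ P.T - P.t₀ := by linarith [hτ₀.1]
  have e4 := abs_timeChange_sub_le (P := P) τ₁ τ₀ hs
  rw [e1, e2]
  have h3 : ‖g₁ - g₀‖ ≤ k * (|τ₁ - τ₀| + d) :=
    h2.trans (mul_le_mul_of_nonneg_left (by linarith) hk)
  have h4 : (P.T - τ₀) * ‖g₁ - g₀‖ ≤ (P.T - P.t₀) * (k * (|τ₁ - τ₀| + d)) :=
    mul_le_mul e3 h3 (norm_nonneg _) (by linarith [P.t₀_lt_T])
  have h5 : |τ₁ - τ₀| * ‖g₁‖ ≤ |τ₁ - τ₀| * k := mul_le_mul_of_nonneg_left h1 (abs_nonneg _)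
  nlinarith [mul_nonneg hk hd]

theorem IsLocalBound.unitLip_nonneg (hK : P.IsLocalBound K) (hN : 0 ≤ N) : 0 ≤ P.unitLip K N :=
  mul_nonneg (zero_le_one.trans (hK.one_le N hN)) (by linarith [P.t₀_lt_T])

theorem IsLocalBound.rescaled_f_sub_le (hK : P.IsLocalBound K) {y₁ y₀ : EuclideanSpace ℝ (Fin n)}
    {w : EuclideanSpace ℝ (Fin m)} {s : ℝ} (hs : s ∈ Icc (0 : ℝ) 1) (hw : w ∈ P.U)
    (hτ₁ : τ₁ ∈ Icc P.t₀ P.T) (hτ₀ : τ₀ ∈ Icc P.t₀ P.T) (h₁ : ‖y₁‖ < N) (h₀ : ‖y₀‖ < N) :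
    ‖(P.T - τ₁) • P.f y₁ w (P.timeChange τ₁ s) - (P.T - τ₀) • P.f y₀ w (P.timeChange τ₀ s)‖ ≤
      P.unitLip K N * (|τ₁ - τ₀| + ‖y₁ - y₀‖) :=
  rescaled_sub_le hs (zero_le_one.trans (hK.one_le N ((norm_nonneg _).trans h₁.le)))
    (norm_nonneg _) hτ₀ (hK.f_le h₁ hw (timeChange_mem' hτ₁ hs))
    (hK.f_sub_le h₁ h₀ hw (timeChange_mem' hτ₁ hs) (timeChange_mem' hτ₀ hs))

theorem IsLocalBound.rescaled_F_sub_le (hK : P.IsLocalBound K) {y₁ y₀ : EuclideanSpace ℝ (Fin n)}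
    {w : EuclideanSpace ℝ (Fin m)} {s : ℝ} (hs : s ∈ Icc (0 : ℝ) 1) (hw : w ∈ P.U)
    (hτ₁ : τ₁ ∈ Icc P.t₀ P.T) (hτ₀ : τ₀ ∈ Icc P.t₀ P.T) (h₁ : ‖y₁‖ < N) (h₀ : ‖y₀‖ < N) :
    ‖(P.T - τ₁) • P.F y₁ w (P.timeChange τ₁ s) - (P.T - τ₀) • P.F y₀ w (P.timeChange τ₀ s)‖ ≤
      P.unitLip K N * (|τ₁ - τ₀| + ‖y₁ - y₀‖) :=
  rescaled_sub_le hs (zero_le_one.trans (hK.one_le N ((norm_nonneg _).trans h₁.le)))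
    (norm_nonneg _) hτ₀ (hK.F_le h₁ hw (timeChange_mem' hτ₁ hs))
    (hK.F_sub_le h₁ h₀ hw (timeChange_mem' hτ₁ hs) (timeChange_mem' hτ₀ hs))

/-- Under a common control, a change of initial time is only a Lipschitz perturbation of the
rescaled vector field, so Gronwall treats it like a change of initial point. -/
theorem IsUnitTrajectory.norm_sub_le (hK : P.IsLocalBound K) (hUc : IsCompact P.U) (h1 : P.H1)
    (hv : P.IsUnitControl v) (hτ₁ : τ₁ ∈ Icc P.t₀ P.T) (hτ₀ : τ₀ ∈ Icc P.t₀ P.T)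
    (hz₁ : P.IsUnitTrajectory x₁ τ₁ v z₁) (hz₀ : P.IsUnitTrajectory x₀ τ₀ v z₀)
    (hN₁ : ∀ s ∈ Icc (0 : ℝ) 1, ‖z₁ s‖ < N) (hN₀ : ∀ s ∈ Icc (0 : ℝ) 1, ‖z₀ s‖ < N) :
    ∀ s ∈ Icc (0 : ℝ) 1, ‖z₁ s - z₀ s‖ ≤
      (1 + P.unitLip K N) * Real.exp (P.unitLip K N) * (|τ₁ - τ₀| + ‖x₁ - x₀‖) := by
  intro s hs
  have hNpos : 0 ≤ N := (norm_nonneg _).trans (hN₁ s hs).le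
  set C := P.unitLip K N with hC
  have hC0 : 0 ≤ C := hK.unitLip_nonneg hNpos
  have hcont : ContinuousOn (fun s => ‖z₁ s - z₀ s‖) (Icc 0 1) := (hz₁.1.sub hz₀.1).norm
  have key := le_mul_exp_of_le_add_mul_integral (φ := fun s => ‖z₁ s - z₀ s‖)
    (A := ‖x₁ - x₀‖ + C * |τ₁ - τ₀|) hC0 hcont (fun r hr => ?_) s hs
  · refine key.trans ?_
    have h2 : Real.exp (C * (s - 0)) ≤ Real.exp C :=
      Real.exp_le_exp.2 (by rw [sub_zero]; exact mul_le_of_le_one_right hC0 hs.2)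
    have h3 : ‖x₁ - x₀‖ + C * |τ₁ - τ₀| ≤ (1 + C) * (|τ₁ - τ₀| + ‖x₁ - x₀‖) := by
      nlinarith [norm_nonneg (x₁ - x₀), abs_nonneg (τ₁ - τ₀), mul_nonneg hC0 (norm_nonneg (x₁ - x₀))]
    calc _ ≤ ((1 + C) * (|τ₁ - τ₀| + ‖x₁ - x₀‖)) * Real.exp C :=
          mul_le_mul h3 h2 (Real.exp_pos _).le (by positivity)
      _ = _ := by ring
  · have i1 := (hz₁.intervalIntegrable hUc h1 hv hτ₁ le_rfl hr.1 hr.2).1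
    have i0 := (hz₀.intervalIntegrable hUc h1 hv hτ₀ le_rfl hr.1 hr.2).1
    have iz : IntervalIntegrable (fun s => ‖z₁ s - z₀ s‖) volume 0 r :=
      (hcont.mono (by rw [uIcc_of_le hr.1]; exact Icc_subset_Icc_right hr.2)).intervalIntegrable
    have e : z₁ r - z₀ r = (x₁ - x₀) + ∫ s in (0 : ℝ)..r,
        ((P.T - τ₁) • P.f (z₁ s) (v s) (P.timeChange τ₁ s) -
          (P.T - τ₀) • P.f (z₀ s) (v s) (P.timeChange τ₀ s)) := by
      rw [hz₁.2 r hr, hz₀.2 r hr, intervalIntegral.integral_sub i1 i0]; abel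
    have e2 : ‖∫ s in (0 : ℝ)..r, ((P.T - τ₁) • P.f (z₁ s) (v s) (P.timeChange τ₁ s) -
          (P.T - τ₀) • P.f (z₀ s) (v s) (P.timeChange τ₀ s))‖ ≤
        ∫ s in (0 : ℝ)..r, C * (|τ₁ - τ₀| + ‖z₁ s - z₀ s‖) := by
      refine intervalIntegral.norm_integral_le_of_norm_le hr.1 (Eventually.of_forall fun s hs => ?_)
        ((intervalIntegrable_const.add iz).const_mul C)
      have hs' : s ∈ Icc (0 : ℝ) 1 := ⟨hs.1.le, hs.2.trans hr.2⟩
      exact hK.rescaled_f_sub_le hs' (hv.2 s hs') hτ₁ hτ₀ (hN₁ s hs') (hN₀ s hs')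
    rw [intervalIntegral.integral_const_mul, intervalIntegral.integral_add intervalIntegrable_const iz,
      intervalIntegral.integral_const, sub_zero, smul_eq_mul] at e2
    calc ‖z₁ r - z₀ r‖ ≤ ‖x₁ - x₀‖ + C * (r * |τ₁ - τ₀| + ∫ s in (0 : ℝ)..r, ‖z₁ s - z₀ s‖) := by
          rw [e]; exact (norm_add_le _ _).trans (by linarith)
      _ ≤ _ := by
          have := mul_le_mul_of_nonneg_left (mul_le_of_le_one_left (abs_nonneg (τ₁ - τ₀)) hr.2) hC0
          linarith

/-- The value function is locally Lipschitz. -/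
theorem exists_value_lipschitz (hK : P.IsLocalBound K) (hU : P.U.Nonempty) (hUc : IsCompact P.U)
    (h1 : P.H1) (hglob : P.HasGlobalTrajectories) (R : ℝ) :
    ∃ C, 0 ≤ C ∧ ∀ x₁ x₀ : EuclideanSpace ℝ (Fin n), ‖x₁‖ ≤ R → ‖x₀‖ ≤ R →
      ∀ τ₁ ∈ Icc P.t₀ P.T, ∀ τ₀ ∈ Icc P.t₀ P.T,
        |P.value x₁ τ₁ - P.value x₀ τ₀| ≤ C * (|τ₁ - τ₀| + ‖x₁ - x₀‖) := by
  obtain ⟨N', hN'⟩ := exists_trajectory_bound hK hU hglob R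
  set N := max N' 0 with hNdef
  have hN : P.IsTrajectoryBound R N := fun x hx τ hτ u X hu hX t ht =>
    (hN' x hx τ hτ u X hu hX t ht).trans_le (le_max_left _ _)
  set L := P.unitLip K N with hL
  have hL0 : 0 ≤ L := hK.unitLip_nonneg (le_max_right _ _)
  set D := (1 + L) * Real.exp L with hD
  have hD0 : 0 ≤ D := by positivity
  refine ⟨L * (1 + D), by positivity, ?_⟩
  have key : ∀ x₁ x₀ : EuclideanSpace ℝ (Fin n), ‖x₁‖ ≤ R → ‖x₀‖ ≤ R →
      ∀ τ₁ ∈ Icc P.t₀ P.T, ∀ τ₀ ∈ Icc P.t₀ P.T,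
        P.value x₁ τ₁ - P.value x₀ τ₀ ≤ L * (1 + D) * (|τ₁ - τ₀| + ‖x₁ - x₀‖) := by
    intro x₁ x₀ hx₁ hx₀ τ₁ hτ₁ τ₀ hτ₀
    refine le_of_forall_pos_le_add fun ε hε => ?_
    -- A control nearly optimal for one datum is run from the other, where it still bounds the value
    -- from above.
    obtain ⟨v, z₀, hv, hz₀, hN₀, hJ₀⟩ := exists_unitCost_lt hK hU hglob hN hx₀ hτ₀ hε
    obtain ⟨z₁, hz₁, hN₁, hJ₁⟩ := hv.exists_unitTrajectory hK hU hglob hN hx₁ hτ₁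
    have hdist := hz₁.norm_sub_le hK hUc h1 hv hτ₁ hτ₀ hz₀ hN₁ hN₀
    have hJ : P.unitCost τ₁ v z₁ - P.unitCost τ₀ v z₀ ≤ L * (1 + D) * (|τ₁ - τ₀| + ‖x₁ - x₀‖) := by
      unfold unitCost
      rw [← intervalIntegral.integral_sub
        (hz₁.intervalIntegrable hUc h1 hv hτ₁ le_rfl zero_le_one le_rfl).2
        (hz₀.intervalIntegrable hUc h1 hv hτ₀ le_rfl zero_le_one le_rfl).2]
      have := intervalIntegral.norm_integral_le_of_norm_le_const (a := 0) (b := 1)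
        (f := fun s => (P.T - τ₁) • P.F (z₁ s) (v s) (P.timeChange τ₁ s) -
          (P.T - τ₀) • P.F (z₀ s) (v s) (P.timeChange τ₀ s))
        (C := L * (1 + D) * (|τ₁ - τ₀| + ‖x₁ - x₀‖)) ?_
      · rw [sub_zero, abs_one, mul_one] at this
        exact (le_abs_self _).trans this
      · intro s hs
        rw [uIoc_of_le zero_le_one] at hs
        have hs' : s ∈ Icc (0 : ℝ) 1 := ⟨hs.1.le, hs.2⟩
        refine (hK.rescaled_F_sub_le hs' (hv.2 s hs') hτ₁ hτ₀ (hN₁ s hs') (hN₀ s hs')).trans ?_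
        rw [mul_assoc]
        refine mul_le_mul_of_nonneg_left ?_ hL0
        have h3 := hdist s hs'
        nlinarith [norm_nonneg (x₁ - x₀)]
    linarith
  intro x₁ x₀ hx₁ hx₀ τ₁ hτ₁ τ₀ hτ₀
  refine abs_sub_le_iff.2 ⟨key x₁ x₀ hx₁ hx₀ τ₁ hτ₁ τ₀ hτ₀, ?_⟩
  rw [abs_sub_comm, norm_sub_rev]
  exact key x₀ x₁ hx₀ hx₁ τ₀ hτ₀ τ₁ hτ₁

end

end LagrangeOCP

/-! ### Joint semiconcavity of the value function -/

/-- Three errors are separated: the convexity defect of the unscaled function (`b` is its value at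
the combined point), the cross term of two factors that both vary, already carrying `l * (1 - l)`,
and the deviation of the actual trajectory from the combined one. -/
theorem convexComb_smul_sub {G : Type*} [NormedAddCommGroup G] [NormedSpace ℝ G]
    (l T τ₁ τ₀ : ℝ) (a₁ a₀ b c : G) :
    l • (T - τ₁) • a₁ + (1 - l) • (T - τ₀) • a₀ - (T - (l * τ₁ + (1 - l) * τ₀)) • c =
      (T - (l * τ₁ + (1 - l) * τ₀)) • (l • a₁ + (1 - l) • a₀ - b) +
        (l * (1 - l) * (τ₀ - τ₁)) • (a₁ - a₀) + (T - (l * τ₁ + (1 - l) * τ₀)) • (b - c) := by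
  module

theorem intervalIntegral_convexComb_sub {G : Type*} [NormedAddCommGroup G] [NormedSpace ℝ G]
    {f g h : ℝ → G} {a b : ℝ} (l : ℝ) (hf : IntervalIntegrable f volume a b)
    (hg : IntervalIntegrable g volume a b) (hh : IntervalIntegrable h volume a b) :
    IntervalIntegrable (fun s => l • f s + (1 - l) • g s - h s) volume a b ∧
    ∫ s in a..b, (l • f s + (1 - l) • g s - h s) =
      l • (∫ s in a..b, f s) + (1 - l) • (∫ s in a..b, g s) - ∫ s in a..b, h s := by
  have i1 : IntervalIntegrable (fun s => l • f s) volume a b := hf.smul l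
  have i2 : IntervalIntegrable (fun s => (1 - l) • g s) volume a b := hg.smul (1 - l)
  refine ⟨(i1.add i2).sub hh, ?_⟩
  rw [intervalIntegral.integral_sub (i1.add i2) hh, intervalIntegral.integral_add i1 i2,
    intervalIntegral.integral_smul, intervalIntegral.integral_smul]

theorem norm_convexComb_lt {G : Type*} [NormedAddCommGroup G] [NormedSpace ℝ G] {a b : G} {N l : ℝ}
    (hl : l ∈ Icc (0 : ℝ) 1) (ha : ‖a‖ < N) (hb : ‖b‖ < N) : ‖l • a + (1 - l) • b‖ < N := by
  have := convex_ball (0 : G) N (mem_ball_zero_iff.2 ha) (mem_ball_zero_iff.2 hb) hl.1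
    (sub_nonneg.2 hl.2) (by ring)
  exact mem_ball_zero_iff.1 this

namespace LagrangeOCP

variable {n m : ℕ} {P : LagrangeOCP n m}

theorem timeChange_convexComb (τ₁ τ₀ l s : ℝ) :
    P.timeChange (l * τ₁ + (1 - l) * τ₀) s =
      l * P.timeChange τ₁ s + (1 - l) * P.timeChange τ₀ s := by
  unfold timeChange; ring

theorem convexComb_mem_Icc {a b l τ₁ τ₀ : ℝ} (hl : l ∈ Icc (0 : ℝ) 1) (h₁ : τ₁ ∈ Icc a b)
    (h₀ : τ₀ ∈ Icc a b) : l * τ₁ + (1 - l) * τ₀ ∈ Icc a b :=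
  convex_Icc a b h₁ h₀ hl.1 (sub_nonneg.2 hl.2) (by ring)

/-- The modulus of the rescaled dynamics obtained from a modulus `ω` of the original one. -/
def rescaledModulus (P : LagrangeOCP n m) (ω : ℝ → ℝ → ℝ) (N k c d : ℝ) : ℝ :=
  (P.T - P.t₀) * c * ω N (c * d) + k * c * d

section Modulus

variable {ω : ℝ → ℝ → ℝ} {N k c : ℝ}

theorem rescaledModulus_nonneg (hω : IsSemiconcavityModulus ω) (hN : 0 ≤ N) (hk : 0 ≤ k)
    (hc : 0 ≤ c) {d : ℝ} (hd : 0 ≤ d) : 0 ≤ P.rescaledModulus ω N k c d := by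
  have h1 := hω.1 N (c * d) hN (mul_nonneg hc hd)
  have h2 : 0 ≤ P.T - P.t₀ := by linarith [P.t₀_lt_T]
  unfold rescaledModulus
  positivity

theorem rescaledModulus_mono (hω : IsSemiconcavityModulus ω) (hN : 0 ≤ N) (hk : 0 ≤ k)
    (hc : 0 ≤ c) {d e : ℝ} (hd : 0 ≤ d) (hde : d ≤ e) :
    P.rescaledModulus ω N k c d ≤ P.rescaledModulus ω N k c e := by
  have h1 := hω.2.1 N N (c * d) (c * e) hN le_rfl (mul_nonneg hc hd)
    (mul_le_mul_of_nonneg_left hde hc)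
  have h2 : 0 ≤ P.T - P.t₀ := by linarith [P.t₀_lt_T]
  unfold rescaledModulus
  gcongr

theorem tendsto_rescaledModulus (hω : IsSemiconcavityModulus ω) (hN : 0 < N) (hc : 0 < c) :
    Tendsto (P.rescaledModulus ω N k c) (𝓝[>] 0) (𝓝 0) := by
  have h0 : Tendsto (fun d : ℝ => c * d) (𝓝[>] 0) (𝓝[>] 0) := by
    refine tendsto_nhdsWithin_iff.2 ⟨?_, ?_⟩
    · have : Tendsto (fun d : ℝ => c * d) (𝓝 0) (𝓝 (c * 0)) := tendsto_id.const_mul c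
      rw [mul_zero] at this
      exact this.mono_left nhdsWithin_le_nhds
    · filter_upwards [self_mem_nhdsWithin] with d hd
      exact mul_pos hc hd
  have h1 := ((hω.2.2 N hN).comp h0).const_mul ((P.T - P.t₀) * c)
  have h2 : Tendsto (fun d : ℝ => k * c * d) (𝓝[>] 0) (𝓝 (k * c * 0)) :=
    (tendsto_id.const_mul (k * c)).mono_left nhdsWithin_le_nhds
  have := h1.add h2
  rw [mul_zero, mul_zero, add_zero] at this
  exact this

end Modulus

section

variable {x₁ x₀ : EuclideanSpace ℝ (Fin n)} {τ₁ τ₀ l : ℝ} {v : ℝ → EuclideanSpace ℝ (Fin m)}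
  {z₁ z₀ z : ℝ → EuclideanSpace ℝ (Fin n)} {K : ℝ → ℝ} {N : ℝ} {ω : ℝ → ℝ → ℝ}

/-- Bounds the first two errors. `D` is the distance along the trajectories, controlled by `c` times
the initial distance `d`; the cross term is quadratic in `d`, hence the linear summand of the
modulus. -/
theorem rescaled_error_le (hω : IsSemiconcavityModulus ω) {k c d D q : ℝ} (hN : 0 ≤ N)
    (hk : 0 ≤ k) (hl : l ∈ Icc (0 : ℝ) 1) (hD : 0 ≤ D) (hDc : D ≤ c * d) (hτd : |τ₁ - τ₀| ≤ d)
    (hc : 0 ≤ c) (hd : 0 ≤ d) (hq : q ∈ Icc P.t₀ P.T) :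
    (P.T - q) * (l * (1 - l) * D * ω N D) + l * (1 - l) * |τ₁ - τ₀| * (k * D) ≤
      l * (1 - l) * d * P.rescaledModulus ω N k c d := by
  have hA : 0 ≤ l * (1 - l) := mul_nonneg hl.1 (sub_nonneg.2 hl.2)
  have h1 : ω N D ≤ ω N (c * d) := hω.2.1 N N D (c * d) hN le_rfl hD hDc
  have h2 := hω.1 N D hN hD
  have h3 : P.T - q ≤ P.T - P.t₀ := by linarith [hq.1]
  have h4 : 0 ≤ P.T - q := by linarith [hq.2]
  have h5 : 0 ≤ P.T - P.t₀ := h4.trans h3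
  calc (P.T - q) * (l * (1 - l) * D * ω N D) + l * (1 - l) * |τ₁ - τ₀| * (k * D)
      ≤ (P.T - P.t₀) * (l * (1 - l) * (c * d) * ω N (c * d)) + l * (1 - l) * d * (k * (c * d)) := by
        gcongr
    _ = _ := by unfold rescaledModulus; ring

/-- The deviation vanishes at time `0`, and its derivative is bounded by the semiconcavity error
plus a multiple of the deviation, so Gronwall applies. The dynamics enter in norm, which is why the
condition on `f` is two-sided. -/
theorem IsUnitTrajectory.norm_convexComb_sub_le (hK : P.IsLocalBound K) (hUc : IsCompact P.U)
    (h1 : P.H1) (hω : IsSemiconcavityModulus ω)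
    (h3 : ∀ R : ℝ, 0 < R → ∀ x ∈ Metric.ball (0 : EuclideanSpace ℝ (Fin n)) R,
      ∀ y ∈ Metric.ball (0 : EuclideanSpace ℝ (Fin n)) R,
      ∀ t ∈ Icc P.t₀ P.T, ∀ s ∈ Icc P.t₀ P.T, ∀ u ∈ P.U, ∀ l ∈ Icc (0 : ℝ) 1,
        ‖l • P.f x u t + (1 - l) • P.f y u s
            - P.f (l • x + (1 - l) • y) u (l * t + (1 - l) * s)‖
          ≤ l * (1 - l) * (|t - s| + ‖x - y‖) * ω R (|t - s| + ‖x - y‖))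
    (hv : P.IsUnitControl v) (hl : l ∈ Icc (0 : ℝ) 1)
    (hτ₁ : τ₁ ∈ Icc P.t₀ P.T) (hτ₀ : τ₀ ∈ Icc P.t₀ P.T)
    (hz₁ : P.IsUnitTrajectory x₁ τ₁ v z₁) (hz₀ : P.IsUnitTrajectory x₀ τ₀ v z₀)
    (hz : P.IsUnitTrajectory (l • x₁ + (1 - l) • x₀) (l * τ₁ + (1 - l) * τ₀) v z)
    (hN₁ : ∀ s ∈ Icc (0 : ℝ) 1, ‖z₁ s‖ < N) (hN₀ : ∀ s ∈ Icc (0 : ℝ) 1, ‖z₀ s‖ < N)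
    (hNz : ∀ s ∈ Icc (0 : ℝ) 1, ‖z s‖ < N) {c : ℝ} (hc : 0 ≤ c)
    (hdist : ∀ s ∈ Icc (0 : ℝ) 1, |P.timeChange τ₁ s - P.timeChange τ₀ s| + ‖z₁ s - z₀ s‖ ≤
      c * (|τ₁ - τ₀| + ‖x₁ - x₀‖)) :
    ∀ s ∈ Icc (0 : ℝ) 1, ‖l • z₁ s + (1 - l) • z₀ s - z s‖ ≤
      l * (1 - l) * (|τ₁ - τ₀| + ‖x₁ - x₀‖) *
        P.rescaledModulus ω N (K N) c (|τ₁ - τ₀| + ‖x₁ - x₀‖) *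
        Real.exp ((P.T - P.t₀) * K N) := by
  intro s hs
  set d := |τ₁ - τ₀| + ‖x₁ - x₀‖ with hd
  have hd0 : 0 ≤ d := by positivity
  have hN : 0 < N := (norm_nonneg _).trans_lt (hN₁ s hs)
  set k := K N with hk
  have hk0 : 0 ≤ k := zero_le_one.trans (hK.one_le N hN.le)
  have hΛ : 0 ≤ P.T - P.t₀ := by linarith [P.t₀_lt_T]
  have hA : 0 ≤ l * (1 - l) := mul_nonneg hl.1 (sub_nonneg.2 hl.2)
  have hMod := rescaledModulus_nonneg (P := P) hω hN.le hk0 hc hd0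
  set M := l * (1 - l) * d * P.rescaledModulus ω N k c d with hM
  have hM0 : 0 ≤ M := mul_nonneg (mul_nonneg hA hd0) hMod
  set q := l * τ₁ + (1 - l) * τ₀ with hqdef
  have hq : q ∈ Icc P.t₀ P.T := convexComb_mem_Icc hl hτ₁ hτ₀
  have hcont : ContinuousOn (fun s => ‖l • z₁ s + (1 - l) • z₀ s - z s‖) (Icc 0 1) :=
    (((hz₁.1.const_smul l).add (hz₀.1.const_smul (1 - l))).sub hz.1).norm
  have hpt : ∀ s ∈ Icc (0 : ℝ) 1,
      ‖l • (P.T - τ₁) • P.f (z₁ s) (v s) (P.timeChange τ₁ s) +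
        (1 - l) • (P.T - τ₀) • P.f (z₀ s) (v s) (P.timeChange τ₀ s) -
        (P.T - q) • P.f (z s) (v s) (P.timeChange q s)‖ ≤
      M + (P.T - P.t₀) * k * ‖l • z₁ s + (1 - l) • z₀ s - z s‖ := by
    intro s hs
    have ht₁ := timeChange_mem' (P := P) hτ₁ hs
    have ht₀ := timeChange_mem' (P := P) hτ₀ hs
    have htq := timeChange_mem' (P := P) hq hs
    set D := |P.timeChange τ₁ s - P.timeChange τ₀ s| + ‖z₁ s - z₀ s‖ with hD
    have e1 := h3 N hN (z₁ s) (mem_ball_zero_iff.2 (hN₁ s hs)) (z₀ s)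
      (mem_ball_zero_iff.2 (hN₀ s hs)) _ ht₁ _ ht₀ (v s) (hv.2 s hs) l hl
    rw [← timeChange_convexComb, ← hqdef, ← hD] at e1
    have e2 := hK.f_sub_le (hN₁ s hs) (hN₀ s hs) (hv.2 s hs) ht₁ ht₀
    rw [← hD, ← hk] at e2
    have e3 := hK.f_sub_le (norm_convexComb_lt hl (hN₁ s hs) (hN₀ s hs)) (hNz s hs) (hv.2 s hs)
      htq htq
    rw [sub_self, abs_zero, zero_add, ← hk] at e3
    have e4 := rescaled_error_le (P := P) hω (k := k) hN.le hk0 hl (by positivity : 0 ≤ D)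
      (hdist s hs) (by rw [hd]; linarith [norm_nonneg (x₁ - x₀)] : |τ₁ - τ₀| ≤ d) hc hd0 hq
    have hTq : 0 ≤ P.T - q := by linarith [hq.2]
    have hTq' : P.T - q ≤ P.T - P.t₀ := by linarith [hq.1]
    rw [convexComb_smul_sub l P.T τ₁ τ₀ _ _
      (P.f (l • z₁ s + (1 - l) • z₀ s) (v s) (P.timeChange q s)), ← hqdef]
    refine (norm_add₃_le).trans ?_
    rw [norm_smul, norm_smul, norm_smul, Real.norm_of_nonneg hTq, Real.norm_eq_abs, abs_mul,
      abs_of_nonneg hA, abs_sub_comm τ₀]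
    have e5 := mul_le_mul_of_nonneg_left e1 hTq
    have e6 := mul_le_mul_of_nonneg_left e2 (mul_nonneg hA (abs_nonneg (τ₁ - τ₀)))
    have e7 := mul_le_mul hTq' e3 (norm_nonneg _) hΛ
    linarith
  refine (le_mul_exp_of_le_add_mul_integral (φ := fun s => ‖l • z₁ s + (1 - l) • z₀ s - z s‖)
    (A := M) (K := (P.T - P.t₀) * k) (by positivity) hcont (fun r hr => ?_) s hs).trans ?_
  · have i1 := (hz₁.intervalIntegrable hUc h1 hv hτ₁ le_rfl hr.1 hr.2).1
    have i0 := (hz₀.intervalIntegrable hUc h1 hv hτ₀ le_rfl hr.1 hr.2).1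
    have iq := (hz.intervalIntegrable hUc h1 hv hq le_rfl hr.1 hr.2).1
    have iz : IntervalIntegrable (fun s => ‖l • z₁ s + (1 - l) • z₀ s - z s‖) volume 0 r :=
      (hcont.mono (by rw [uIcc_of_le hr.1]; exact Icc_subset_Icc_right hr.2)).intervalIntegrable
    have e : l • z₁ r + (1 - l) • z₀ r - z r = ∫ s in (0 : ℝ)..r,
        (l • (P.T - τ₁) • P.f (z₁ s) (v s) (P.timeChange τ₁ s) +
        (1 - l) • (P.T - τ₀) • P.f (z₀ s) (v s) (P.timeChange τ₀ s) -
        (P.T - q) • P.f (z s) (v s) (P.timeChange q s)) := by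
      rw [(intervalIntegral_convexComb_sub l i1 i0 iq).2, hz₁.2 r hr, hz₀.2 r hr, hz.2 r hr]
      module
    beta_reduce
    rw [e]
    refine (intervalIntegral.norm_integral_le_of_norm_le hr.1
      (g := fun s => M + (P.T - P.t₀) * k * ‖l • z₁ s + (1 - l) • z₀ s - z s‖)
      (Eventually.of_forall fun s hs => hpt s ⟨hs.1.le, hs.2.trans hr.2⟩)
      (intervalIntegrable_const.add (iz.const_mul _))).trans ?_
    rw [intervalIntegral.integral_add intervalIntegrable_const (iz.const_mul _),
      intervalIntegral.integral_const, intervalIntegral.integral_const_mul, sub_zero, smul_eq_mul]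
    linarith [mul_le_of_le_one_left hM0 hr.2]
  · refine mul_le_mul_of_nonneg_left (Real.exp_le_exp.2 ?_) hM0
    rw [sub_zero]
    exact mul_le_of_le_one_right (by positivity) hs.2

/-- The one-sided condition on `F` gives the semiconcavity error at the combined trajectory;
replacing that trajectory by the actual one costs a Lipschitz multiple of `E`. -/
theorem unitCost_convexComb_le (hK : P.IsLocalBound K) (hUc : IsCompact P.U)
    (h1 : P.H1) (hω : IsSemiconcavityModulus ω)
    (h4 : ∀ R : ℝ, 0 < R → ∀ x ∈ Metric.ball (0 : EuclideanSpace ℝ (Fin n)) R,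
      ∀ y ∈ Metric.ball (0 : EuclideanSpace ℝ (Fin n)) R,
      ∀ t ∈ Icc P.t₀ P.T, ∀ s ∈ Icc P.t₀ P.T, ∀ u ∈ P.U, ∀ l ∈ Icc (0 : ℝ) 1,
        l * P.F x u t + (1 - l) * P.F y u s
            - P.F (l • x + (1 - l) • y) u (l * t + (1 - l) * s)
          ≤ l * (1 - l) * (|t - s| + ‖x - y‖) * ω R (|t - s| + ‖x - y‖))
    (hv : P.IsUnitControl v) (hl : l ∈ Icc (0 : ℝ) 1)
    (hτ₁ : τ₁ ∈ Icc P.t₀ P.T) (hτ₀ : τ₀ ∈ Icc P.t₀ P.T)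
    (hz₁ : P.IsUnitTrajectory x₁ τ₁ v z₁) (hz₀ : P.IsUnitTrajectory x₀ τ₀ v z₀)
    (hz : P.IsUnitTrajectory (l • x₁ + (1 - l) • x₀) (l * τ₁ + (1 - l) * τ₀) v z)
    (hN₁ : ∀ s ∈ Icc (0 : ℝ) 1, ‖z₁ s‖ < N) (hN₀ : ∀ s ∈ Icc (0 : ℝ) 1, ‖z₀ s‖ < N)
    (hNz : ∀ s ∈ Icc (0 : ℝ) 1, ‖z s‖ < N) {c E : ℝ} (hc : 0 ≤ c)
    (hdist : ∀ s ∈ Icc (0 : ℝ) 1, |P.timeChange τ₁ s - P.timeChange τ₀ s| + ‖z₁ s - z₀ s‖ ≤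
      c * (|τ₁ - τ₀| + ‖x₁ - x₀‖))
    (hE : ∀ s ∈ Icc (0 : ℝ) 1, ‖l • z₁ s + (1 - l) • z₀ s - z s‖ ≤ E) :
    l * P.unitCost τ₁ v z₁ + (1 - l) * P.unitCost τ₀ v z₀
        - P.unitCost (l * τ₁ + (1 - l) * τ₀) v z ≤
      l * (1 - l) * (|τ₁ - τ₀| + ‖x₁ - x₀‖) *
        P.rescaledModulus ω N (K N) c (|τ₁ - τ₀| + ‖x₁ - x₀‖) + (P.T - P.t₀) * K N * E := by
  set d := |τ₁ - τ₀| + ‖x₁ - x₀‖ with hd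
  have hd0 : 0 ≤ d := by positivity
  have hN : 0 < N := (norm_nonneg _).trans_lt (hN₁ 0 ⟨le_rfl, zero_le_one⟩)
  set k := K N with hk
  have hk0 : 0 ≤ k := zero_le_one.trans (hK.one_le N hN.le)
  have hΛ : 0 ≤ P.T - P.t₀ := by linarith [P.t₀_lt_T]
  have hA : 0 ≤ l * (1 - l) := mul_nonneg hl.1 (sub_nonneg.2 hl.2)
  set M := l * (1 - l) * d * P.rescaledModulus ω N k c d with hM
  set q := l * τ₁ + (1 - l) * τ₀ with hqdef
  have hq : q ∈ Icc P.t₀ P.T := convexComb_mem_Icc hl hτ₁ hτ₀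
  have i1 := (hz₁.intervalIntegrable hUc h1 hv hτ₁ le_rfl zero_le_one le_rfl).2
  have i0 := (hz₀.intervalIntegrable hUc h1 hv hτ₀ le_rfl zero_le_one le_rfl).2
  have iq := (hz.intervalIntegrable hUc h1 hv hq le_rfl zero_le_one le_rfl).2
  have e : l * P.unitCost τ₁ v z₁ + (1 - l) * P.unitCost τ₀ v z₀ - P.unitCost q v z =
      ∫ s in (0 : ℝ)..1, (l • (P.T - τ₁) • P.F (z₁ s) (v s) (P.timeChange τ₁ s) +
        (1 - l) • (P.T - τ₀) • P.F (z₀ s) (v s) (P.timeChange τ₀ s) -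
        (P.T - q) • P.F (z s) (v s) (P.timeChange q s)) := by
    rw [(intervalIntegral_convexComb_sub l i1 i0 iq).2]
    rfl
  rw [e]
  have hmono := intervalIntegral.integral_mono_on (zero_le_one' ℝ)
    (intervalIntegral_convexComb_sub l i1 i0 iq).1
    (intervalIntegrable_const (c := M + (P.T - P.t₀) * k * E)) (fun s hs => ?_)
  · refine hmono.trans ?_
    rw [intervalIntegral.integral_const, sub_zero, one_smul]
  · have ht₁ := timeChange_mem' (P := P) hτ₁ hs
    have ht₀ := timeChange_mem' (P := P) hτ₀ hs
    have htq := timeChange_mem' (P := P) hq hs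
    set D := |P.timeChange τ₁ s - P.timeChange τ₀ s| + ‖z₁ s - z₀ s‖ with hD
    have e1 := h4 N hN (z₁ s) (mem_ball_zero_iff.2 (hN₁ s hs)) (z₀ s)
      (mem_ball_zero_iff.2 (hN₀ s hs)) _ ht₁ _ ht₀ (v s) (hv.2 s hs) l hl
    rw [← timeChange_convexComb, ← hqdef, ← hD] at e1
    have e2 := hK.F_sub_le (hN₁ s hs) (hN₀ s hs) (hv.2 s hs) ht₁ ht₀
    rw [← hD, ← hk] at e2
    have e3 := hK.F_sub_le (norm_convexComb_lt hl (hN₁ s hs) (hN₀ s hs)) (hNz s hs) (hv.2 s hs)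
      htq htq
    rw [sub_self, abs_zero, zero_add, ← hk] at e3
    have e4 := rescaled_error_le (P := P) hω (k := k) hN.le hk0 hl (by positivity : 0 ≤ D)
      (hdist s hs) (by rw [hd]; linarith [norm_nonneg (x₁ - x₀)] : |τ₁ - τ₀| ≤ d) hc hd0 hq
    have hTq : 0 ≤ P.T - q := by linarith [hq.2]
    have hTq' : P.T - q ≤ P.T - P.t₀ := by linarith [hq.1]
    have e3' := (le_abs_self _).trans (e3.trans (mul_le_mul_of_nonneg_left (hE s hs) hk0))
    have hkE : 0 ≤ k * E := mul_nonneg hk0 ((norm_nonneg _).trans (hE s hs))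
    rw [convexComb_smul_sub l P.T τ₁ τ₀ _ _
      (P.F (l • z₁ s + (1 - l) • z₀ s) (v s) (P.timeChange q s)), ← hqdef]
    simp only [smul_eq_mul]
    have e5 := mul_le_mul_of_nonneg_left e1 hTq
    have e6 : l * (1 - l) * (τ₀ - τ₁) *
        (P.F (z₁ s) (v s) (P.timeChange τ₁ s) - P.F (z₀ s) (v s) (P.timeChange τ₀ s)) ≤
        l * (1 - l) * |τ₁ - τ₀| * (k * D) := by
      rw [mul_assoc, mul_assoc (l * (1 - l))]
      refine mul_le_mul_of_nonneg_left ((le_abs_self _).trans ?_) hA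
      rw [abs_mul, abs_sub_comm τ₀]
      exact mul_le_mul_of_nonneg_left e2 (abs_nonneg _)
    have e7 := mul_le_mul_of_nonneg_left e3' hTq
    have e8 := mul_le_mul_of_nonneg_right hTq' hkE
    linarith

end

/-- The value function is semiconcave on `closedBall 0 R × [t₀, T]`, jointly in both variables. -/
theorem exists_value_semiconcave {K : ℝ → ℝ} (hK : P.IsLocalBound K) (hU : P.U.Nonempty)
    (hUc : IsCompact P.U) (h1 : P.H1) (h3 : P.H3) (h4 : P.H4) (hglob : P.HasGlobalTrajectories)
    (R : ℝ) :
    ∃ η : ℝ → ℝ, (∀ d, 0 ≤ d → 0 ≤ η d) ∧ (∀ d e, 0 ≤ d → d ≤ e → η d ≤ η e) ∧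
      Tendsto η (𝓝[>] 0) (𝓝 0) ∧
      ∀ x₁ x₀ : EuclideanSpace ℝ (Fin n), ‖x₁‖ ≤ R → ‖x₀‖ ≤ R →
      ∀ τ₁ ∈ Icc P.t₀ P.T, ∀ τ₀ ∈ Icc P.t₀ P.T, ∀ l ∈ Icc (0 : ℝ) 1,
        l * P.value x₁ τ₁ + (1 - l) * P.value x₀ τ₀
            - P.value (l • x₁ + (1 - l) • x₀) (l * τ₁ + (1 - l) * τ₀) ≤
          l * (1 - l) * (|τ₁ - τ₀| + ‖x₁ - x₀‖) * η (|τ₁ - τ₀| + ‖x₁ - x₀‖) := by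
  obtain ⟨ω, hω, h3⟩ := h3
  obtain ⟨ω', hω', h4⟩ := h4
  obtain ⟨N', hN'⟩ := exists_trajectory_bound hK hU hglob R
  set N := max N' 1 with hNdef
  have hN : P.IsTrajectoryBound R N := fun x hx τ hτ u X hu hX t ht =>
    (hN' x hx τ hτ u X hu hX t ht).trans_le (le_max_left _ _)
  have hN0 : 0 < N := zero_lt_one.trans_le (le_max_right _ _)
  set k := K N with hk
  have hk0 : 0 ≤ k := zero_le_one.trans (hK.one_le N hN0.le)
  have hΛ : 0 ≤ P.T - P.t₀ := by linarith [P.t₀_lt_T]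
  set L := P.unitLip K N with hL
  have hL0 : 0 ≤ L := hK.unitLip_nonneg hN0.le
  set c := 1 + (1 + L) * Real.exp L with hc
  have hc0 : 0 < c := by positivity
  set B := (P.T - P.t₀) * k * Real.exp ((P.T - P.t₀) * k) with hB
  have hB0 : 0 ≤ B := by positivity
  refine ⟨fun d => P.rescaledModulus ω' N k c d + B * P.rescaledModulus ω N k c d,
    fun d hd => add_nonneg (rescaledModulus_nonneg hω' hN0.le hk0 hc0.le hd)
      (mul_nonneg hB0 (rescaledModulus_nonneg hω hN0.le hk0 hc0.le hd)),
    fun d e hd hde => add_le_add (rescaledModulus_mono hω' hN0.le hk0 hc0.le hd hde)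
      (mul_le_mul_of_nonneg_left (rescaledModulus_mono hω hN0.le hk0 hc0.le hd hde) hB0), ?_, ?_⟩
  · have := (tendsto_rescaledModulus (P := P) (k := k) hω' hN0 hc0).add
      ((tendsto_rescaledModulus (P := P) (k := k) hω hN0 hc0).const_mul B)
    simpa using this
  · intro x₁ x₀ hx₁ hx₀ τ₁ hτ₁ τ₀ hτ₀ l hl
    set d := |τ₁ - τ₀| + ‖x₁ - x₀‖ with hd
    have hq : l * τ₁ + (1 - l) * τ₀ ∈ Icc P.t₀ P.T := convexComb_mem_Icc hl hτ₁ hτ₀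
    have hxq : ‖l • x₁ + (1 - l) • x₀‖ ≤ R := by
      have := convex_closedBall (0 : EuclideanSpace ℝ (Fin n)) R (mem_closedBall_zero_iff.2 hx₁)
        (mem_closedBall_zero_iff.2 hx₀) hl.1 (sub_nonneg.2 hl.2) (by ring)
      exact mem_closedBall_zero_iff.1 this
    refine le_of_forall_pos_le_add fun ε hε => ?_
    -- The control is nearly optimal at the combined datum, whose value is subtracted; at the two
    -- end data any control gives the upper bound that is needed.
    obtain ⟨v, z, hv, hz, hNz, hJ⟩ := exists_unitCost_lt hK hU hglob hN hxq hq hε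
    obtain ⟨z₁, hz₁, hN₁, hJ₁⟩ := hv.exists_unitTrajectory hK hU hglob hN hx₁ hτ₁
    obtain ⟨z₀, hz₀, hN₀, hJ₀⟩ := hv.exists_unitTrajectory hK hU hglob hN hx₀ hτ₀
    have hdist : ∀ s ∈ Icc (0 : ℝ) 1,
        |P.timeChange τ₁ s - P.timeChange τ₀ s| + ‖z₁ s - z₀ s‖ ≤ c * d := fun s hs => by
      have e1 := hz₁.norm_sub_le hK hUc h1 hv hτ₁ hτ₀ hz₀ hN₁ hN₀ s hs
      have e2 := abs_timeChange_sub_le (P := P) τ₁ τ₀ hs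
      have e3 := norm_nonneg (x₁ - x₀)
      rw [← hL, ← hd] at e1
      rw [hc, add_mul, one_mul]
      linarith
    have hE := hz₁.norm_convexComb_sub_le hK hUc h1 hω h3 hv hl hτ₁ hτ₀ hz₀ hz hN₁ hN₀ hNz
      hc0.le hdist
    have hcost := unitCost_convexComb_le hK hUc h1 hω' h4 hv hl hτ₁ hτ₀ hz₁ hz₀ hz hN₁ hN₀ hNz
      hc0.le hdist hE
    have e1 := mul_le_mul_of_nonneg_left hJ₁ hl.1
    have e2 := mul_le_mul_of_nonneg_left hJ₀ (sub_nonneg.2 hl.2)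
    rw [← hd, ← hk] at hcost
    have e3 : l * (1 - l) * d * P.rescaledModulus ω' N k c d + (P.T - P.t₀) * k *
        (l * (1 - l) * d * P.rescaledModulus ω N k c d * Real.exp ((P.T - P.t₀) * k)) =
        l * (1 - l) * d * (P.rescaledModulus ω' N k c d + B * P.rescaledModulus ω N k c d) := by
      rw [hB]; ring
    rw [e3] at hcost
    linarith

end LagrangeOCP

/-! ### Supergradients of semiconcave functions -/

/-- The limit is the supremum of `q h - e h`: near zero `q` is at least each of these numbers, and
it exceeds their supremum by at most `e`. No monotonicity of `e` is needed. -/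
theorem exists_tendsto_of_almost_antitone {q e : ℝ → ℝ} {r C : ℝ} (hr : 0 < r)
    (hC : ∀ s ∈ Ioc 0 r, q s ≤ C) (hq : ∀ s h, 0 < s → s ≤ h → h ≤ r → q h ≤ q s + e h)
    (he : Tendsto e (𝓝[>] 0) (𝓝 0)) :
    ∃ D, Tendsto q (𝓝[>] 0) (𝓝 D) ∧ ∀ h ∈ Ioc 0 r, q h ≤ D + e h := by
  set S := (fun h => q h - e h) '' Ioc 0 r with hS
  have hbdd : BddAbove S := by
    refine ⟨C, ?_⟩
    rintro _ ⟨h, hh, rfl⟩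
    have := hq h h hh.1 le_rfl hh.2
    linarith [hC h hh]
  have hne : S.Nonempty := ⟨_, r, ⟨hr, le_rfl⟩, rfl⟩
  have hle : ∀ h ∈ Ioc 0 r, q h ≤ sSup S + e h := fun h hh => by
    have : q h - e h ≤ sSup S := le_csSup hbdd (mem_image_of_mem (fun h => q h - e h) hh)
    linarith
  refine ⟨sSup S, tendsto_order.2 ⟨fun a ha => ?_, fun a ha => ?_⟩, hle⟩
  · obtain ⟨_, ⟨h, hh, rfl⟩, hlt⟩ := exists_lt_of_lt_csSup hne ha
    filter_upwards [Ioc_mem_nhdsGT hh.1] with s hs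
    have := hq s h hs.1 hs.2 hh.2
    have hlt' : a < q h - e h := hlt
    linarith
  · filter_upwards [Ioc_mem_nhdsGT hr, he.eventually (gt_mem_nhds (sub_pos.2 ha))] with s hs hs'
    linarith [hle s hs]

section Supergradient

variable {E : Type*} [NormedAddCommGroup E] [NormedSpace ℝ E]

theorem tendsto_modulus_mul {η : ℝ → ℝ} (hη : Tendsto η (𝓝[>] 0) (𝓝 0)) {c : ℝ} (hc : 0 ≤ c) :
    Tendsto (fun h => c * η (h * c)) (𝓝[>] 0) (𝓝 0) := by
  rcases hc.eq_or_lt with rfl | hc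
  · simp
  · have h0 : Tendsto (fun h : ℝ => h * c) (𝓝[>] 0) (𝓝[>] 0) := by
      refine tendsto_nhdsWithin_iff.2 ⟨?_, ?_⟩
      · have : Tendsto (fun h : ℝ => h * c) (𝓝 0) (𝓝 (0 * c)) := tendsto_id.mul_const c
        rw [zero_mul] at this
        exact this.mono_left nhdsWithin_le_nhds
      · filter_upwards [self_mem_nhdsWithin] with d hd
        exact mul_pos hd hc
    have := (hη.comp h0).const_mul c
    rwa [mul_zero] at this

variable {Ω : Set E} {W : E → ℝ} {η : ℝ → ℝ} {C : ℝ} {x : E}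

/-- A semiconcave function has almost monotone difference quotients along segments. -/
theorem diffQuotient_le_of_semiconcave (hη0 : ∀ d, 0 ≤ d → 0 ≤ η d)
    (hW : ∀ a ∈ Ω, ∀ b ∈ Ω, ∀ l ∈ Icc (0 : ℝ) 1,
      l * W a + (1 - l) * W b - W (l • a + (1 - l) • b) ≤ l * (1 - l) * ‖a - b‖ * η ‖a - b‖)
    (hx : x ∈ Ω) {θ : E} {s h : ℝ} (hs : 0 < s) (hsh : s ≤ h) (hh : x + h • θ ∈ Ω) :
    (W (x + h • θ) - W x) / h ≤ (W (x + s • θ) - W x) / s + ‖θ‖ * η (h * ‖θ‖) := by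
  have hpos : 0 < h := hs.trans_le hsh
  have hl : s / h ∈ Icc (0 : ℝ) 1 := ⟨by positivity, (div_le_one hpos).2 hsh⟩
  have key := hW _ hh x hx (s / h) hl
  have e1 : (s / h) • (x + h • θ) + (1 - s / h) • x = x + s • θ := by
    rw [smul_add, smul_smul, div_mul_cancel₀ _ hpos.ne']; module
  have e2 : ‖x + h • θ - x‖ = h * ‖θ‖ := by
    rw [add_sub_cancel_left, norm_smul, Real.norm_of_nonneg hpos.le]
  rw [e1, e2] at key
  have hη := hη0 (h * ‖θ‖) (by positivity)
  have e3 : s / h * (1 - s / h) * (h * ‖θ‖) * η (h * ‖θ‖) ≤ s * (‖θ‖ * η (h * ‖θ‖)) := by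
    have : s / h * (1 - s / h) * (h * ‖θ‖) * η (h * ‖θ‖) =
        (1 - s / h) * (s * (‖θ‖ * η (h * ‖θ‖))) := by field_simp
    rw [this]
    exact mul_le_of_le_one_left (by positivity) (by linarith [hl.1])
  have e4 : (W (x + s • θ) - W x) / s + ‖θ‖ * η (h * ‖θ‖) - (W (x + h • θ) - W x) / h =
      (W (x + s • θ) - W x + s * (‖θ‖ * η (h * ‖θ‖)) - s / h * (W (x + h • θ) - W x)) / s := by
    field_simp
  rw [← sub_nonneg, e4]
  exact div_nonneg (by linarith) hs.le

/-- A Lipschitz semiconcave function has a supergradient at every interior point, with the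
semiconcavity modulus controlling the error. -/
theorem exists_supergradient (hΩ : Convex ℝ Ω) (hC : 0 ≤ C)
    (hLip : ∀ a ∈ Ω, ∀ b ∈ Ω, |W a - W b| ≤ C * ‖a - b‖)
    (hη0 : ∀ d, 0 ≤ d → 0 ≤ η d) (hη : Tendsto η (𝓝[>] 0) (𝓝 0))
    (hW : ∀ a ∈ Ω, ∀ b ∈ Ω, ∀ l ∈ Icc (0 : ℝ) 1,
      l * W a + (1 - l) * W b - W (l • a + (1 - l) • b) ≤ l * (1 - l) * ‖a - b‖ * η ‖a - b‖)
    (hx : Ω ∈ 𝓝 x) :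
    ∃ p : E →L[ℝ] ℝ, ‖p‖ ≤ C ∧ ∀ b ∈ Ω, W b ≤ W x + p (b - x) + ‖b - x‖ * η ‖b - x‖ := by
  have hxΩ : x ∈ Ω := mem_of_mem_nhds hx
  set q : E → ℝ → ℝ := fun θ s => (W (x + s • θ) - W x) / s with hq
  have hmem : ∀ θ : E, ∀ᶠ s : ℝ in 𝓝[>] 0, x + s • θ ∈ Ω := fun θ => by
    have : Tendsto (fun s : ℝ => x + s • θ) (𝓝 0) (𝓝 (x + (0 : ℝ) • θ)) := by
      have hc : Continuous fun s : ℝ => x + s • θ := by fun_prop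
      exact hc.tendsto 0
    rw [zero_smul, add_zero] at this
    exact (this.mono_left nhdsWithin_le_nhds).eventually hx
  have hseg : ∀ (θ : E) (r s : ℝ), 0 < s → s ≤ r → x + r • θ ∈ Ω → x + s • θ ∈ Ω := by
    intro θ r s hs hsr hr
    have hr0 : 0 < r := hs.trans_le hsr
    have := hΩ hr hxΩ (a := s / r) (b := 1 - s / r) (by positivity)
      (sub_nonneg.2 ((div_le_one hr0).2 hsr)) (by ring)
    have e1 : (s / r) • (x + r • θ) + (1 - s / r) • x = x + s • θ := by
      rw [smul_add, smul_smul, div_mul_cancel₀ _ hr0.ne']; module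
    rwa [e1] at this
  have hqbd : ∀ (θ : E) (s : ℝ), 0 < s → x + s • θ ∈ Ω → |q θ s| ≤ C * ‖θ‖ := by
    intro θ s hs hsΩ
    have := hLip _ hsΩ x hxΩ
    rw [add_sub_cancel_left, norm_smul, Real.norm_of_nonneg hs.le] at this
    rw [hq, abs_div, abs_of_pos hs, div_le_iff₀ hs]
    linarith
  have hdir : ∀ (θ : E) (r : ℝ), 0 < r → x + r • θ ∈ Ω → ∃ D, Tendsto (q θ) (𝓝[>] 0) (𝓝 D) ∧
      ∀ h ∈ Ioc 0 r, q θ h ≤ D + ‖θ‖ * η (h * ‖θ‖) := fun θ r hr hrΩ =>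
    exists_tendsto_of_almost_antitone hr (C := C * ‖θ‖)
      (fun s hs => (le_abs_self _).trans (hqbd θ s hs.1 (hseg θ r s hs.1 hs.2 hrΩ)))
      (fun s h hs hsh hhr => diffQuotient_le_of_semiconcave hη0 hW hxΩ hs hsh
        (hseg θ r h (hs.trans_le hsh) hhr hrΩ))
      (tendsto_modulus_mul hη (norm_nonneg θ))
  have hD : ∀ θ : E, ∃ D, Tendsto (q θ) (𝓝[>] 0) (𝓝 D) := fun θ => by
    obtain ⟨r, hr, hr0⟩ := ((hmem θ).and self_mem_nhdsWithin).exists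
    obtain ⟨D, hD, -⟩ := hdir θ r hr0 hr
    exact ⟨D, hD⟩
  choose D hD using hD
  -- Taking `h = 1` in direction `b - x` gives an inequality on all of `Ω` with an explicit error, a
  -- form that survives limits of base points.
  have hDle : ∀ b ∈ Ω, W b - W x ≤ D (b - x) + ‖b - x‖ * η ‖b - x‖ := by
    intro b hb
    obtain ⟨D', hD', hle⟩ := hdir (b - x) 1 one_pos (by rw [one_smul, add_sub_cancel]; exact hb)
    have := hle 1 ⟨one_pos, le_rfl⟩
    rw [tendsto_nhds_unique hD' (hD _)] at this
    simpa [hq] using this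
  have hDbd : ∀ θ, |D θ| ≤ C * ‖θ‖ := fun θ => by
    refine le_of_tendsto (hD θ).abs ?_
    filter_upwards [hmem θ, self_mem_nhdsWithin] with s hs hs0
    exact hqbd θ s hs0 hs
  have hscale : ∀ c : ℝ, 0 < c → Tendsto (fun s : ℝ => s * c) (𝓝[>] 0) (𝓝[>] 0) := fun c hc => by
    refine tendsto_nhdsWithin_iff.2 ⟨?_, ?_⟩
    · have : Tendsto (fun h : ℝ => h * c) (𝓝 0) (𝓝 (0 * c)) := tendsto_id.mul_const c
      rw [zero_mul] at this
      exact this.mono_left nhdsWithin_le_nhds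
    · filter_upwards [self_mem_nhdsWithin] with d hd
      exact mul_pos hd hc
  have hhom : ∀ c : ℝ, 0 < c → ∀ θ, D (c • θ) = c * D θ := by
    intro c hc θ
    refine tendsto_nhds_unique (hD (c • θ)) ((((hD θ).comp (hscale c hc)).const_mul c).congr' ?_)
    filter_upwards [self_mem_nhdsWithin] with s hs
    have hs0 : s ≠ 0 := ne_of_gt hs
    simp only [hq, Function.comp, smul_smul]
    field_simp
  -- Directional derivatives are superadditive: `x + s • (θ₁ + θ₂)` is the midpoint of the points `x
  -- + (s * 2) • θᵢ`.
  have hadd : ∀ θ₁ θ₂, D θ₁ + D θ₂ ≤ D (θ₁ + θ₂) := by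
    intro θ₁ θ₂
    have hlim : Tendsto (fun s => q (θ₁ + θ₂) s +
        ‖θ₁ - θ₂‖ * η (s * 2 * ‖θ₁ - θ₂‖)) (𝓝[>] 0) (𝓝 (D (θ₁ + θ₂) + 0)) :=
      (hD _).add ((tendsto_modulus_mul hη (norm_nonneg (θ₁ - θ₂))).comp (hscale 2 two_pos))
    rw [add_zero] at hlim
    refine le_of_tendsto_of_tendsto (((hD θ₁).comp (hscale 2 two_pos)).add
      ((hD θ₂).comp (hscale 2 two_pos))) hlim ?_
    filter_upwards [(hscale 2 two_pos).eventually (hmem θ₁),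
      (hscale 2 two_pos).eventually (hmem θ₂), self_mem_nhdsWithin] with s h₁ h₂ hs
    have hs0 : (0 : ℝ) < s := hs
    have key := hW _ h₁ _ h₂ (1 / 2) ⟨by norm_num, by norm_num⟩
    have e1 : (1 / 2 : ℝ) • (x + (s * 2) • θ₁) + (1 - 1 / 2 : ℝ) • (x + (s * 2) • θ₂) =
        x + s • (θ₁ + θ₂) := by module
    have e2 : ‖x + (s * 2) • θ₁ - (x + (s * 2) • θ₂)‖ = s * 2 * ‖θ₁ - θ₂‖ := by
      rw [add_sub_add_left_eq_sub, ← smul_sub, norm_smul, Real.norm_of_nonneg (by positivity)]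
    rw [e1, e2] at key
    have hη' := hη0 (s * 2 * ‖θ₁ - θ₂‖) (by positivity)
    have e3 : q (θ₁ + θ₂) s + ‖θ₁ - θ₂‖ * η (s * 2 * ‖θ₁ - θ₂‖) -
        (q θ₁ (s * 2) + q θ₂ (s * 2)) = (W (x + s • (θ₁ + θ₂)) +
          s * (‖θ₁ - θ₂‖ * η (s * 2 * ‖θ₁ - θ₂‖)) - 1 / 2 * W (x + (s * 2) • θ₁) -
          1 / 2 * W (x + (s * 2) • θ₂)) / s := by
      simp only [hq]
      field_simp
      ring
    simp only [Function.comp]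
    rw [← sub_nonneg, e3]
    refine div_nonneg ?_ hs0.le
    have : 0 ≤ s * (‖θ₁ - θ₂‖ * η (s * 2 * ‖θ₁ - θ₂‖)) := by positivity
    linarith
  have hD0 : D 0 = 0 := by
    have := hDbd 0
    simpa using this
  -- Hahn–Banach, from the trivial subspace: `-D` is sublinear, so some linear `g` lies below it,
  -- and `-g` is a supergradient.
  obtain ⟨g, -, hg⟩ := exists_extension_of_le_sublinear (⊥ : E →ₗ.[ℝ] ℝ) (fun θ => -D θ)
    (fun c hc θ => by rw [hhom c hc]; ring) (fun θ₁ θ₂ => by linarith [hadd θ₁ θ₂])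
    (fun θ => by
      have hθ : θ = 0 := Subtype.ext ((Submodule.mem_bot ℝ).1 θ.2)
      rw [hθ, LinearPMap.map_zero]
      simp [hD0])
  have hbound : ∀ θ, ‖(-g) θ‖ ≤ C * ‖θ‖ := by
    intro θ
    have h1 := hg θ
    have h2 := hg (-θ)
    have h3 := (abs_le.1 (hDbd θ)).1
    have h4 := (abs_le.1 (hDbd (-θ))).1
    rw [norm_neg] at h4
    rw [map_neg] at h2
    rw [LinearMap.neg_apply, Real.norm_eq_abs, abs_neg, abs_le]
    constructor <;> linarith
  refine ⟨(-g).mkContinuous C hbound, LinearMap.mkContinuous_norm_le _ hC _, fun b hb => ?_⟩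
  have h1 := hDle b hb
  have h2 := hg (b - x)
  rw [LinearMap.mkContinuous_apply, LinearMap.neg_apply]
  linarith

end Supergradient

/-! ### The pre-Hamiltonian along trajectories and at supergradients -/

theorem limsup_coe_le_zero {α : Type*} {l : Filter α} {g : α → ℝ}
    (h : ∀ ε > 0, ∀ᶠ a in l, g a ≤ ε) : limsup (fun a => (g a : EReal)) l ≤ 0 := by
  by_contra! hcon
  obtain ⟨ε, hε, hlt⟩ := EReal.lt_iff_exists_real_btwn.1 hcon
  have hε' : 0 < ε := by exact_mod_cast hε
  refine absurd hlt (not_lt.2 (limsup_le_of_le (h := ?_)))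
  filter_upwards [h ε hε'] with a ha
  exact_mod_cast ha

namespace LagrangeOCP

variable {n m : ℕ} {P : LagrangeOCP n m}

/-- The pre-Hamiltonian `p(f(x,w,τ), 1) + F(x,w,τ)`, for a linear functional `p` on space-time. -/
noncomputable def preHamiltonian (P : LagrangeOCP n m)
    (p : EuclideanSpace ℝ (Fin n) × ℝ →L[ℝ] ℝ) (x : EuclideanSpace ℝ (Fin n))
    (w : EuclideanSpace ℝ (Fin m)) (t : ℝ) : ℝ :=
  p (P.f x w t, 1) + P.F x w t

section

variable {x : EuclideanSpace ℝ (Fin n)} {τ h C N : ℝ} {u : ℝ → EuclideanSpace ℝ (Fin m)}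
  {X : ℝ → EuclideanSpace ℝ (Fin n)} {K : ℝ → ℝ} {p : EuclideanSpace ℝ (Fin n) × ℝ →L[ℝ] ℝ}

theorem abs_apply_fst_le (hp : ‖p‖ ≤ C) (y : EuclideanSpace ℝ (Fin n)) : |p (y, 0)| ≤ C * ‖y‖ := by
  have h1 := p.le_of_opNorm_le hp (y, 0)
  rwa [Prod.norm_mk, norm_zero, max_eq_left (norm_nonneg y)] at h1

theorem apply_eq_add_mul (y : EuclideanSpace ℝ (Fin n)) (t : ℝ) :
    p (y, t) = p (y, 0) + t * p (0, 1) := by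
  have : (y, t) = (y, (0 : ℝ)) + t • ((0 : EuclideanSpace ℝ (Fin n)), (1 : ℝ)) := by simp
  rw [this, map_add, map_smul, smul_eq_mul]

theorem IsTrajectory.norm_sub_start_le (hK : P.IsLocalBound K) (hτ : P.t₀ ≤ τ)
    (hu : P.IsAdmissibleControl τ u) (hX : P.IsTrajectory x τ u X)
    (hN : ∀ t ∈ Icc τ P.T, ‖X t‖ < N) {s : ℝ} (hs : s ∈ Icc τ P.T) :
    ‖X s - x‖ ≤ K N * (s - τ) := by
  have := hX.norm_apply_sub_le hK hτ hu le_rfl hs.1 hs.2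
    fun r hr => hN r ⟨hr.1.le, hr.2.le.trans hs.2⟩
  rwa [hX.apply_left (hs.1.trans hs.2)] at this

/-- The pre-Hamiltonian along a trajectory differs little from the one at the initial point. -/
theorem abs_preHamiltonian_sub_le (hK : P.IsLocalBound K) (hτ : P.t₀ ≤ τ) (hh : τ + h ≤ P.T)
    (hu : P.IsAdmissibleControl τ u) (hX : P.IsTrajectory x τ u X)
    (hN : ∀ t ∈ Icc τ P.T, ‖X t‖ < N) (hp : ‖p‖ ≤ C) {s : ℝ} (hs : s ∈ Icc τ (τ + h)) :
    |P.preHamiltonian p (X s) (u s) s - P.preHamiltonian p x (u s) τ| ≤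
      (C + 1) * (K N * (1 + K N)) * h := by
  have hs' : s ∈ Icc τ P.T := ⟨hs.1, hs.2.trans hh⟩
  have hτT : τ ≤ P.T := hs'.1.trans hs'.2
  have hC : 0 ≤ C := (norm_nonneg p).trans hp
  have hxN : ‖x‖ < N := by
    have := hN τ ⟨le_rfl, hτT⟩
    rwa [hX.apply_left hτT] at this
  have hK1 := hK.one_le N ((norm_nonneg _).trans hxN.le)
  have hd : |s - τ| + ‖X s - x‖ ≤ (1 + K N) * h := by
    have := hX.norm_sub_start_le hK hτ hu hN hs'
    rw [abs_of_nonneg (sub_nonneg.2 hs.1)]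
    nlinarith [hs.2]
  have e1 := (hK.f_sub_le (hN s hs') hxN (hu.2 s hs') ⟨hτ.trans hs.1, hs'.2⟩ ⟨hτ, hτT⟩).trans
    (mul_le_mul_of_nonneg_left hd (by linarith))
  have e2 := (hK.F_sub_le (hN s hs') hxN (hu.2 s hs') ⟨hτ.trans hs.1, hs'.2⟩ ⟨hτ, hτT⟩).trans
    (mul_le_mul_of_nonneg_left hd (by linarith))
  have e3 : P.preHamiltonian p (X s) (u s) s - P.preHamiltonian p x (u s) τ =
      p (P.f (X s) (u s) s - P.f x (u s) τ, 0) + (P.F (X s) (u s) s - P.F x (u s) τ) := by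
    have : (P.f (X s) (u s) s - P.f x (u s) τ, (0 : ℝ)) =
      (P.f (X s) (u s) s, 1) - (P.f x (u s) τ, 1) := by simp
    rw [this, map_sub]
    unfold preHamiltonian
    ring
  rw [e3]
  have e4 := (abs_apply_fst_le hp (P.f (X s) (u s) s - P.f x (u s) τ)).trans
    (mul_le_mul_of_nonneg_left e1 hC)
  refine (abs_add_le _ _).trans ?_
  linarith

/-- Integrated along a trajectory, the pre-Hamiltonian is the linearised increment of the value plus
the running cost, the quantity that dynamic programming compares with zero. -/
theorem integral_preHamiltonian (hUc : IsCompact P.U) (h1 : P.H1) (hτ : P.t₀ ≤ τ)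
    (hh0 : 0 ≤ h) (hh : τ + h ≤ P.T)
    (hu : P.IsAdmissibleControl τ u) (hX : P.IsTrajectory x τ u X) :
    IntervalIntegrable (fun s => P.preHamiltonian p (X s) (u s) s) volume τ (τ + h) ∧
    ∫ s in τ..(τ + h), P.preHamiltonian p (X s) (u s) s =
      p (X (τ + h) - x, h) + ∫ s in τ..(τ + h), P.F (X s) (u s) s := by
  have hle : τ ≤ τ + h := by linarith
  have i1 := hX.integrable le_rfl hle hh
  have i2 := hX.integrable_cost hUc h1 hu hτ le_rfl hle hh
  set p₁ : EuclideanSpace ℝ (Fin n) →L[ℝ] ℝ := p.comp (ContinuousLinearMap.inl ℝ _ ℝ) with hp₁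
  have hp₁' : ∀ y, p₁ y = p (y, 0) := fun y => rfl
  have i3 : IntervalIntegrable (fun s => p₁ (P.f (X s) (u s) s)) volume τ (τ + h) :=
    ⟨p₁.integrable_comp i1.1, p₁.integrable_comp i1.2⟩
  have e : (fun s => P.preHamiltonian p (X s) (u s) s) =
      fun s => p₁ (P.f (X s) (u s) s) + p (0, 1) + P.F (X s) (u s) s := by
    funext s
    rw [preHamiltonian, apply_eq_add_mul, one_mul, hp₁']
  rw [e]
  refine ⟨(i3.add intervalIntegrable_const).add i2, ?_⟩
  rw [intervalIntegral.integral_add (i3.add intervalIntegrable_const) i2,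
    intervalIntegral.integral_add i3 intervalIntegrable_const, p₁.intervalIntegral_comp_comm i1,
    ← hX.sub_eq le_rfl hle hh, hX.apply_left (hle.trans hh), intervalIntegral.integral_const,
    hp₁', apply_eq_add_mul (X (τ + h) - x) h, add_sub_cancel_left, smul_eq_mul]

/-- Freezing state and time at the initial datum changes the pre-Hamiltonian by `O(h)`, so a
pointwise bound at that datum integrates up to `O(h²)`. -/
theorem mul_sub_le_of_le_preHamiltonian (hK : P.IsLocalBound K) (hUc : IsCompact P.U) (h1 : P.H1)
    (hτ : P.t₀ ≤ τ) (hh0 : 0 ≤ h) (hh : τ + h ≤ P.T)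
    (hu : P.IsAdmissibleControl τ u) (hX : P.IsTrajectory x τ u X)
    (hN : ∀ t ∈ Icc τ P.T, ‖X t‖ < N) (hp : ‖p‖ ≤ C) {c : ℝ}
    (hc : ∀ s ∈ Icc τ (τ + h), c ≤ P.preHamiltonian p x (u s) τ) :
    h * (c - (C + 1) * (K N * (1 + K N)) * h) ≤
      p (X (τ + h) - x, h) + ∫ s in τ..(τ + h), P.F (X s) (u s) s := by
  obtain ⟨hi, he⟩ := integral_preHamiltonian (p := p) hUc h1 hτ hh0 hh hu hX
  rw [← he]
  have := intervalIntegral.integral_mono_on (a := τ) (b := τ + h) (by linarith)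
    (intervalIntegrable_const (c := c - (C + 1) * (K N * (1 + K N)) * h)) hi (fun s hs => by
      have := (abs_le.1 (abs_preHamiltonian_sub_le hK hτ hh hu hX hN hp hs)).1
      linarith [hc s hs])
  rwa [intervalIntegral.integral_const, add_sub_cancel_left, smul_eq_mul] at this

theorem le_mul_add_of_preHamiltonian_le (hK : P.IsLocalBound K) (hUc : IsCompact P.U) (h1 : P.H1)
    (hτ : P.t₀ ≤ τ) (hh0 : 0 ≤ h) (hh : τ + h ≤ P.T)
    (hu : P.IsAdmissibleControl τ u) (hX : P.IsTrajectory x τ u X)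
    (hN : ∀ t ∈ Icc τ P.T, ‖X t‖ < N) (hp : ‖p‖ ≤ C) {c : ℝ}
    (hc : ∀ s ∈ Icc τ (τ + h), P.preHamiltonian p x (u s) τ ≤ c) :
    p (X (τ + h) - x, h) + ∫ s in τ..(τ + h), P.F (X s) (u s) s ≤
      h * (c + (C + 1) * (K N * (1 + K N)) * h) := by
  obtain ⟨hi, he⟩ := integral_preHamiltonian (p := p) hUc h1 hτ hh0 hh hu hX
  rw [← he]
  have := intervalIntegral.integral_mono_on (a := τ) (b := τ + h) (by linarith) hi
    (intervalIntegrable_const (c := c + (C + 1) * (K N * (1 + K N)) * h)) (fun s hs => by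
      have := (abs_le.1 (abs_preHamiltonian_sub_le hK hτ hh hu hX hN hp hs)).2
      linarith [hc s hs])
  rwa [intervalIntegral.integral_const, add_sub_cancel_left, smul_eq_mul] at this

theorem norm_spacetime_sub_le (hK : P.IsLocalBound K) (hτ : P.t₀ ≤ τ) (hh0 : 0 ≤ h)
    (hh : τ + h ≤ P.T) (hu : P.IsAdmissibleControl τ u) (hX : P.IsTrajectory x τ u X)
    (hN : ∀ t ∈ Icc τ P.T, ‖X t‖ < N) :
    ‖(X (τ + h) - x, h)‖ ≤ h * K N := by
  have hle : τ ≤ τ + h := by linarith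
  have h2 := hX.norm_sub_start_le hK hτ hu hN ⟨hle, hh⟩
  have h3 := hK.one_le N ((norm_nonneg _).trans (hN τ ⟨le_rfl, hle.trans hh⟩).le)
  rw [Prod.norm_mk]
  refine max_le ?_ ?_
  · rw [add_sub_cancel_left] at h2
    linarith
  · rw [Real.norm_of_nonneg hh0]
    nlinarith

end

/-- Supergradients with respect to a set `Ω` and an error function `η`. -/
def IsSupergradient {E : Type*} [NormedAddCommGroup E] [NormedSpace ℝ E] (W : E → ℝ) (Ω : Set E)
    (η : ℝ → ℝ) (a : E) (p : E →L[ℝ] ℝ) : Prop :=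
  ∀ b ∈ Ω, W b ≤ W a + p (b - a) + ‖b - a‖ * η ‖b - a‖

/-- The space-time region on which semiconcavity is used. -/
def spacetime (P : LagrangeOCP n m) (R : ℝ) : Set (EuclideanSpace ℝ (Fin n) × ℝ) :=
  Metric.closedBall 0 R ×ˢ Icc P.t₀ P.T

section

variable {x : EuclideanSpace ℝ (Fin n)} {τ C R N : ℝ} {K η : ℝ → ℝ}

/-- Near every initial datum there is a supergradient for which the pre-Hamiltonian is almost
nonpositive at some control value. -/
theorem exists_approx_supergradient (hK : P.IsLocalBound K) (hU : P.U.Nonempty)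
    (hUc : IsCompact P.U) (h1 : P.H1) (hglob : P.HasGlobalTrajectories)
    (hN : P.IsTrajectoryBound R N) (hx : ‖x‖ < R) (hτ : τ ∈ Ico P.t₀ P.T)
    (hηm : ∀ d e, 0 ≤ d → d ≤ e → η d ≤ η e) (hη : Tendsto η (𝓝[>] 0) (𝓝 0))
    (hS : ∀ a, P.spacetime R ∈ 𝓝 a → ∃ p, ‖p‖ ≤ C ∧
      IsSupergradient (fun z => P.value z.1 z.2) (P.spacetime R) η a p) {ε : ℝ} (hε : 0 < ε) :
    ∃ a p w, a ∈ P.spacetime R ∧ ‖a - (x, τ)‖ ≤ ε ∧ ‖p‖ ≤ C ∧ w ∈ P.U ∧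
      IsSupergradient (fun z => P.value z.1 z.2) (P.spacetime R) η a p ∧
      P.preHamiltonian p x w τ ≤ ε := by
  have hNx : ‖x‖ < N := IsTrajectoryBound.lt hN hU hglob hx.le
  set B := K N with hB
  have hB1 : 1 ≤ B := hK.one_le N ((norm_nonneg _).trans hNx.le)
  set c := (C + 1) * (B * (1 + B)) with hc
  have hsmall : ∀ {g : ℝ → ℝ} {e : ℝ}, Tendsto g (𝓝 0) (𝓝 0) → 0 < e →
      ∀ᶠ h in 𝓝[>] (0 : ℝ), g h < e := fun hg he =>
    (hg.mono_left nhdsWithin_le_nhds).eventually (gt_mem_nhds he)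
  have hid : Tendsto (fun h : ℝ => h) (𝓝 0) (𝓝 0) := tendsto_id
  have hmul : Tendsto (fun h : ℝ => h * B) (𝓝 0) (𝓝 0) := by simpa using hid.mul_const B
  have herr : Tendsto (fun h : ℝ => c * h + h + B * η (h * B)) (𝓝[>] 0) (𝓝 0) := by
    have := ((hid.const_mul c).add hid).mono_left (nhdsWithin_le_nhds (s := Ioi 0))
    simpa using this.add (tendsto_modulus_mul hη (by linarith : 0 ≤ B))
  obtain ⟨h, h1', h2', h3', h4', hpos⟩ := ((hsmall hid (sub_pos.2 hτ.2)).and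
    ((hsmall hmul (sub_pos.2 hx)).and ((hsmall hmul hε).and
      ((herr.eventually (gt_mem_nhds hε)).and self_mem_nhdsWithin)))).exists
  have hpos' : 0 < h := hpos
  have hτ' : τ ∈ Icc P.t₀ P.T := Ico_subset_Icc_self hτ
  have hτh : τ + h < P.T := by linarith
  -- The tolerance `h * h` remains negligible after division by `h`.
  obtain ⟨u, X, hu, hX, hJ⟩ := exists_cost_lt_value_add hK hU hglob x hτ'
    (by positivity : 0 < h * h)
  have hXN := hN x hx.le τ hτ' u X hu hX
  have hd := norm_spacetime_sub_le hK hτ.1 hpos'.le hτh.le hu hX hXN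
  rw [← hB] at hd
  have hdx : ‖X (τ + h) - x‖ ≤ h * B := (norm_fst_le (X (τ + h) - x, h)).trans hd
  have hXR : ‖X (τ + h)‖ < R := by
    have := norm_le_norm_add_norm_sub' (X (τ + h)) x
    linarith
  have hint : P.spacetime R ∈ 𝓝 (X (τ + h), τ + h) := by
    rw [nhds_prod_eq]
    refine prod_mem_prod ?_ (Icc_mem_nhds (by linarith [hτ.1]) hτh)
    exact mem_of_superset (Metric.isOpen_ball.mem_nhds (mem_ball_zero_iff.2 hXR))
      Metric.ball_subset_closedBall
  -- The supergradient is taken at the end of the short arc, an interior point even when `τ = t₀`.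
  obtain ⟨p, hp, hsup⟩ := hS _ hint
  have hsub : (X (τ + h), τ + h) - (x, τ) = (X (τ + h) - x, h) := by
    rw [Prod.mk_sub_mk, add_sub_cancel_left]
  have hex : ∃ w ∈ P.U, P.preHamiltonian p x w τ ≤ ε := by
    by_contra! hcon
    have e1 := mul_sub_le_of_le_preHamiltonian hK hUc h1 hτ.1 hpos'.le hτh.le hu hX hXN hp
      (c := ε) (fun s hs => (hcon _ (hu.2 s ⟨hs.1, hs.2.trans hτh.le⟩)).le)
    have e2 := integral_add_value_le hK hU hUc h1 hglob hτ.1 hu hX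
      (σ := τ + h) ⟨by linarith, hτh.le⟩
    -- Tested backwards, the inequality bounds the value at `(x, τ)` from above, which combines with
    -- `e2` and near-optimality to contradict `e1`.
    have e3 := hsup (x, τ) ⟨mem_closedBall_zero_iff.2 hx.le, hτ'⟩
    rw [norm_sub_rev, ← neg_sub, map_neg, hsub] at e3
    simp only at e3
    have e4 : ‖(X (τ + h) - x, h)‖ * η ‖(X (τ + h) - x, h)‖ ≤
        h * B * η (h * B) := by
      refine (mul_le_mul_of_nonneg_left (hηm _ _ (norm_nonneg _) hd) (norm_nonneg _)).trans ?_
      refine mul_le_mul_of_nonneg_right hd ?_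
      -- Nonnegativity of `η (h * B)` comes from monotonicity and the limit `0` at `0`.
      have hηB : Tendsto (fun _ : ℝ => η (h * B)) (𝓝[>] 0) (𝓝 (η (h * B))) := tendsto_const_nhds
      refine le_of_tendsto_of_tendsto hη hηB ?_
      filter_upwards [Ioc_mem_nhdsGT (by positivity : 0 < h * B)] with d hd
      exact hηm _ _ hd.1.le hd.2
    rw [← hB, ← hc] at e1
    have e5 : h * (ε - c * h) ≤ h * (h + B * η (h * B)) := by nlinarith
    have e6 := le_of_mul_le_mul_left e5 hpos'
    linarith
  obtain ⟨w, hw, hwε⟩ := hex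
  exact ⟨_, p, w, mem_of_mem_nhds hint, by rw [hsub]; exact hd.trans h3'.le, hp, hw, hsup, hwε⟩

/-- The pre-Hamiltonian is nonnegative at every supergradient of the value function. -/
theorem IsSupergradient.preHamiltonian_nonneg (hK : P.IsLocalBound K) (hU : P.U.Nonempty)
    (hUc : IsCompact P.U) (h1 : P.H1) (hglob : P.HasGlobalTrajectories)
    (hN : P.IsTrajectoryBound R N) (hx : ‖x‖ < R) (hτ : τ ∈ Ico P.t₀ P.T)
    (hηm : ∀ d e, 0 ≤ d → d ≤ e → η d ≤ η e) (hη : Tendsto η (𝓝[>] 0) (𝓝 0))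
    {p : EuclideanSpace ℝ (Fin n) × ℝ →L[ℝ] ℝ}
    (hsup : IsSupergradient (fun z => P.value z.1 z.2) (P.spacetime R) η (x, τ) p)
    {w : EuclideanSpace ℝ (Fin m)} (hw : w ∈ P.U) : 0 ≤ P.preHamiltonian p x w τ := by
  by_contra! hneg
  have hNx : ‖x‖ < N := IsTrajectoryBound.lt hN hU hglob hx.le
  set B := K N with hB
  have hB1 : 1 ≤ B := hK.one_le N ((norm_nonneg _).trans hNx.le)
  set c := (‖p‖ + 1) * (B * (1 + B)) with hc
  have hτ' : τ ∈ Icc P.t₀ P.T := Ico_subset_Icc_self hτ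
  have hu : P.IsAdmissibleControl τ fun _ => w := isAdmissibleControl_const hw τ
  obtain ⟨X, hX⟩ := hglob x τ hτ' _ hu
  have hXN := hN x hx.le τ hτ' _ X hu hX
  have hid : Tendsto (fun h : ℝ => h) (𝓝 0) (𝓝 0) := tendsto_id
  have hmul : Tendsto (fun h : ℝ => h * B) (𝓝 0) (𝓝 0) := by simpa using hid.mul_const B
  have herr : Tendsto (fun h : ℝ => c * h + B * η (h * B)) (𝓝[>] 0) (𝓝 0) := by
    have := (hid.const_mul c).mono_left (nhdsWithin_le_nhds (s := Ioi 0))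
    simpa using this.add (tendsto_modulus_mul hη (by linarith : 0 ≤ B))
  -- `h` is so small that the errors per unit time stay below the supposed deficit.
  obtain ⟨h, h1', h2', h4', hpos⟩ := (((hid.mono_left nhdsWithin_le_nhds).eventually
    (gt_mem_nhds (sub_pos.2 hτ.2))).and (((hmul.mono_left nhdsWithin_le_nhds).eventually
    (gt_mem_nhds (sub_pos.2 hx))).and ((herr.eventually (gt_mem_nhds (neg_pos.2 hneg))).and
      (self_mem_nhdsWithin (s := Ioi 0))))).exists
  have hpos' : 0 < h := hpos
  have hτh : τ + h < P.T := by linarith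
  have hd := norm_spacetime_sub_le hK hτ.1 hpos'.le hτh.le hu hX hXN
  rw [← hB] at hd
  have hdx : ‖X (τ + h) - x‖ ≤ h * B := (norm_fst_le (X (τ + h) - x, h)).trans hd
  have hXR : ‖X (τ + h)‖ ≤ R := by
    have := norm_le_norm_add_norm_sub' (X (τ + h)) x
    linarith
  have hsub : (X (τ + h), τ + h) - (x, τ) = (X (τ + h) - x, h) := by
    rw [Prod.mk_sub_mk, add_sub_cancel_left]
  have e1 := le_mul_add_of_preHamiltonian_le hK hUc h1 hτ.1 hpos'.le hτh.le hu hX hXN le_rfl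
    (p := p) (c := P.preHamiltonian p x w τ) (fun s hs => le_rfl)
  have e2 := value_le_integral_add_value hK hU hUc h1 hglob hτ.1 hu hX
    (σ := τ + h) ⟨by linarith, hτh.le⟩
  have e3 := hsup (X (τ + h), τ + h) ⟨mem_closedBall_zero_iff.2 hXR, by linarith [hτ.1], hτh.le⟩
  rw [hsub] at e3
  simp only at e3
  have e4 : ‖(X (τ + h) - x, h)‖ * η ‖(X (τ + h) - x, h)‖ ≤ h * B * η (h * B) := by
    refine (mul_le_mul_of_nonneg_left (hηm _ _ (norm_nonneg _) hd) (norm_nonneg _)).trans ?_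
    refine mul_le_mul_of_nonneg_right hd ?_
    have hηB : Tendsto (fun _ : ℝ => η (h * B)) (𝓝[>] 0) (𝓝 (η (h * B))) := tendsto_const_nhds
    refine le_of_tendsto_of_tendsto hη hηB ?_
    filter_upwards [Ioc_mem_nhdsGT (by positivity : 0 < h * B)] with d hd
    exact hηm _ _ hd.1.le hd.2
  rw [← hB, ← hc] at e1
  have e5 : h * 0 ≤ h * (P.preHamiltonian p x w τ + (c * h + B * η (h * B))) := by nlinarith
  have e6 := le_of_mul_le_mul_left e5 hpos'
  linarith

end

/-! ### Supergradients of the value function and the extended solution -/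

section

variable {x : EuclideanSpace ℝ (Fin n)} {τ C R N : ℝ} {K η : ℝ → ℝ}

theorem convex_spacetime (R : ℝ) : Convex ℝ (P.spacetime R) :=
  (convex_closedBall _ _).prod (convex_Icc _ _)

theorem tendsto_clm_apply {E : Type*} [NormedAddCommGroup E] [NormedSpace ℝ E] {α : Type*}
    {l : Filter α} {p : α → E →L[ℝ] ℝ} {y : α → E} {q : E →L[ℝ] ℝ} {z : E}
    (hp : Tendsto p l (𝓝 q)) (hy : Tendsto y l (𝓝 z)) :
    Tendsto (fun k => p k (y k)) l (𝓝 (q z)) :=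
  (isBoundedBilinearMap_apply.continuous.tendsto (q, z)).comp (hp.prodMk_nhds hy)

/-- There is a supergradient of the value function for which the pre-Hamiltonian is nonpositive at
some control value. -/
theorem exists_supergradient_preHamiltonian_nonpos (hK : P.IsLocalBound K) (hU : P.U.Nonempty)
    (hUc : IsCompact P.U) (h1 : P.H1) (hglob : P.HasGlobalTrajectories)
    (hN : P.IsTrajectoryBound R N) (hx : ‖x‖ < R) (hτ : τ ∈ Ico P.t₀ P.T)
    (hηm : ∀ d e, 0 ≤ d → d ≤ e → η d ≤ η e) (hη : Tendsto η (𝓝[>] 0) (𝓝 0))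
    (hLip : ∀ a ∈ P.spacetime R, ∀ b ∈ P.spacetime R,
      |P.value a.1 a.2 - P.value b.1 b.2| ≤ C * ‖a - b‖)
    (hS : ∀ a, P.spacetime R ∈ 𝓝 a → ∃ p, ‖p‖ ≤ C ∧
      IsSupergradient (fun z => P.value z.1 z.2) (P.spacetime R) η a p) :
    ∃ p w, w ∈ P.U ∧ IsSupergradient (fun z => P.value z.1 z.2) (P.spacetime R)
      (fun d => η (2 * d)) (x, τ) p ∧ P.preHamiltonian p x w τ ≤ 0 := by
  have hτ' : τ ∈ Icc P.t₀ P.T := Ico_subset_Icc_self hτ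
  have hxΩ : (x, τ) ∈ P.spacetime R := ⟨mem_closedBall_zero_iff.2 hx.le, hτ'⟩
  choose a p w ha haε hp hw hsup hpre using fun k : ℕ =>
    exists_approx_supergradient hK hU hUc h1 hglob hN hx hτ hηm hη hS
      (Nat.one_div_pos_of_nat (α := ℝ) (n := k))
  have hε := tendsto_one_div_add_atTop_nhds_zero_nat (𝕜 := ℝ)
  have hnorm : Tendsto (fun k => ‖a k - (x, τ)‖) atTop (𝓝 0) :=
    squeeze_zero (fun _ => norm_nonneg _) haε hε
  have ha0 : Tendsto a atTop (𝓝 (x, τ)) := tendsto_iff_norm_sub_tendsto_zero.2 hnorm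
  have hW : Tendsto (fun k => P.value (a k).1 (a k).2) atTop (𝓝 (P.value x τ)) := by
    rw [tendsto_iff_norm_sub_tendsto_zero]
    refine squeeze_zero (fun _ => norm_nonneg _) (fun k => hLip (a k) (ha k) (x, τ) hxΩ) ?_
    simpa using hnorm.const_mul C
  have : ProperSpace (EuclideanSpace ℝ (Fin n) × ℝ →L[ℝ] ℝ) := FiniteDimensional.proper ℝ _
  obtain ⟨⟨q, v⟩, ⟨-, hv⟩, φ, hφ, hlim⟩ := ((isCompact_closedBall
    (0 : EuclideanSpace ℝ (Fin n) × ℝ →L[ℝ] ℝ) C).prod hUc).tendsto_subseq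
    (x := fun k => (p k, w k)) (fun k => ⟨mem_closedBall_zero_iff.2 (hp k), hw k⟩)
  rw [nhds_prod_eq, tendsto_prod_iff'] at hlim
  have hq : Tendsto (fun k => p (φ k)) atTop (𝓝 q) := hlim.1
  have hwv : Tendsto (fun k => w (φ k)) atTop (𝓝 v) := hlim.2
  have hφt := hφ.tendsto_atTop
  refine ⟨q, v, hv, fun b hb => ?_, ?_⟩
  · rcases eq_or_ne b (x, τ) with rfl | hne
    · simp
    · have hpos : 0 < ‖b - (x, τ)‖ := norm_pos_iff.2 (sub_ne_zero.2 hne)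
      have hsub : Tendsto (fun k => b - a (φ k)) atTop (𝓝 (b - (x, τ))) :=
        (ha0.comp hφt).const_sub b
      refine ge_of_tendsto (((hW.comp hφt).add (tendsto_clm_apply hq hsub)).add
        (hsub.norm.mul_const (η (2 * ‖b - (x, τ)‖)))) ?_
      -- For large `k` the distance from `b` to the base point is below twice its limit.
      -- Monotonicity of `η` then replaces continuity, at the price of the factor `2` in the error.
      filter_upwards [hsub.norm.eventually (gt_mem_nhds (by linarith :
        ‖b - (x, τ)‖ < 2 * ‖b - (x, τ)‖))] with k hk
      refine (hsup (φ k) b hb).trans ?_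
      simp only [Function.comp]
      exact add_le_add_right
        (mul_le_mul_of_nonneg_left (hηm _ _ (norm_nonneg _) hk.le) (norm_nonneg _)) _
  · have hwU : Tendsto (fun k => w (φ k)) atTop (𝓝[P.U] v) :=
      tendsto_nhdsWithin_iff.2 ⟨hwv, Eventually.of_forall fun k => hw _⟩
    have hmaps : MapsTo (fun w => (x, w, τ)) P.U (univ ×ˢ P.U ×ˢ Icc P.t₀ P.T) :=
      fun w hw => ⟨mem_univ _, hw, hτ'⟩
    have hcont : ContinuousOn (fun w => (x, w, τ)) P.U := by fun_prop
    have hf : Tendsto (fun k => P.f x (w (φ k)) τ) atTop (𝓝 (P.f x v τ)) :=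
      ((h1.1.comp hcont hmaps) v hv).tendsto.comp hwU
    have hF : Tendsto (fun k => P.F x (w (φ k)) τ) atTop (𝓝 (P.F x v τ)) :=
      ((h1.2.1.comp hcont hmaps) v hv).tendsto.comp hwU
    exact le_of_tendsto_of_tendsto ((tendsto_clm_apply hq (hf.prodMk_nhds tendsto_const_nhds)).add hF)
      (hε.comp hφt) (Eventually.of_forall fun k => hpre (φ k))

theorem tendsto_norm_sub_nhdsGT {E : Type*} [NormedAddCommGroup E] (a : E) :
    Tendsto (fun y => ‖y - a‖) (𝓝[≠] a) (𝓝[>] 0) := by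
  refine tendsto_nhdsWithin_iff.2 ⟨?_, ?_⟩
  · have : Tendsto (fun y => ‖y - a‖) (𝓝 a) (𝓝 ‖a - a‖) := by
      have hc : Continuous fun y => ‖y - a‖ := by fun_prop
      exact hc.tendsto a
    rw [sub_self, norm_zero] at this
    exact this.mono_left nhdsWithin_le_nhds
  · filter_upwards [self_mem_nhdsWithin] with y hy
    exact norm_pos_iff.2 (sub_ne_zero.2 hy)

/-- The partial superdifferentials contain the components of a supergradient. -/
theorem IsSupergradient.mem_superdiff (hη : Tendsto η (𝓝[>] 0) (𝓝 0)) (hx : ‖x‖ < R)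
    (hτ : τ ∈ Icc P.t₀ P.T) {p : EuclideanSpace ℝ (Fin n) × ℝ →L[ℝ] ℝ}
    {v : EuclideanSpace ℝ (Fin n) → ℝ → ℝ}
    (hsup : IsSupergradient (fun z => v z.1 z.2) (P.spacetime R) η (x, τ) p) :
    (∀ p₁ : EuclideanSpace ℝ (Fin n), (∀ y, inner ℝ p₁ y = p (y, 0)) → p₁ ∈ superdiffX v x τ) ∧
    p (0, 1) ∈ superdiffTime P.t₀ P.T v x τ := by
  refine ⟨fun p₁ hp₁ => limsup_coe_le_zero fun ε hε => ?_, limsup_coe_le_zero fun ε hε => ?_⟩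
  · filter_upwards [(hη.comp (tendsto_norm_sub_nhdsGT x)).eventually (gt_mem_nhds hε),
      nhdsWithin_le_nhds (Metric.isOpen_ball.mem_nhds (mem_ball_zero_iff.2 hx)),
      self_mem_nhdsWithin] with y hy hyR hyx
    have hpos : 0 < ‖y - x‖ := norm_pos_iff.2 (sub_ne_zero.2 hyx)
    have h := hsup (y, τ) ⟨Metric.ball_subset_closedBall hyR, hτ⟩
    have e1 : ((y, τ) : EuclideanSpace ℝ (Fin n) × ℝ) - (x, τ) = (y - x, 0) := by
      rw [Prod.mk_sub_mk, sub_self]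
    have e2 : ‖((y - x, 0) : EuclideanSpace ℝ (Fin n) × ℝ)‖ = ‖y - x‖ := by
      rw [Prod.norm_mk, norm_zero, max_eq_left (norm_nonneg _)]
    rw [e1, e2, ← hp₁] at h
    simp only [Function.comp] at h hy
    rw [div_le_iff₀ hpos]
    have := mul_le_mul_of_nonneg_left hy.le hpos.le
    linarith
  · have hmono : 𝓝[Icc P.t₀ P.T \ {τ}] τ ≤ 𝓝[≠] τ := nhdsWithin_mono _ fun t ht => ht.2
    filter_upwards [hmono ((hη.comp (tendsto_norm_sub_nhdsGT τ)).eventually (gt_mem_nhds hε)),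
      self_mem_nhdsWithin] with t ht htm
    have hpos : 0 < |t - τ| := abs_pos.2 (sub_ne_zero.2 htm.2)
    have h := hsup (x, t) ⟨mem_closedBall_zero_iff.2 hx.le, htm.1⟩
    have e1 : ((x, t) : EuclideanSpace ℝ (Fin n) × ℝ) - (x, τ) = (0, t - τ) := by
      rw [Prod.mk_sub_mk, sub_self]
    have e2 : ‖((0, t - τ) : EuclideanSpace ℝ (Fin n) × ℝ)‖ = |t - τ| := by
      rw [Prod.norm_mk, norm_zero, Real.norm_eq_abs, max_eq_right (abs_nonneg _)]
    have e3 : p (0, t - τ) = (t - τ) * p (0, 1) := by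
      rw [apply_eq_add_mul]
      have : ((0, 0) : EuclideanSpace ℝ (Fin n) × ℝ) = 0 := rfl
      rw [this, map_zero, zero_add]
    rw [e1, e2, e3] at h
    simp only [Function.comp, Real.norm_eq_abs] at h ht
    rw [div_le_iff₀ hpos]
    have := mul_le_mul_of_nonneg_left ht.le hpos.le
    linarith

/-- Supergradients of the value function exist in the interior of the space-time region. -/
theorem exists_value_supergradient (hK : P.IsLocalBound K) (hU : P.U.Nonempty)
    (hUc : IsCompact P.U) (h1 : P.H1) (h3 : P.H3) (h4 : P.H4) (hglob : P.HasGlobalTrajectories)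
    (R : ℝ) :
    ∃ (C : ℝ) (η : ℝ → ℝ), (∀ d e, 0 ≤ d → d ≤ e → η d ≤ η e) ∧ Tendsto η (𝓝[>] 0) (𝓝 0) ∧
      (∀ a ∈ P.spacetime R, ∀ b ∈ P.spacetime R,
        |P.value a.1 a.2 - P.value b.1 b.2| ≤ C * ‖a - b‖) ∧
      ∀ a, P.spacetime R ∈ 𝓝 a → ∃ p, ‖p‖ ≤ C ∧
        IsSupergradient (fun z => P.value z.1 z.2) (P.spacetime R) η a p := by
  obtain ⟨C, hC, hLip⟩ := exists_value_lipschitz hK hU hUc h1 hglob R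
  obtain ⟨η, hη0, hηm, hη, hsc⟩ := exists_value_semiconcave hK hU hUc h1 h3 h4 hglob R
  -- The estimates use the sum of the two distances, the product norm is their maximum; all factors
  -- `2` below come from this.
  have hdist : ∀ a b : EuclideanSpace ℝ (Fin n) × ℝ, |a.2 - b.2| + ‖a.1 - b.1‖ ≤ 2 * ‖a - b‖ :=
    fun a b => by
      have e1 := norm_fst_le (a - b)
      have e2 := norm_snd_le (a - b)
      rw [Prod.fst_sub] at e1
      rw [Prod.snd_sub, Real.norm_eq_abs] at e2
      linarith
  have hLip' : ∀ a ∈ P.spacetime R, ∀ b ∈ P.spacetime R,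
      |P.value a.1 a.2 - P.value b.1 b.2| ≤ C * 2 * ‖a - b‖ := fun a ha b hb => by
    refine (hLip a.1 b.1 (mem_closedBall_zero_iff.1 ha.1) (mem_closedBall_zero_iff.1 hb.1)
      a.2 ha.2 b.2 hb.2).trans ?_
    rw [mul_assoc]
    exact mul_le_mul_of_nonneg_left (hdist a b) hC
  have hη' : Tendsto (fun d => 2 * η (d * 2)) (𝓝[>] 0) (𝓝 0) := tendsto_modulus_mul hη two_pos.le
  have hηm' : ∀ d e, 0 ≤ d → d ≤ e → 2 * η (d * 2) ≤ 2 * η (e * 2) := fun d e hd hde =>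
    mul_le_mul_of_nonneg_left (hηm _ _ (by linarith) (by linarith)) two_pos.le
  have hsc' : ∀ a ∈ P.spacetime R, ∀ b ∈ P.spacetime R, ∀ l ∈ Icc (0 : ℝ) 1,
      l * P.value a.1 a.2 + (1 - l) * P.value b.1 b.2
        - P.value (l • a + (1 - l) • b).1 (l • a + (1 - l) • b).2 ≤
      l * (1 - l) * ‖a - b‖ * (2 * η (‖a - b‖ * 2)) := by
    intro a ha b hb l hl
    have e0 : l • a + (1 - l) • b =
        (l • a.1 + (1 - l) • b.1, l * a.2 + (1 - l) * b.2) := rfl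
    rw [e0]
    refine (hsc a.1 b.1 (mem_closedBall_zero_iff.1 ha.1) (mem_closedBall_zero_iff.1 hb.1)
      a.2 ha.2 b.2 hb.2 l hl).trans ?_
    have hA : 0 ≤ l * (1 - l) := mul_nonneg hl.1 (sub_nonneg.2 hl.2)
    have hd0 : 0 ≤ |a.2 - b.2| + ‖a.1 - b.1‖ := by positivity
    have e1 := hηm _ _ hd0 (hdist a b)
    have e2 := mul_le_mul (hdist a b) e1 (hη0 _ hd0) (by positivity)
    have e3 := mul_le_mul_of_nonneg_left e2 hA
    rw [mul_comm 2 ‖a - b‖] at e3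
    linarith
  have hη0' : ∀ d, 0 ≤ d → 0 ≤ 2 * η (d * 2) := fun d hd =>
    mul_nonneg two_pos.le (hη0 _ (by linarith))
  refine ⟨C * 2, fun d => 2 * η (d * 2), hηm', hη', hLip', fun a ha => ?_⟩
  have hC' : 0 ≤ C * 2 := by positivity
  exact _root_.exists_supergradient (Ω := P.spacetime R) (W := fun z => P.value z.1 z.2)
    (C := C * 2) (η := fun d => 2 * η (d * 2)) (x := a) (convex_spacetime R) hC' hLip' hη0' hη'
    hsc' ha

/-- With `p₁` the Riesz representative of the spatial part, the Hamiltonian at `-p₁` is `p (0, 1)`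
minus a pre-Hamiltonian that is nonnegative on `U` and zero at `w`. -/
theorem exists_value_superdiff (hK : P.IsLocalBound K) (hU : P.U.Nonempty)
    (hUc : IsCompact P.U) (h1 : P.H1) (h3 : P.H3) (h4 : P.H4) (hglob : P.HasGlobalTrajectories)
    (x : EuclideanSpace ℝ (Fin n)) (hτ : τ ∈ Ico P.t₀ P.T) :
    ∃ p : EuclideanSpace ℝ (Fin n), -p ∈ superdiffX P.value x τ ∧
      ∃ u ∈ P.U, (∀ w ∈ P.U, P.hamiltonian x p w τ ≤ P.hamiltonian x p u τ) ∧
        P.hamiltonian x p u τ ∈ superdiffTime P.t₀ P.T P.value x τ := by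
  set R := ‖x‖ + 1 with hR
  have hx : ‖x‖ < R := lt_add_one _
  have hτ' : τ ∈ Icc P.t₀ P.T := Ico_subset_Icc_self hτ
  obtain ⟨N, hN⟩ := exists_trajectory_bound hK hU hglob R
  obtain ⟨C, η, hηm, hη, hLip, hS⟩ := exists_value_supergradient hK hU hUc h1 h3 h4 hglob R
  obtain ⟨p, w, hw, hsup, hpre⟩ := exists_supergradient_preHamiltonian_nonpos hK hU hUc h1 hglob
    hN hx hτ hηm hη hLip hS
  have hη₂ : Tendsto (fun d : ℝ => η (2 * d)) (𝓝[>] 0) (𝓝 0) := by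
    have := (tendsto_modulus_mul hη two_pos.le).const_mul (1 / 2 : ℝ)
    simp only [mul_zero] at this
    refine this.congr fun d => ?_
    rw [mul_comm d 2]
    ring
  have hηm₂ : ∀ d e : ℝ, 0 ≤ d → d ≤ e → η (2 * d) ≤ η (2 * e) :=
    fun d e hd hde => hηm _ _ (by linarith) (by linarith)
  have hnonneg : ∀ w ∈ P.U, 0 ≤ P.preHamiltonian p x w τ := fun w hw =>
    hsup.preHamiltonian_nonneg hK hU hUc h1 hglob hN hx hτ hηm₂ hη₂ hw
  obtain ⟨hX, hT⟩ := hsup.mem_superdiff hη₂ hx hτ'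
  set p₁ : EuclideanSpace ℝ (Fin n) := (InnerProductSpace.toDual ℝ _).symm
    (p.comp (ContinuousLinearMap.inl ℝ _ ℝ)) with hp₁def
  have hp₁ : ∀ y, inner ℝ p₁ y = p (y, 0) := fun y => by
    rw [hp₁def, InnerProductSpace.toDual_symm_apply]; rfl
  have hham : ∀ w, P.hamiltonian x (-p₁) w τ = p (0, 1) - P.preHamiltonian p x w τ := fun w => by
    rw [hamiltonian, preHamiltonian, apply_eq_add_mul (P.f x w τ) 1, inner_neg_left, hp₁]
    ring
  have hz : P.preHamiltonian p x w τ = 0 := le_antisymm hpre (hnonneg w hw)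
  refine ⟨-p₁, by rw [neg_neg]; exact hX p₁ hp₁, w, hw, fun w' hw' => ?_, ?_⟩
  · rw [hham, hham, hz]
    linarith [hnonneg w' hw']
  · rw [hham, hz, sub_zero]
    exact hT

/-- The value vanishes on the whole terminal slice, so the costate `0` is admissible and maximising
the Hamiltonian means minimising `F` over `U`. Running the minimiser as a constant control from time
`t` bounds the value by `(T - t) * (F x u T + O(T - t))`, the left-sided superdifferential
inequality. -/
theorem exists_value_superdiff_terminal (hK : P.IsLocalBound K) (hU : P.U.Nonempty)
    (hUc : IsCompact P.U) (h1 : P.H1) (hglob : P.HasGlobalTrajectories)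
    (x : EuclideanSpace ℝ (Fin n)) :
    ∃ p : EuclideanSpace ℝ (Fin n), -p ∈ superdiffX P.value x P.T ∧
      ∃ u ∈ P.U, (∀ w ∈ P.U, P.hamiltonian x p w P.T ≤ P.hamiltonian x p u P.T) ∧
        P.hamiltonian x p u P.T ∈ superdiffTime P.t₀ P.T P.value x P.T := by
  have hT : P.T ∈ Icc P.t₀ P.T := ⟨P.t₀_lt_T.le, le_rfl⟩
  have hcont : ContinuousOn (fun w => P.F x w P.T) P.U :=
    h1.2.1.comp (f := fun w => (x, w, P.T)) (by fun_prop) fun w hw => ⟨mem_univ _, hw, hT⟩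
  obtain ⟨u, hu, hmin⟩ := hUc.exists_isMinOn hU hcont
  obtain ⟨N, hN⟩ := exists_trajectory_bound hK hU hglob ‖x‖
  have hham : ∀ w, P.hamiltonian x 0 w P.T = -P.F x w P.T := fun w => by
    rw [hamiltonian, inner_zero_left, zero_sub]
  refine ⟨0, ?_, u, hu, fun w hw => ?_, ?_⟩
  · refine limsup_coe_le_zero fun ε hε => Eventually.of_forall fun y => ?_
    simp [value_terminal hK hU hglob, hε.le]
  · rw [hham, hham]
    exact neg_le_neg (hmin hw)
  · rw [hham]
    refine limsup_coe_le_zero fun ε hε => ?_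
    have hxN : ‖x‖ < N := IsTrajectoryBound.lt hN hU hglob le_rfl
    have hK1 := hK.one_le N ((norm_nonneg _).trans hxN.le)
    set c := K N * (1 + K N) with hc
    have hlim : Tendsto (fun t => c * (P.T - t)) (𝓝 P.T) (𝓝 0) := by
      have h : Continuous fun t => c * (P.T - t) := by fun_prop
      simpa using h.tendsto P.T
    filter_upwards [(hlim.mono_left nhdsWithin_le_nhds).eventually (gt_mem_nhds hε),
      self_mem_nhdsWithin] with t ht htm
    have htT : t < P.T := lt_of_le_of_ne htm.1.2 htm.2
    have hadm : P.IsAdmissibleControl t fun _ => u := isAdmissibleControl_const hu t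
    obtain ⟨X, hX⟩ := hglob x t htm.1 _ hadm
    have hXN := hN x le_rfl t htm.1 _ X hadm hX
    have hle := value_le hK hU hglob htm.1 hadm hX
    have hmono := intervalIntegral.integral_mono_on htT.le
      (hX.integrable_cost hUc h1 hadm htm.1.1 le_rfl htT.le le_rfl)
      (intervalIntegrable_const (c := P.F x u P.T + ε)) (fun s hs => by
        have e1 := hX.norm_sub_start_le hK htm.1.1 hadm hXN hs
        have e2 := hK.F_sub_le (hXN s hs) hxN hu (t := s) (s := P.T)
          ⟨htm.1.1.trans hs.1, hs.2⟩ hT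
        rw [abs_sub_comm s, abs_of_nonneg (sub_nonneg.2 hs.2)] at e2
        have e3 : P.T - s + ‖X s - x‖ ≤ (1 + K N) * (P.T - t) := by
          nlinarith [hs.1, hs.2]
        have e4 := mul_le_mul_of_nonneg_left e3 (by linarith : 0 ≤ K N)
        have e5 := (abs_le.1 e2).2
        rw [← mul_assoc, ← hc] at e4
        linarith)
    rw [intervalIntegral.integral_const, smul_eq_mul] at hmono
    have hpos : 0 < P.T - t := sub_pos.2 htT
    rw [value_terminal hK hU hglob, abs_sub_comm, abs_of_pos hpos, div_le_iff₀ hpos]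
    linarith

theorem continuousOn_value (hK : P.IsLocalBound K) (hU : P.U.Nonempty)
    (hUc : IsCompact P.U) (h1 : P.H1) (hglob : P.HasGlobalTrajectories) :
    ContinuousOn (fun z : EuclideanSpace ℝ (Fin n) × ℝ => P.value z.1 z.2)
      (univ ×ˢ Icc P.t₀ P.T) := by
  rintro ⟨x, τ⟩ ⟨-, hτ⟩
  obtain ⟨C, hC, hLip⟩ := exists_value_lipschitz hK hU hUc h1 hglob (‖x‖ + 1)
  rw [ContinuousWithinAt, tendsto_iff_norm_sub_tendsto_zero]
  have hlim : Tendsto (fun z : EuclideanSpace ℝ (Fin n) × ℝ => C * (|z.2 - τ| + ‖z.1 - x‖))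
      (𝓝 (x, τ)) (𝓝 0) := by
    have h : Continuous fun z : EuclideanSpace ℝ (Fin n) × ℝ => C * (|z.2 - τ| + ‖z.1 - x‖) := by
      fun_prop
    simpa using h.tendsto (x, τ)
  refine squeeze_zero' (Eventually.of_forall fun _ => norm_nonneg _) ?_
    (hlim.mono_left nhdsWithin_le_nhds)
  have hball : ∀ᶠ z : EuclideanSpace ℝ (Fin n) × ℝ in 𝓝 (x, τ), ‖z.1‖ < ‖x‖ + 1 := by
    have h : Continuous fun z : EuclideanSpace ℝ (Fin n) × ℝ => ‖z.1‖ := by fun_prop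
    exact (h.tendsto (x, τ)).eventually (gt_mem_nhds (lt_add_one ‖x‖))
  filter_upwards [nhdsWithin_le_nhds hball, self_mem_nhdsWithin] with z hz hzm
  exact hLip z.1 x hz.le (by linarith) z.2 hzm.2 τ hτ

end

end LagrangeOCP

/-- The value function is well defined (the infimum of the costs is a finite infimum at every initial
datum) and is an extended solution of the Hamilton-Jacobi-Bellman equation. -/
theorem theorem2p1 {n m : ℕ} (P : LagrangeOCP n m)
    (hU : P.U.Nonempty) (hUc : IsCompact P.U)
    (h1 : P.H1) (h2 : P.H2) (h3 : P.H3) (h4 : P.H4)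
    (hglob : P.HasGlobalTrajectories) :
    (∀ x : EuclideanSpace ℝ (Fin n), ∀ τ ∈ Set.Icc P.t₀ P.T,
      IsGLB (P.costSet x τ) (P.value x τ)) ∧
    P.IsExtendedSolution P.value := by
  obtain ⟨K, hK⟩ := LagrangeOCP.exists_isLocalBound h1 h2
  refine ⟨fun x τ hτ => LagrangeOCP.isGLB_value hK hU hglob hτ,
    LagrangeOCP.continuousOn_value hK hU hUc h1 hglob, fun x τ hτ => ?_,
    LagrangeOCP.value_terminal hK hU hglob⟩
  -- The supergradient argument needs room to move forward in time.
  rcases hτ.2.eq_or_lt with rfl | hlt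
  · exact LagrangeOCP.exists_value_superdiff_terminal hK hU hUc h1 hglob x
  · exact LagrangeOCP.exists_value_superdiff hK hU hUc h1 h3 h4 hglob x ⟨hτ.1, hlt⟩
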